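/- Let $m>1$ be an integer with $m\not\equiv 2\pmod 4$, and write $m=q_1\cdots q_t$ with $q_1,\dots,q_t$ pairwise coprime prime powers, in any fixed order. Let $G_m=\mathrm{Gal}(\mathbb{Q}(\zeta_m)/\mathbb{Q})$ with $\zeta_m=e^{2\pi i/m}$, let $N_m=\sum_{\tau\in G_m}\tau$, let $\sigma_{s,m}\in G_m$ be the automorphism raising $m$th roots of unity to the $s$th power, and for $a\in\mathbb{Z}$ put $$\theta_m(a)=\sum_{0<s\le m,\ (s,m)=1}\Bigl\langle-\frac{as}{m}\Bigr\rangle\sigma_{s,m}^{-1}\in\mathbb{Q}[G_m],\qquad \omega_m(a)=\begin{cases}\theta_m(a)-\tfrac12N_m & \text{if } m\nmid a,\\ 0&\text{if } m\mid a,\end{cases}$$ where $\langle x\rangle$ is the fractional part of $x$ ($\theta_n$ is defined likewise for every $n\ge1$). Let $S'_m$ be the additive subgroup of $\mathbb{Q}[G_m]$ generated by all elements $$\mathrm{cor}_{\mathbb{Q}(\zeta_m)/\mathbb{Q}(\zeta_{(m,n)})}\bigl(\mathrm{res}_{\mathbb{Q}(\zeta_n)/\mathbb{Q}(\zeta_{(m,n)})}(\theta_n(a))\bigr),\qquad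 a,n\in\mathbb{Z},\ n>0,$$ where, for $d\mid n$, $\mathrm{res}_{\mathbb{Q}(\zeta_n)/\mathbb{Q}(\zeta_d)}:\mathbb{Q}[G_n]\to\mathbb{Q}[G_d]$ is the ring homomorphism induced by restriction of automorphisms and, for $d\mid m$, $\mathrm{cor}_{\mathbb{Q}(\zeta_m)/\mathbb{Q}(\zeta_d)}:\mathbb{Q}[G_d]\to\mathbb{Q}[G_m]$ is the linear map sending $\tau\in G_d$ to the sum of all $\sigma\in G_m$ with $\sigma|_{\mathbb{Q}(\zeta_d)}=\tau$. Let $X_m=\{a\in\mathbb{Z}: 0<a<m,\ (a,\tfrac{m}{(a,m)})=1\}$, and let $M_m$ be the set of all $a\in X_m$ such that - for all $i$, if $q_i\nmid a$ then $a\not\equiv-(a,m)\pmod{q_i}$; - if $a\nmid m$ and $k=\max\{i: a\not\equiv(a,m)\pmod{q_i}\}$, then $\bigl\langle\tfrac{a}{(a,m)q_k}\bigr\rangle<\tfrac12$; - if $a\mid m$, then the number of $i$ with $q_i\nmid a$ is odd. Put $$M'_m=\{a\in M_m:\ \tfrac{m}{q_i}\nmid a\text{ for all }i\}\ \cup\ \bigcup_{i=1}^t\bigl\{\tfrac{m}{q_i}b:\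 1\le b\le\tfrac{\varphi(q_i)}2\bigr\}.$$ For $0<b<m$ let $r_b$ be the product of all $q_i$ that divide $b$ (equivalently, the largest divisor $r$ of $(b,m)$ with $(r,\tfrac mr)=1$). Then: 1. The elements $\omega_m(a)$, $a\in M'_m$, together with $\tfrac12N_m$, form a $\mathbb{Z}$-basis of $S'_m$. Moreover, for every integer $0<b<m$, $\omega_m(b)\in S'_m$, and when $\omega_m(b)$ is written in this basis, the coefficient of $\omega_m(a)$ is zero for every $a\in M'_m$ with $r_b\nmid a$. 2. The elements $\theta_m(a)$, $a\in M'_m$, together with $\tfrac12N_m$, form a $\mathbb{Z}$-basis of $S'_m$. Moreover, for every integer $0<b<m$, $\theta_m(b)\in S'_m$, and when $\theta_m(b)$ is written in this basis, the coefficient of $\theta_m(a)$ is zero for every $a\in M'_m$ with $r_b\nmid a$. -/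

import Mathlib

namespace Stickelberger

noncomputable section

section CyclotomicFields

open scoped Classical

/-- The `m`th cyclotomic field `ℚ(ζ_m)`, where `ζ_m = exp (2πi/m)`, as a subfield of `ℂ`. -/
abbrev cycField (m : ℕ) : IntermediateField ℚ ℂ :=
  IntermediateField.adjoin ℚ {Complex.exp (2 * Real.pi * Complex.I / m)}

instance cycField_isCyclotomicExtension (m : ℕ) [NeZero m] :
    IsCyclotomicExtension {m} ℚ (cycField m) := by
  have hζ := Complex.isPrimitiveRoot_exp m (NeZero.ne m)
  change IsCyclotomicExtension {m} ℚ (cycField m).toSubalgebra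
  rw [IntermediateField.adjoin_simple_toSubalgebra_of_isAlgebraic
    (hζ.isIntegral (NeZero.pos m)).tower_top.isAlgebraic]
  exact hζ.adjoin_isCyclotomicExtension ℚ

instance cycField_finiteDimensional (m : ℕ) [NeZero m] : FiniteDimensional ℚ (cycField m) :=
  IsCyclotomicExtension.finiteDimensional {m} ℚ (cycField m)

instance cycField_numberField (m : ℕ) [NeZero m] : NumberField (cycField m) where

instance cycField_isGalois (m : ℕ) [NeZero m] : IsGalois ℚ (cycField m) :=
  IsCyclotomicExtension.isGalois {m} ℚ (cycField m)

instance neZero_gcd (m n : ℕ) [NeZero m] : NeZero (Nat.gcd m n) :=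
  ⟨fun h => NeZero.ne m (Nat.gcd_eq_zero_iff.mp h).1⟩

/-- The Galois group of `ℚ(ζ_m)` over `ℚ`. -/
abbrev G (m : ℕ) : Type := Gal(cycField m/ℚ)

/-- The rational group ring `ℚ[G m]`. -/
abbrev QG (m : ℕ) : Type := MonoidAlgebra ℚ (G m)

theorem cycField_le {m n : ℕ} [NeZero m] (h : n ∣ m) : cycField n ≤ cycField m := by
  have hm : (m : ℂ) ≠ 0 := Nat.cast_ne_zero.mpr (NeZero.ne m)
  obtain ⟨d, rfl⟩ := h
  rw [Nat.cast_mul] at hm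
  have hn : (n : ℂ) ≠ 0 := left_ne_zero_of_mul hm
  have hd : (d : ℂ) ≠ 0 := right_ne_zero_of_mul hm
  rw [IntermediateField.adjoin_simple_le_iff]
  have key : Complex.exp (2 * Real.pi * Complex.I / n) =
      Complex.exp (2 * Real.pi * Complex.I / (n * d : ℕ)) ^ d := by
    rw [← Complex.exp_nat_mul]
    congr 1
    push_cast
    field_simp
  rw [key]
  exact pow_mem (IntermediateField.mem_adjoin_simple_self ℚ _) d

/-- The restriction homomorphism `Gal(E/ℚ) → Gal(F/ℚ)` for subfields `F ≤ E` of `ℂ`,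
`F` normal over `ℚ`. -/
def restrictAux {E F : IntermediateField ℚ ℂ} [Normal ℚ F] (h : F ≤ E) :
    Gal(E/ℚ) →* Gal(F/ℚ) :=
  letI : Algebra F E := (IntermediateField.inclusion h).toRingHom.toAlgebra
  haveI : IsScalarTower ℚ F E := IsScalarTower.of_algebraMap_eq fun _ => rfl
  AlgEquiv.restrictNormalHom F

theorem restrictAux_apply {E F : IntermediateField ℚ ℂ} [Normal ℚ F] (h : F ≤ E)
    (σ : Gal(E/ℚ)) (x : F) :
    ((restrictAux h σ x : F) : ℂ) = (σ (IntermediateField.inclusion h x) : E) := by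
  let : Algebra F E := (IntermediateField.inclusion h).toRingHom.toAlgebra
  have : IsScalarTower ℚ F E := IsScalarTower.of_algebraMap_eq fun _ => rfl
  have key := AlgEquiv.restrictNormal_commutes σ F x
  exact congrArg (fun y : E => (y : ℂ)) key

/-- The restriction homomorphism `σ ↦ σ|_{ℚ(ζ_n)}`, for `n ∣ m`. -/
def restrictGal (m n : ℕ) [NeZero m] [NeZero n] (h : n ∣ m) : G m →* G n :=
  restrictAux (cycField_le h)

theorem restrictGal_apply (m n : ℕ) [NeZero m] [NeZero n] (h : n ∣ m) (σ : G m)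
    (x : cycField n) :
    ((restrictGal m n h σ x : cycField n) : ℂ) =
      (σ (IntermediateField.inclusion (cycField_le h) x) : cycField m) :=
  restrictAux_apply (cycField_le h) σ x

/-- The automorphism of `ℚ(ζ_m)` raising every `m`th root of unity to its `s`th power,
for `s` coprime to `m` (and the identity if `s` is not coprime to `m`). -/
def sigma (m : ℕ) [NeZero m] (s : ℕ) : G m :=
  if h : Nat.Coprime s m then
    (IsCyclotomicExtension.Rat.galEquivZMod m (cycField m)).symm (ZMod.unitOfCoprime s h)
  else 1

theorem sigma_apply (m : ℕ) [NeZero m] (s : ℕ) (h : Nat.Coprime s m) (x : cycField m)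
    (hx : x ^ m = 1) : sigma m s x = x ^ s := by
  rw [IsCyclotomicExtension.Rat.galEquivZMod_apply_of_pow_eq m (cycField m) (sigma m s) hx, sigma,
    dif_pos h, MulEquiv.apply_symm_apply, ZMod.coe_unitOfCoprime, ZMod.val_natCast]
  exact (pow_eq_pow_mod s hx).symm

/-- The absolute norm element `N_m`, the sum of all elements of the Galois group. -/
def normElt (m : ℕ) [NeZero m] : QG m := ∑ τ : G m, MonoidAlgebra.single τ 1

/-- `θ_m(a) = ∑ ⟨-as/m⟩ σ_s⁻¹`, over `0 < s ≤ m` coprime to `m`. -/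
def theta (m : ℕ) [NeZero m] (a : ℤ) : QG m :=
  ∑ s ∈ Finset.Icc 1 m with Nat.Coprime s m,
    MonoidAlgebra.single (sigma m s)⁻¹ (Int.fract (-((a : ℚ) * s / m)))

/-- `ω_m(a)`, which is `θ_m(a) - ½ N_m` if `m ∤ a` and `0` if `m ∣ a`. -/
def omega (m : ℕ) [NeZero m] (a : ℤ) : QG m :=
  if (m : ℤ) ∣ a then 0 else theta m a - (1 / 2 : ℚ) • normElt m

/-- The restriction ring homomorphism `ℚ[G m] → ℚ[G n]`, for `n ∣ m`. -/
def res (m n : ℕ) [NeZero m] [NeZero n] (h : n ∣ m) : QG m →+* QG n :=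
  MonoidAlgebra.mapDomainRingHom ℚ (restrictGal m n h)

/-- The corestriction map `ℚ[G n] → ℚ[G m]`, for `n ∣ m`: the linear map sending `τ ∈ G n` to the
sum of all `σ ∈ G m` that restrict to `τ`. -/
def cor (m n : ℕ) [NeZero m] [NeZero n] (h : n ∣ m) : QG n →ₗ[ℚ] QG m :=
  (Finsupp.linearCombination ℚ fun τ : G n =>
      ∑ σ : G m with restrictGal m n h σ = τ, (MonoidAlgebra.single σ 1 : QG m)) ∘ₗ
    (MonoidAlgebra.coeffLinearEquiv ℚ).toLinearMap

theorem cor_single (m n : ℕ) [NeZero m] [NeZero n] (h : n ∣ m) (τ : G n) :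
    cor m n h (MonoidAlgebra.single τ 1) =
      ∑ σ : G m with restrictGal m n h σ = τ, MonoidAlgebra.single σ 1 := by
  simp [cor]

/-- `θ_n^{(m)}(a) = cor_{ℚ(ζ_m)/ℚ(ζ_(m,n))} (res_{ℚ(ζ_n)/ℚ(ζ_(m,n))} (θ_n(a)))`. -/
def thetaRel (m n : ℕ) [NeZero m] [NeZero n] (a : ℤ) : QG m :=
  cor m (Nat.gcd m n) (Nat.gcd_dvd_left m n)
    (res n (Nat.gcd m n) (Nat.gcd_dvd_right m n) (theta n a))

/-- Sinnott's group `S'_m`: the additive subgroup of `ℚ[G m]` generated by all `θ_n^{(m)}(a)`,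
for `n` a positive integer and `a` an integer. -/
def sinnott (m : ℕ) [NeZero m] : AddSubgroup (QG m) :=
  AddSubgroup.closure {x | ∃ (n : ℕ) (_ : NeZero n) (a : ℤ), x = thetaRel m n a}

end CyclotomicFields

section IndexSets

variable (m : ℕ) {t : ℕ} (q : Fin t → ℕ)

/-- The set `X_m` of all `0 < a < m` with `(a, m/(a,m)) = 1`. -/
def setX : Set ℕ := {a | 0 < a ∧ a < m ∧ Nat.Coprime a (m / Nat.gcd a m)}

/-- The set `M_m`, for `m = q_1 ⋯ q_t` with the given ordering of the prime powers `q_i`. -/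
def setM : Set ℕ := {a | a ∈ setX m ∧
  (∀ i, ¬ q i ∣ a → ¬ (a : ℤ) ≡ -(Nat.gcd a m : ℤ) [ZMOD q i]) ∧
  (¬ a ∣ m → ∀ k, IsGreatest {i : Fin t | ¬ a ≡ Nat.gcd a m [MOD q i]} k →
    Int.fract ((a : ℚ) / (Nat.gcd a m * q k)) < 1 / 2) ∧
  (a ∣ m → Odd (Finset.univ.filter fun i => ¬ q i ∣ a).card)}

/-- The modified set `M'_m`. -/
def setM' : Set ℕ :=
  {a | a ∈ setM m q ∧ ∀ i, ¬ m / q i ∣ a} ∪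
    ⋃ i, {a | ∃ b : ℕ, 1 ≤ b ∧ b ≤ Nat.totient (q i) / 2 ∧ a = m / q i * b}

/-- `r_b`, the product of all `q_i` which divide `b`. -/
def rPart (b : ℕ) : ℕ := ∏ i with q i ∣ b, q i

end IndexSets

end

end Stickelberger

/-! By the Chinese remainder theorem `G m` is the product of the groups `U i = (ZMod (q i))ˣ`. Read
as a function of the unit `u` (the coefficient at `σ_u⁻¹`), `ω_m(a)` is `u ↦ saw (-a u / m)` with
the sawtooth function `saw`, which is odd and satisfies distribution relations. For `m ∤ a`,
`θ_m(a)` differs from it by `½ N_m`, so both parts reduce to one statement about sawtooth functions.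

Sinnott's group is generated by all `ω_m(a)` and `½ N_m` (`sinnott_eq_map`). Möbius inversion
removes the coprimality condition in a coefficient of `thetaRel m n a`, and the remaining sum over
an arithmetic progression collapses by the distribution relation; `½ N_m` is itself a generator,
with `n = 2` and `a = 1`.

Independence is a count. `M'_m` has at most `φ(m)/2` elements (`two_mul_ncard_setM'_le`), whereas
the complex span of the translated sawtooth functions and the constants contains the trivial
character and all `φ(m)/2` odd ones (`linearIndependent_of_forall_mem_span`). An odd character
occurs because its pairing with some translate is nonzero, which comes down to `L(1, χ) ≠ 0`
(`exists_sum_mul_sawZ_ne_zero`).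

Generation is the main difficulty (`gp_mul_mem_closure`). Distribution relations reduce every point
to one whose components are zero or units, that is, to a conjugate `c • w I` of the element `w I` of
support `I`. The norm relation `N_i w I = (1 - F_i⁻¹) w (I \ {i})` eliminates components `c i = -1`;
oddness moves the last nontrivial component into a chosen half `H` of the units. What remains is `c
= 1` with `#I` even, and this needs a further relation: the product of the half traces over `I`,
applied to `w I`, is an integral combination of conjugates of smaller support (`trProd_mul_mem`).

That relation is proved in a universal model, where `latGen F I` is the product of `1 - F_i⁻¹ e_i`
over `I` and of the norms off `I`; every distribution is a multiple `latGen F I * η`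
(`exists_latGen_mul_eq`). An induction on `I` constructs an element of the lattice of `I` on which
`J = -1` acts by `(-1) ^ #I` and whose leading coefficient is the half trace (`exists_eigen`). The
obstructions are Tate cohomology classes of `⟨J⟩` in lattices that are cohomologically trivial
(`exists_coboundary`). For even `#I` the element is `J`-invariant, hence annihilates an odd `η`, and
only terms of smaller support survive.

No relation ever enlarges the support of a point, so every `q i` dividing `b` also divides each `a`
that occurs; this gives the statement about `r_b`. Finally `M` becomes `M'` by replacing the
elements supported at a single prime with the first `φ(q i)/2` multiples of `m / q i`
(`mem_closure_of_odd_distribution`). -/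

set_option linter.unusedSectionVars false

/-! ### The group ring of a product of finite groups and the lattices `lat F S` -/

namespace OddDistribution

open Finset

noncomputable section

variable {ι : Type*} [Fintype ι] [DecidableEq ι] {U : ι → Type*} [∀ i, CommGroup (U i)]
  [∀ i, Fintype (U i)] [∀ i, DecidableEq (U i)]

/-- The rational group ring of `∏ i, U i`. -/
abbrev GrpRing (U : ι → Type*) [∀ i, CommGroup (U i)] := MonoidAlgebra ℚ (∀ i, U i)

/-- The group elements in the group ring. -/
def gp : (∀ i, U i) →* GrpRing U := MonoidAlgebra.of ℚ (∀ i, U i)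

theorem gp_eq_single (g : ∀ i, U i) : gp g = MonoidAlgebra.single g 1 := rfl

/-- The sum of the elements of a subset `T` of the factor `U i`. -/
def tr (i : ι) (T : Finset (U i)) : GrpRing U := ∑ c ∈ T, gp (Pi.mulSingle i c)

/-- The norm element of the factor `U i`. -/
def nm (U : ι → Type*) [∀ i, CommGroup (U i)] [∀ i, Fintype (U i)] (i : ι) : GrpRing U :=
  tr i univ

/-- The idempotent of the factor `U i`. -/
def idem (U : ι → Type*) [∀ i, CommGroup (U i)] [∀ i, Fintype (U i)] (i : ι) : GrpRing U :=
  algebraMap ℚ _ (Fintype.card (U i) : ℚ)⁻¹ * nm U i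

/-- `1 - F_i⁻¹`. -/
def frobSub (F : ι → ∀ i, U i) (i : ι) : GrpRing U := 1 - gp (F i)⁻¹

/-- `1 - F_i⁻¹ e_i`, where `e_i` is the idempotent of the factor `U i`. -/
def eps (F : ι → ∀ i, U i) (i : ι) : GrpRing U := 1 - gp (F i)⁻¹ * idem U i

theorem gp_mulSingle_mul_nm (i : ι) (c : U i) : gp (Pi.mulSingle i c) * nm U i = nm U i := by
  rw [nm, tr, mul_sum]
  simp_rw [← map_mul, ← Pi.mulSingle_mul]
  exact Equiv.sum_comp (Equiv.mulLeft c) (fun d => gp (Pi.mulSingle i d))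

theorem tr_mul_nm (i : ι) (T : Finset (U i)) : tr i T * nm U i = #T * nm U i := by
  rw [tr, sum_mul, sum_congr rfl fun c _ => gp_mulSingle_mul_nm i c]
  simp

theorem card_mul_algebraMap_inv (i : ι) : (Fintype.card (U i) : GrpRing U) *
    algebraMap ℚ (GrpRing U) (Fintype.card (U i) : ℚ)⁻¹ = 1 := by
  have h : (Fintype.card (U i) : ℚ) ≠ 0 := Nat.cast_ne_zero.mpr Fintype.card_ne_zero
  rw [← map_natCast (algebraMap ℚ (GrpRing U)), ← map_mul, mul_inv_cancel₀ h, map_one]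

theorem idem_mul_nm (i : ι) : idem U i * nm U i = nm U i := by
  have h : nm U i * nm U i = (Fintype.card (U i) : GrpRing U) * nm U i := tr_mul_nm i univ
  rw [idem, mul_assoc, h, ← mul_assoc, mul_comm (algebraMap _ _ _), card_mul_algebraMap_inv, one_mul]

theorem idem_mul_idem (i : ι) : idem U i * idem U i = idem U i := by
  have h : idem U i = algebraMap ℚ _ (Fintype.card (U i) : ℚ)⁻¹ * nm U i := rfl
  linear_combination (idem U i - 1) * h +
    algebraMap ℚ (GrpRing U) (Fintype.card (U i) : ℚ)⁻¹ * idem_mul_nm (U := U) i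

theorem gp_mulSingle_mul_idem (i : ι) (c : U i) :
    gp (Pi.mulSingle i c) * idem U i = idem U i := by
  rw [idem, mul_left_comm, gp_mulSingle_mul_nm]

theorem eps_mul_nm (F : ι → ∀ i, U i) (i : ι) : eps F i * nm U i = frobSub F i * nm U i := by
  rw [eps, frobSub]; linear_combination (-gp (F i)⁻¹) * idem_mul_nm (U := U) i

theorem one_sub_idem_mul_eps (F : ι → ∀ i, U i) (i : ι) :
    (1 - idem U i) * eps F i = 1 - idem U i := by
  rw [eps]; linear_combination (gp (F i)⁻¹) * idem_mul_idem (U := U) i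

theorem one_sub_idem_mul_nm (i : ι) : (1 - idem U i) * nm U i = 0 := by
  linear_combination -idem_mul_nm (U := U) i

/-- The integral group ring, as a subring of the rational one. -/
def intRing (U : ι → Type*) [∀ i, CommGroup (U i)] : Subring (GrpRing U) :=
  Subring.closure (Set.range gp)

theorem gp_mem (g : ∀ i, U i) : gp g ∈ intRing U := Subring.subset_closure ⟨g, rfl⟩

theorem tr_mem (i : ι) (T : Finset (U i)) : tr i T ∈ intRing U := sum_mem fun _ _ => gp_mem _

theorem nm_mem (i : ι) : nm U i ∈ intRing U := tr_mem i _

theorem frobSub_mem (F : ι → ∀ i, U i) (i : ι) : frobSub F i ∈ intRing U :=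
  sub_mem (one_mem _) (gp_mem _)

theorem mem_intRing_iff {x : GrpRing U} :
    x ∈ intRing U ↔ x ∈ AddSubgroup.closure (Set.range (gp : (∀ i, U i) → GrpRing U)) := by
  rw [intRing, Subring.mem_closure_iff, ← MonoidHom.coe_mrange, Submonoid.closure_eq]

/-- The lattice `U_S`, generated by the products of `eps i` or `nm i` over `i ∈ S`. -/
def lat (F : ι → ∀ i, U i) (S : Finset ι) : Submodule (intRing U) (GrpRing U) :=
  ∏ i ∈ S, Submodule.span (intRing U) {eps F i, nm U i}

variable {F : ι → ∀ i, U i}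

theorem mem_lat_empty {x : GrpRing U} : x ∈ lat F ∅ ↔ x ∈ intRing U := by
  rw [lat, prod_empty, Submodule.mem_one]
  exact ⟨by rintro ⟨y, rfl⟩; exact y.2, fun h => ⟨⟨x, h⟩, rfl⟩⟩

theorem mem_lat_insert {S : Finset ι} {i : ι} (hi : i ∉ S) {x : GrpRing U} :
    x ∈ lat F (insert i S) ↔ ∃ b ∈ lat F S, ∃ a ∈ lat F S, x = eps F i * b + nm U i * a := by
  rw [lat, prod_insert hi, ← lat, Submodule.span_insert, Submodule.sup_mul, Submodule.mem_sup]
  simp only [Submodule.mem_span_singleton_mul]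
  constructor
  · rintro ⟨_, ⟨b, hb, rfl⟩, _, ⟨a, ha, rfl⟩, rfl⟩
    exact ⟨b, hb, a, ha, rfl⟩
  · rintro ⟨b, hb, a, ha, rfl⟩
    exact ⟨_, ⟨b, hb, rfl⟩, _, ⟨a, ha, rfl⟩, rfl⟩

theorem mul_mem_lat {S : Finset ι} {z x : GrpRing U} (hz : z ∈ intRing U) (hx : x ∈ lat F S) :
    z * x ∈ lat F S := (lat F S).smul_mem (⟨z, hz⟩ : intRing U) hx

theorem eps_mul_mem_lat {S : Finset ι} {i : ι} (hi : i ∉ S) {x : GrpRing U} (hx : x ∈ lat F S) :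
    eps F i * x ∈ lat F (insert i S) :=
  (mem_lat_insert hi).2 ⟨x, hx, 0, zero_mem _, by ring⟩

theorem nm_mul_mem_lat {S : Finset ι} {i : ι} (hi : i ∉ S) {x : GrpRing U} (hx : x ∈ lat F S) :
    nm U i * x ∈ lat F (insert i S) :=
  (mem_lat_insert hi).2 ⟨0, zero_mem _, x, hx, by ring⟩

/-- The product of a group element `g` with `nm i` for those `i ∈ S` with `g i = 1` and with
`eps i` for the other `i ∈ S`. -/
def latBasis (F : ι → ∀ i, U i) (S : Finset ι) (g : ∀ i, U i) : GrpRing U :=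
  gp g * ∏ i ∈ S, if g i = 1 then nm U i else eps F i

theorem latBasis_insert {S : Finset ι} {i : ι} (hi : i ∉ S) (g : ∀ i, U i) :
    latBasis F (insert i S) g = (if g i = 1 then nm U i else eps F i) * latBasis F S g := by
  rw [latBasis, prod_insert hi, latBasis]; ring

theorem latBasis_mul_mulSingle {S : Finset ι} {i : ι} (hi : i ∉ S) (g : ∀ i, U i) (c : U i) :
    latBasis F S (Pi.mulSingle i c * g) = gp (Pi.mulSingle i c) * latBasis F S g := by
  rw [latBasis, latBasis, map_mul, mul_assoc]
  congr 2
  refine prod_congr rfl fun j hj => ?_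
  have : j ≠ i := by rintro rfl; exact hi hj
  simp [Pi.mulSingle_eq_of_ne this]

theorem latBasis_mem_lat (S : Finset ι) (g : ∀ i, U i) : latBasis F S g ∈ lat F S := by
  induction S using Finset.induction_on with
  | empty => rw [latBasis, prod_empty, mul_one]; exact mem_lat_empty.2 (gp_mem g)
  | insert i S hi ih =>
    rw [latBasis_insert hi]
    split_ifs
    · exact nm_mul_mem_lat hi ih
    · exact eps_mul_mem_lat hi ih

/-- Multiplying by `nm U i` makes the `i`th component irrelevant, so it may be set to `1`. A product
of `eps F i` with a term whose `i`th component is `1` lacks the required shape, and is rewritten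
through the relation between `eps F i` and `nm U i`. -/
theorem lat_le_closure (S : Finset ι) {x : GrpRing U} (hx : x ∈ lat F S) :
    x ∈ AddSubgroup.closure (Set.range (latBasis F S)) := by
  induction S using Finset.induction_on generalizing x with
  | empty =>
    rw [mem_lat_empty, mem_intRing_iff] at hx
    convert hx using 3
    ext g; simp [latBasis]
  | insert i S hi ih =>
    have hnm : ∀ y ∈ lat F S, nm U i * y ∈ AddSubgroup.closure
        (Set.range (latBasis F (insert i S))) := by
      intro y hy
      replace hy := ih hy
      induction hy using AddSubgroup.closure_induction with
      | mem y h =>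
        obtain ⟨g, rfl⟩ := h
        refine AddSubgroup.subset_closure ⟨Pi.mulSingle i (g i)⁻¹ * g, ?_⟩
        rw [latBasis_insert hi, latBasis_mul_mulSingle hi]
        simp only [Pi.mul_apply, Pi.mulSingle_eq_same, inv_mul_cancel, if_true]
        rw [← mul_assoc, mul_comm (nm U i), gp_mulSingle_mul_nm]
      | zero => simp
      | add a b _ _ ha hb => rw [mul_add]; exact add_mem ha hb
      | neg a _ ha => rw [mul_neg]; exact neg_mem ha
    obtain ⟨b, hb, a, ha, rfl⟩ := (mem_lat_insert hi).1 hx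
    refine add_mem ?_ (hnm a ha)
    have hb' := ih hb
    have key : ∀ y ∈ AddSubgroup.closure (Set.range (latBasis F S)),
        eps F i * y ∈ AddSubgroup.closure (Set.range (latBasis F (insert i S))) := by
      intro y hy
      induction hy using AddSubgroup.closure_induction with
      | mem y h =>
        obtain ⟨g, rfl⟩ := h
        by_cases hg : g i = 1
        · have hmem : latBasis F S g ∈ lat F S := latBasis_mem_lat S g
          -- Since `nm * eps = nm * frobSub`, the sum of all translates of `eps F i * x` under `U i`
          -- is `nm * frobSub * x`; this is solved for the translate by `1`.
          have h1 : eps F i * latBasis F S g = nm U i * (frobSub F i * latBasis F S g) -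
              ∑ c ∈ univ.erase (1 : U i), latBasis F (insert i S) (Pi.mulSingle i c * g) := by
            have h2 : ∑ c ∈ univ.erase (1 : U i), latBasis F (insert i S) (Pi.mulSingle i c * g) =
                ∑ c ∈ univ.erase (1 : U i), gp (Pi.mulSingle i c) * (eps F i * latBasis F S g) := by
              refine sum_congr rfl fun c hc => ?_
              rw [latBasis_insert hi, latBasis_mul_mulSingle hi]
              simp only [Pi.mul_apply, Pi.mulSingle_eq_same, hg, mul_one]
              rw [if_neg (ne_of_mem_erase hc)]; ring
            have h3 : nm U i = 1 + ∑ c ∈ univ.erase (1 : U i), gp (Pi.mulSingle i c) := by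
              rw [nm, tr, ← add_sum_erase _ _ (mem_univ (1 : U i))]; simp
            rw [h2, ← sum_mul]
            linear_combination (latBasis F S g) * (eps_mul_nm F i) -
              (eps F i * latBasis F S g) * h3
          rw [h1]
          exact sub_mem (hnm _ (mul_mem_lat (frobSub_mem F i) hmem))
            (sum_mem fun c _ => AddSubgroup.subset_closure ⟨_, rfl⟩)
        · refine AddSubgroup.subset_closure ⟨g, ?_⟩
          rw [latBasis_insert hi, if_neg hg]
      | zero => simp
      | add a b _ _ ha hb => rw [mul_add]; exact add_mem ha hb
      | neg a _ ha => rw [mul_neg]; exact neg_mem ha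
    exact key b hb'

/-- From `1 = eps F i + F_i⁻¹ e_i`, where `e_i` is a rational multiple of `nm U i`: rationally, the
lattice is everything. -/
theorem mem_span_lat (S : Finset ι) (g : ∀ i, U i) :
    gp g ∈ Submodule.span ℚ (lat F S : Set (GrpRing U)) := by
  have key : ∀ T : Finset ι, ∀ x ∈ lat F T, x ∈ Submodule.span ℚ (lat F T : Set (GrpRing U)) :=
    fun T x hx => Submodule.subset_span hx
  induction S using Finset.induction_on with
  | empty => exact Submodule.subset_span (mem_lat_empty.2 (gp_mem g))
  | insert i S hi ih =>
    refine Submodule.span_le.2 ?_ ih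
    intro x hx
    have h1 : x = eps F i * x + (Fintype.card (U i) : ℚ)⁻¹ • (nm U i * (gp (F i)⁻¹ * x)) := by
      rw [Algebra.smul_def, eps, idem]; ring
    rw [h1]
    exact add_mem (Submodule.subset_span (eps_mul_mem_lat hi hx))
      (Submodule.smul_mem _ _ (Submodule.subset_span
        (nm_mul_mem_lat hi (mul_mem_lat (gp_mem _) hx))))

/-- The family spans and has as many members as the group has elements. -/
theorem linearIndependent_latBasis (S : Finset ι) :
    LinearIndependent ℚ (latBasis F S : (∀ i, U i) → GrpRing U) := by
  have hb : Module.Basis (∀ i, U i) ℚ (GrpRing U) :=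
    Module.Basis.ofRepr (MonoidAlgebra.coeffLinearEquiv ℚ)
  refine linearIndependent_of_top_le_span_of_card_eq_finrank ?_ (Module.finrank_eq_card_basis hb).symm
  have h1 : (lat F S : Set (GrpRing U)) ⊆ Submodule.span ℚ (Set.range (latBasis F S)) := by
    intro x hx
    have := lat_le_closure S hx
    exact (AddSubgroup.closure_le (Submodule.span ℚ (Set.range (latBasis F S))).toAddSubgroup).2
      Submodule.subset_span this
  intro x _
  induction x using MonoidAlgebra.induction_linear with
  | zero => simp
  | add f g hf hg => exact add_mem (hf trivial) (hg trivial)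
  | single g r =>
    have h2 := Submodule.span_le.2 h1 (mem_span_lat (F := F) S g)
    have h3 : (MonoidAlgebra.single g r : GrpRing U) = r • gp g := by
      rw [gp_eq_single, MonoidAlgebra.smul_single]; simp
    rw [h3]
    exact Submodule.smul_mem _ _ h2

end

end OddDistribution

/-! ### Cohomology of the group generated by `J` in the lattices -/

namespace OddDistribution

open Finset

noncomputable section

variable {ι : Type*} [Fintype ι] [DecidableEq ι] {U : ι → Type*} [∀ i, CommGroup (U i)]
  [∀ i, Fintype (U i)] [∀ i, DecidableEq (U i)]

theorem GrpRing.induction {P : GrpRing U → Prop} (h0 : P 0) (hadd : ∀ x y, P x → P y → P (x + y))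
    (hgp : ∀ (r : ℚ) g, P (r • gp g)) (x : GrpRing U) : P x := by
  induction x using MonoidAlgebra.induction_linear with
  | zero => exact h0
  | add f g hf hg => exact hadd _ _ hf hg
  | single g r =>
    have h3 : (MonoidAlgebra.single g r : GrpRing U) = r • gp g := by
      rw [gp_eq_single, MonoidAlgebra.smul_single]; simp
    exact h3 ▸ hgp r g

/-- The linear projection that keeps the group elements with `i`th component in `T`. -/
def restr (i : ι) (T : Finset (U i)) : GrpRing U →ₗ[ℚ] GrpRing U :=
  (Finsupp.linearCombination ℚ fun g : ∀ i, U i => if g i ∈ T then (gp g : GrpRing U) else 0) ∘ₗ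
    (MonoidAlgebra.coeffLinearEquiv ℚ).toLinearMap

theorem restr_gp (i : ι) (T : Finset (U i)) (g : ∀ i, U i) :
    restr i T (gp g) = if g i ∈ T then gp g else 0 := by
  simp [restr, gp_eq_single]

theorem restr_gp_mul (i : ι) (T : Finset (U i)) (g : ∀ i, U i) (hg : g i = 1) (x : GrpRing U) :
    restr i T (gp g * x) = gp g * restr i T x := by
  induction x using GrpRing.induction with
  | h0 => simp
  | hadd x y hx hy => rw [mul_add, map_add, hx, hy, map_add, mul_add]
  | hgp r h =>
    rw [mul_smul_comm, map_smul, map_smul, ← map_mul, restr_gp, restr_gp, Pi.mul_apply, hg, one_mul]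
    split_ifs <;> simp

theorem restr_tr_mul {i l : ι} (h : l ≠ i) (T : Finset (U i)) (T' : Finset (U l))
    (x : GrpRing U) : restr i T (tr l T' * x) = tr l T' * restr i T x := by
  rw [tr, sum_mul, map_sum, sum_mul]
  exact sum_congr rfl fun c _ => restr_gp_mul i T _ (Pi.mulSingle_eq_of_ne h.symm c) x

theorem restr_idem_mul {i l : ι} (h : l ≠ i) (T : Finset (U i)) (x : GrpRing U) :
    restr i T (idem U l * x) = idem U l * restr i T x := by
  rw [idem, mul_assoc, ← Algebra.smul_def, map_smul, nm, restr_tr_mul h, Algebra.smul_def, mul_assoc]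

theorem restr_prod_mul {i : ι} (T : Finset (U i)) {κ : Type*} (K : Finset κ) (f : κ → GrpRing U)
    (hf : ∀ k ∈ K, ∀ x, restr i T (f k * x) = f k * restr i T x) (x : GrpRing U) :
    restr i T ((∏ k ∈ K, f k) * x) = (∏ k ∈ K, f k) * restr i T x := by
  classical
  induction K using Finset.induction_on with
  | empty => simp
  | insert k K hk ih =>
    rw [prod_insert hk, mul_assoc, hf k (mem_insert_self _ _),
      ih fun l hl => hf l (mem_insert_of_mem hl), mul_assoc]

theorem restr_mem (i : ι) (T : Finset (U i)) {x : GrpRing U} (hx : x ∈ intRing U) :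
    restr i T x ∈ intRing U := by
  rw [mem_intRing_iff] at hx
  induction hx using AddSubgroup.closure_induction with
  | mem y h =>
    obtain ⟨g, rfl⟩ := h
    rw [restr_gp]
    split_ifs
    exacts [gp_mem g, zero_mem _]
  | zero => simp
  | add a b _ _ ha hb => rw [map_add]; exact add_mem ha hb
  | neg a _ ha => rw [map_neg]; exact neg_mem ha

theorem restr_gp_mul_of_swap {i : ι} {T : Finset (U i)} {J : ∀ i, U i}
    (hT : ∀ c, c ∈ T ↔ J i * c ∉ T) (x : GrpRing U) :
    restr i T (gp J * x) = gp J * (x - restr i T x) := by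
  induction x using GrpRing.induction with
  | h0 => simp
  | hadd x y hx hy => rw [mul_add, map_add, hx, hy, map_add]; ring
  | hgp r h =>
    rw [mul_smul_comm, map_smul, map_smul, ← smul_sub, mul_smul_comm, ← map_mul, restr_gp, restr_gp,
      Pi.mul_apply]
    have := hT (h i)
    by_cases h1 : h i ∈ T
    · rw [if_neg (this.1 h1), if_pos h1]; simp
    · rw [if_pos (by tauto), if_neg h1]; simp

/-- `J` exchanges the parts of `z` over `T` and over its complement, so for an eigenvector the
second part is `e * gp J` times the first. This is the basic way of writing eigenvectors as
coboundaries. -/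
theorem eq_one_add_mul_restr {i : ι} {T : Finset (U i)} {J : ∀ i, U i}
    (hT : ∀ c, c ∈ T ↔ J i * c ∉ T) {e : GrpRing U} (he : e = 1 ∨ e = -1) {z : GrpRing U}
    (hz : gp J * z = e * z) : z = (1 + e * gp J) * restr i T z := by
  have h1 := restr_gp_mul_of_swap hT z
  rw [hz] at h1
  have h2 : restr i T (e * z) = e * restr i T z := by rcases he with rfl | rfl <;> simp
  have h3 : e * e = 1 := by rcases he with rfl | rfl <;> ring
  rw [h2] at h1
  linear_combination (-e) * h1 - e * hz + (restr i T z - z) * h3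

/-- The product of the norm elements `nm i` for `i ∈ K`. -/
def nmProd (U : ι → Type*) [∀ i, CommGroup (U i)] [∀ i, Fintype (U i)] (K : Finset ι) :
    GrpRing U := ∏ i ∈ K, nm U i

theorem nmProd_insert {K : Finset ι} {i : ι} (hi : i ∉ K) :
    nmProd U (insert i K) = nm U i * nmProd U K := prod_insert hi

theorem nmProd_mem (K : Finset ι) : nmProd U K ∈ intRing U := prod_mem fun i _ => nm_mem i

theorem gp_mulSingle_mul_nmProd {K : Finset ι} {i : ι} (hi : i ∈ K) (c : U i) :
    gp (Pi.mulSingle i c) * nmProd U K = nmProd U K := by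
  rw [nmProd, ← mul_prod_erase K _ hi, ← mul_assoc, gp_mulSingle_mul_nm]

variable {F : ι → ∀ i, U i}

/-- Every orbit of the factors in `L` has exactly one member that is trivial on `L`, and summing
over an orbit is multiplying by the norms. -/
theorem latBasis_sum_eq_nmProd_mul (S L : Finset ι) (hd : Disjoint L S) (n : (∀ i, U i) → ℤ)
    (hn : ∀ i ∈ L, ∀ c g, n (Pi.mulSingle i c * g) = n g) :
    ∑ g, n g • latBasis F S g =
      nmProd U L * ∑ g with ∀ i ∈ L, g i = 1, n g • latBasis F S g := by
  induction L using Finset.induction_on with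
  | empty => simp [nmProd]
  | insert i L hi ih =>
    rw [disjoint_insert_left] at hd
    rw [ih hd.2 fun l hl => hn l (mem_insert_of_mem hl), nmProd_insert hi, mul_comm (nm U i),
      mul_assoc]
    congr 1
    rw [nm, tr, sum_mul_sum, ← sum_product']
    symm
    refine sum_nbij' (fun p => Pi.mulSingle i p.1 * p.2)
      (fun g => (g i, Pi.mulSingle i (g i)⁻¹ * g)) ?_ ?_ ?_ ?_ ?_
    · rintro ⟨c, g⟩ hg
      simp only [mem_product, mem_univ, mem_filter, true_and, mem_insert,
        forall_eq_or_imp] at hg ⊢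
      intro l hl
      have : l ≠ i := by rintro rfl; exact hi hl
      simp [Pi.mulSingle_eq_of_ne this, hg.2 l hl]
    · intro g hg
      simp only [mem_product, mem_univ, mem_filter, true_and, mem_insert, forall_eq_or_imp] at hg ⊢
      refine ⟨by simp, fun l hl => ?_⟩
      have : l ≠ i := by rintro rfl; exact hi hl
      simp [Pi.mulSingle_eq_of_ne this, hg l hl]
    · rintro ⟨c, g⟩ hg
      simp only [mem_product, mem_univ, mem_filter, true_and, mem_insert, forall_eq_or_imp] at hg
      simp [hg.1, ← mul_assoc, ← Pi.mulSingle_mul]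
    · intro g hg
      simp [← mul_assoc, ← Pi.mulSingle_mul]
    · rintro ⟨c, g⟩ hg
      simp only
      rw [hn i (mem_insert_self _ _), latBasis_mul_mulSingle hd.1, mul_smul_comm]

/-- The factors outside `S` permute the basis `latBasis F S`, so the coordinates of an invariant
element are constant on orbits. -/
theorem exists_eq_nmProd_mul {S L : Finset ι} (hd : Disjoint L S) {x : GrpRing U}
    (hx : x ∈ lat F S) (hinv : ∀ i ∈ L, ∀ c : U i, gp (Pi.mulSingle i c) * x = x) :
    ∃ y ∈ lat F S, x = nmProd U L * y := by
  have h1 := lat_le_closure S hx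
  rw [← Submodule.span_int_eq_addSubgroupClosure, Submodule.mem_toAddSubgroup,
    Submodule.mem_span_range_iff_exists_fun] at h1
  obtain ⟨n, rfl⟩ := h1
  have hli : LinearIndependent ℤ (latBasis F S) :=
    (linearIndependent_latBasis S).restrict_scalars (by
      intro a b hab; simpa using hab)
  have hn : ∀ i ∈ L, ∀ c g, n (Pi.mulSingle i c * g) = n g := by
    intro i hi c g
    have hiS : i ∉ S := disjoint_left.1 hd hi
    have h2 := hinv i hi c
    have h3 : ∑ g, n (Pi.mulSingle i c⁻¹ * g) • latBasis F S g =
        gp (Pi.mulSingle i c) * ∑ g, n g • latBasis F S g := by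
      rw [mul_sum, ← Equiv.sum_comp (Equiv.mulLeft (Pi.mulSingle i c))]
      refine sum_congr rfl fun g _ => ?_
      rw [Equiv.coe_mulLeft, latBasis_mul_mulSingle hiS, mul_smul_comm, ← mul_assoc,
        ← Pi.mulSingle_mul]
      simp
    rw [h2] at h3
    have h4 := Fintype.linearIndependent_iff.1 hli
      (fun g => n (Pi.mulSingle i c⁻¹ * g) - n g) (by
        simp only [sub_smul, sum_sub_distrib]; rw [h3, sub_self]) (Pi.mulSingle i c * g)
    rw [← mul_assoc, ← Pi.mulSingle_mul] at h4
    simp only [inv_mul_cancel, Pi.mulSingle_one, one_mul] at h4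
    linarith
  exact ⟨_, sum_mem fun g _ => zsmul_mem (latBasis_mem_lat S g) _,
    latBasis_sum_eq_nmProd_mul S L hd n hn⟩

/-- The lattices `nmProd K * lat S` are cohomologically trivial for `⟨J⟩` if `S ∪ K` is not
everything. -/
theorem exists_coboundary {J : ∀ i, U i} (hJ : J * J = 1) {H : ∀ i, Finset (U i)}
    (hH : ∀ i c, c ∈ H i ↔ J i * c ∉ H i) (S : Finset ι) : ∀ (K : Finset ι), Disjoint K S →
    S ∪ K ≠ univ → ∀ e : GrpRing U, e = 1 ∨ e = -1 → ∀ y ∈ lat F S,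
    gp J * (nmProd U K * y) = e * (nmProd U K * y) →
    ∃ y' ∈ lat F S, nmProd U K * y = (1 + e * gp J) * (nmProd U K * y') := by
  have hJJ : (gp J * gp J : GrpRing U) = 1 := by rw [← map_mul, hJ, map_one]
  induction S using Finset.induction_on with
  | empty =>
    intro K _ hne e he y hy hz
    obtain ⟨j, hj⟩ : ∃ j, j ∉ K := by
      by_contra! h
      exact hne (by rw [empty_union]; exact eq_univ_of_forall h)
    -- With a free index `j`, half of `U j` is a fundamental domain for `J`, and restriction to it
    -- commutes with the norms over `K`.
    refine ⟨restr j (H j) y, mem_lat_empty.2 (restr_mem _ _ (mem_lat_empty.1 hy)), ?_⟩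
    have h1 := eq_one_add_mul_restr (hH j) he hz
    rwa [nmProd, restr_prod_mul, ← nmProd] at h1
    intro k hk x
    exact restr_tr_mul (by rintro rfl; exact hj hk) _ _ _
  | insert i S hi ih =>
    intro K hd hne e he y hy hz
    have hee : e * e = 1 := by rcases he with rfl | rfl <;> ring
    have heI : e ∈ intRing U := by
      rcases he with rfl | rfl
      exacts [one_mem _, neg_mem (one_mem _)]
    have hne' : e ∈ ({1, -1} : Set (GrpRing U)) := by simpa using he
    have he' : -e = 1 ∨ -e = -1 := by rcases he with rfl | rfl <;> simp
    rw [disjoint_insert_right] at hd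
    obtain ⟨hiK, hdK⟩ := hd
    have hd' : Disjoint (insert i K) S := by
      rw [disjoint_insert_left]; exact ⟨hi, hdK⟩
    have hn1 : S ∪ insert i K ≠ univ := by
      rwa [union_insert, ← insert_union]
    have hn2 : S ∪ K ≠ univ := by
      intro h; apply hne; rw [insert_union, h]; simp
    obtain ⟨b, hb, a, ha, rfl⟩ := (mem_lat_insert hi).1 hy
    have hsb : nmProd U K * b ∈ lat F S := mul_mem_lat (nmProd_mem K) hb
    set s := nmProd U K with hs
    -- The factor `1 - e_i` turns `eps F i` into itself and kills `nm U i`. Hence `b` gives an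
    -- eigenvector modulo the part invariant under `U i`, and the defect `(J - e) s b` is a multiple
    -- of `nm U i`.
    have h1 : (1 - idem U i) * ((gp J - e) * (s * b)) = 0 := by
      linear_combination (1 - idem U i) * hz -
        (gp J - e) * s * b * one_sub_idem_mul_eps F i -
        (gp J - e) * s * a * one_sub_idem_mul_nm (U := U) i
    have hx : (gp J - e) * (s * b) ∈ lat F S := mul_mem_lat (sub_mem (gp_mem J) heI) hsb
    obtain ⟨w, hw, hxw⟩ := exists_eq_nmProd_mul hd' hx (by
      intro l hl c
      rcases mem_insert.1 hl with rfl | hl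
      · linear_combination (gp (Pi.mulSingle l c) - 1) * h1 +
          ((gp J - e) * (s * b)) * gp_mulSingle_mul_idem l c
      · linear_combination ((gp J - e) * b) * gp_mulSingle_mul_nmProd hl c)
    -- The defect is an eigenvector for the opposite sign, hence a coboundary by induction with `i`
    -- moved from `S` to `K`.
    obtain ⟨w', hw', hww'⟩ := ih (insert i K) hd' hn1 (-e) he' w hw (by
      rw [← hxw]; linear_combination (s * b) * hJJ - (s * b) * hee)
    rw [nmProd_insert hiK, ← hs] at hxw hww'
    -- Adding `e * nm * w'` turns `s * b` into a true eigenvector. The compensating change of `a`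
    -- below uses `eps * nm = frobSub * nm`.
    obtain ⟨b', hb', hbb'⟩ := ih K hdK hn2 e he (b + e * (nm U i * w'))
      (add_mem hb (mul_mem_lat heI (mul_mem_lat (nm_mem i) hw'))) (by
        linear_combination hxw + hww' - (s * nm U i * w') * hee)
    obtain ⟨a', ha', haa'⟩ := ih (insert i K) hd' hn1 e he (a - e * (frobSub F i * w'))
      (sub_mem ha (mul_mem_lat heI (mul_mem_lat (frobSub_mem F i) hw'))) (by
        rw [nmProd_insert hiK, ← hs]
        have h2 : nm U i * s * (a - e * (frobSub F i * w')) = s * (eps F i * b + nm U i * a) -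
            (1 + e * gp J) * (eps F i * (s * b')) := by
          linear_combination (-eps F i) * hbb' + (s * e * w') * eps_mul_nm F i
        rw [h2]
        linear_combination hz + (eps F i * s * b') * gp J * hee -
          (e * (eps F i * s * b')) * hJJ)
    rw [nmProd_insert hiK, ← hs] at haa'
    refine ⟨eps F i * b' + nm U i * a', (mem_lat_insert hi).2 ⟨b', hb', a', ha', rfl⟩, ?_⟩
    linear_combination eps F i * hbb' + haa' - (s * e * w') * eps_mul_nm F i

/-- The whole group acts trivially on the cohomology of the lattice `nmProd Iᶜ * lat I`, to which
the vanishing theorem does not apply since no index is free. It suffices to treat one component at a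
time. -/
theorem gp_sub_one_mul_mem_coboundary {J : ∀ i, U i} (hJ : J * J = 1) {H : ∀ i, Finset (U i)}
    (hH : ∀ i c, c ∈ H i ↔ J i * c ∉ H i) {I : Finset ι} {e : GrpRing U} (he : e = 1 ∨ e = -1)
    {y : GrpRing U} (hy : y ∈ lat F I)
    (hz : gp J * (nmProd U Iᶜ * y) = e * (nmProd U Iᶜ * y)) (g : ∀ i, U i) :
    ∃ y' ∈ lat F I, (gp g - 1) * (nmProd U Iᶜ * y) = (1 + e * gp J) * (nmProd U Iᶜ * y') := by
  rw [← univ_prod_mulSingle g]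
  refine prod_induction _ (fun g => ∃ y' ∈ lat F I, (gp g - 1) * (nmProd U Iᶜ * y) =
    (1 + e * gp J) * (nmProd U Iᶜ * y')) ?_ ⟨0, zero_mem _, by simp⟩ ?_
  · rintro g h ⟨y₁, hy₁, h₁⟩ ⟨y₂, hy₂, h₂⟩
    refine ⟨gp g * y₂ + y₁, add_mem (mul_mem_lat (gp_mem g) hy₂) hy₁, ?_⟩
    rw [map_mul]
    linear_combination gp g * h₂ + h₁
  · intro j _
    by_cases hj : j ∈ I
    · obtain ⟨I, hjI, rfl⟩ : ∃ I', j ∉ I' ∧ I = insert j I' :=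
        ⟨I.erase j, notMem_erase j I, (insert_erase hj).symm⟩
      obtain ⟨b, hb, a, ha, rfl⟩ := (mem_lat_insert hjI).1 hy
      set s := nmProd U (insert j I)ᶜ with hs
      have h0 := gp_mulSingle_mul_idem j (g j)
      have h0' := gp_mulSingle_mul_nm j (g j)
      -- The difference `c - 1` with `c ∈ U j` kills `e_j` and `nm U j`, so only `(c - 1) * b`
      -- remains. It lives in a lattice in which `j` is a free index.
      obtain ⟨y', hy', h1⟩ := exists_coboundary (F := F) hJ hH I (insert j I)ᶜ
        (disjoint_compl_left.mono_right (subset_insert j I))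
        (by
          intro h
          have := mem_univ j
          rw [← h] at this
          simp [hjI] at this) e he ((gp (Pi.mulSingle j (g j)) - 1) * b)
        (mul_mem_lat (sub_mem (gp_mem _) (one_mem _)) hb) (by
          rw [← hs]
          linear_combination (gp (Pi.mulSingle j (g j)) - 1) * (1 - idem U j) * hz -
            (gp (Pi.mulSingle j (g j)) - 1) * (gp J - e) * s * b * one_sub_idem_mul_eps F j -
            (gp (Pi.mulSingle j (g j)) - 1) * (gp J - e) * s * a * one_sub_idem_mul_nm (U := U) j +
            (gp J - e) * s * b * h0)
      refine ⟨eps F j * y', eps_mul_mem_lat hjI hy', ?_⟩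
      rw [← hs] at h1
      linear_combination eps F j * h1 + s * a * h0'
    · refine ⟨0, zero_mem _, ?_⟩
      linear_combination y * gp_mulSingle_mul_nmProd (U := U) (mem_compl.2 hj) (g j)

end

end OddDistribution

/-! ### Eigenvectors with prescribed leading coefficient and the half-trace relation -/

namespace OddDistribution

open Finset

noncomputable section

variable {ι : Type*} [Fintype ι] [DecidableEq ι] {U : ι → Type*} [∀ i, CommGroup (U i)]
  [∀ i, Fintype (U i)] [∀ i, DecidableEq (U i)] {F : ι → ∀ i, U i}

/-- The product of the complementary idempotents `1 - e_i` for `i ∈ I`. -/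
def coIdem (U : ι → Type*) [∀ i, CommGroup (U i)] [∀ i, Fintype (U i)] (I : Finset ι) :
    GrpRing U := ∏ i ∈ I, (1 - idem U i)

theorem coIdem_insert {I : Finset ι} {i : ι} (hi : i ∉ I) :
    coIdem U (insert i I) = (1 - idem U i) * coIdem U I := prod_insert hi

theorem coIdem_mul_nm {I : Finset ι} {i : ι} (hi : i ∈ I) : coIdem U I * nm U i = 0 := by
  rw [coIdem, ← mul_prod_erase I _ hi, mul_right_comm, one_sub_idem_mul_nm, zero_mul]

theorem coIdem_mul_prod_eps (I : Finset ι) : coIdem U I * ∏ i ∈ I, eps F i = coIdem U I := by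
  rw [coIdem, ← prod_mul_distrib]
  exact prod_congr rfl fun i _ => one_sub_idem_mul_eps F i

/-- Multiplication by `coIdem U I` replaces each `eps` by `1` and each norm over `I` by `0`. The
element `α` is the leading coefficient of `y`. -/
theorem exists_coIdem_mul_eq {I : Finset ι} {y : GrpRing U} (hy : y ∈ lat F I) :
    ∃ α ∈ intRing U, coIdem U I * y = coIdem U I * α := by
  induction I using Finset.induction_on generalizing y with
  | empty => exact ⟨y, mem_lat_empty.1 hy, rfl⟩
  | insert i I hi ih =>
    obtain ⟨b, hb, a, ha, rfl⟩ := (mem_lat_insert hi).1 hy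
    obtain ⟨α, hα, h⟩ := ih hb
    refine ⟨α, hα, ?_⟩
    rw [coIdem_insert hi]
    linear_combination (1 - idem U i) * h + coIdem U I * b * one_sub_idem_mul_eps F i +
      coIdem U I * a * one_sub_idem_mul_nm (U := U) i

theorem prod_eps_mem_lat (I : Finset ι) : ∏ i ∈ I, eps F i ∈ lat F I := by
  induction I using Finset.induction_on with
  | empty => rw [prod_empty]; exact mem_lat_empty.2 (one_mem _)
  | insert i I hi ih => rw [prod_insert hi]; exact eps_mul_mem_lat hi ih

theorem restr_coIdem_mul {i : ι} {I : Finset ι} (hi : i ∉ I) (T : Finset (U i)) (x : GrpRing U) :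
    restr i T (coIdem U I * x) = coIdem U I * restr i T x := by
  refine restr_prod_mul T I _ (fun k hk x => ?_) x
  rw [sub_mul, map_sub, restr_idem_mul (by rintro rfl; exact hi hk), one_mul, sub_mul, one_mul]

theorem restr_nmProd_mul {i : ι} {K : Finset ι} (hi : i ∉ K) (T : Finset (U i)) (x : GrpRing U) :
    restr i T (nmProd U K * x) = nmProd U K * restr i T x :=
  restr_prod_mul T K _ (fun k hk x => restr_tr_mul (by rintro rfl; exact hi hk) _ _ _) x

/-- The product of the half traces over `i ∈ I`. -/
def trProd (H : ∀ i, Finset (U i)) (I : Finset ι) : GrpRing U := ∏ i ∈ I, tr i (H i)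

theorem trProd_mem (H : ∀ i, Finset (U i)) (I : Finset ι) : trProd H I ∈ intRing U :=
  prod_mem fun i _ => tr_mem i _

theorem gp_eq_prod (g : ∀ i, U i) : (gp g : GrpRing U) = ∏ i, gp (Pi.mulSingle i (g i)) := by
  rw [← map_prod, univ_prod_mulSingle]

theorem gp_mul_nmProd_univ (g : ∀ i, U i) : gp g * nmProd U univ = nmProd U univ := by
  rw [gp_eq_prod, nmProd, ← prod_mul_distrib]
  exact prod_congr rfl fun i _ => gp_mulSingle_mul_nm i _

theorem gp_mulSingle_mul_tr {J : ∀ i, U i} (hJ : J * J = 1) {i : ι} {T : Finset (U i)}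
    (hT : ∀ c, c ∈ T ↔ J i * c ∉ T) :
    gp (Pi.mulSingle i (J i)) * tr i T = nm U i - tr i T := by
  have h1 : nm U i = tr i T + tr i Tᶜ := (sum_add_sum_compl T _).symm
  have hJi (c : U i) : J i * (J i * c) = c := by
    rw [← mul_assoc]; have := congrFun hJ i; simp only [Pi.mul_apply, Pi.one_apply] at this
    rw [this, one_mul]
  rw [h1, add_sub_cancel_left, tr, mul_sum, tr]
  refine sum_nbij' (fun c => J i * c) (fun c => J i * c) ?_ ?_ ?_ ?_ ?_
  · intro c hc; exact mem_compl.2 ((hT c).1 hc)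
  · intro c hc
    rw [hT, hJi]; exact mem_compl.1 hc
  · intro c _; exact hJi c
  · intro c _; exact hJi c
  · intro c _; rw [← map_mul, ← Pi.mulSingle_mul]

/-- Split `J` into components: those off `insert j I` are absorbed by norms, those in `I` act as
`-1` because `J i` sends a half trace to the norm minus itself and `1 - e_i` kills the norm, and the
one at `j` exchanges the two halves. -/
theorem gp_mul_coIdem_trProd {J : ∀ i, U i} (hJ : J * J = 1) {H : ∀ i, Finset (U i)}
    (hH : ∀ i c, c ∈ H i ↔ J i * c ∉ H i) {I : Finset ι} {j : ι} (hj : j ∉ I) :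
    gp J * (nmProd U (insert j I)ᶜ * coIdem U I * trProd H I * tr j (H j)) =
      (-1) ^ #I * (nmProd U (insert j I)ᶜ * coIdem U I * trProd H I * (nm U j - tr j (H j))) := by
  have h1 : (gp J : GrpRing U) = gp (Pi.mulSingle j (J j)) * (∏ i ∈ I, gp (Pi.mulSingle i (J i))) *
      ∏ i ∈ (insert j I)ᶜ, gp (Pi.mulSingle i (J i)) := by
    rw [gp_eq_prod, ← prod_insert (f := fun i => (gp (Pi.mulSingle i (J i)) : GrpRing U)) hj,
      prod_mul_prod_compl]
  have h2 : (∏ i ∈ (insert j I)ᶜ, gp (Pi.mulSingle i (J i))) * nmProd U (insert j I)ᶜ =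
      nmProd U (insert j I)ᶜ := by
    rw [nmProd, ← prod_mul_distrib]
    exact prod_congr rfl fun i _ => gp_mulSingle_mul_nm i _
  have h3 : (∏ i ∈ I, gp (Pi.mulSingle i (J i))) * (coIdem U I * trProd H I) =
      (-1) ^ #I * (coIdem U I * trProd H I) := by
    rw [coIdem, trProd, ← prod_mul_distrib, ← prod_mul_distrib, ← prod_const, ← prod_mul_distrib]
    refine prod_congr rfl fun i _ => ?_
    linear_combination (1 - idem U i) * gp_mulSingle_mul_tr hJ (hH i) +
      one_sub_idem_mul_nm (U := U) i
  have h4 := gp_mulSingle_mul_tr hJ (hH j)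
  rw [h1]
  set A := nmProd U (insert j I)ᶜ
  set P := ∏ i ∈ (insert j I)ᶜ, (gp (Pi.mulSingle i (J i)) : GrpRing U)
  set Q := ∏ i ∈ I, (gp (Pi.mulSingle i (J i)) : GrpRing U)
  linear_combination gp (Pi.mulSingle j (J j)) * Q * (coIdem U I * trProd H I * tr j (H j)) * h2 +
    gp (Pi.mulSingle j (J j)) * A * tr j (H j) * h3 +
    (-1) ^ #I * A * coIdem U I * trProd H I * h4

/-- In every lattice `nmProd Iᶜ * lat I` there is an element on which `J` acts by `(-1) ^ #I`, and
whose leading coefficient is the product of the half traces. -/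
theorem exists_eigen {J : ∀ i, U i} (hJ : J * J = 1) {H : ∀ i, Finset (U i)}
    (hH : ∀ i c, c ∈ H i ↔ J i * c ∉ H i) (I : Finset ι) :
    ∃ y ∈ lat F I, gp J * (nmProd U Iᶜ * y) = (-1) ^ #I * (nmProd U Iᶜ * y) ∧
      coIdem U I * (nmProd U Iᶜ * y) = coIdem U I * (trProd H I * nmProd U Iᶜ) := by
  have hJJ : (gp J * gp J : GrpRing U) = 1 := by rw [← map_mul, hJ, map_one]
  induction I using Finset.induction_on with
  | empty =>
    refine ⟨1, mem_lat_empty.2 (one_mem _), ?_, ?_⟩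
    · simp [gp_mul_nmProd_univ]
    · simp [trProd]
  | insert j I hj ih =>
    obtain ⟨y, hy, hJy, hly⟩ := ih
    have hc : Iᶜ = insert j (insert j I)ᶜ := by
      ext k; by_cases hk : k = j <;> simp [hk, hj]
    have hjK : j ∉ (insert j I)ᶜ := by simp
    have hsign : ((-1) ^ #I : GrpRing U) = 1 ∨ ((-1) ^ #I : GrpRing U) = -1 :=
      neg_one_pow_eq_or _ _
    -- The element `y₁` makes `(F_j⁻¹ - 1) z` a coboundary and `x₂` below makes `z` itself one, in
    -- the larger lattice where `j` is free. As `eps * nm = (1 - F_j⁻¹) * nm`, the operator `1 + e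
    -- J` kills `eps F j * x₂ + nm U j * y₁`: this is the required change of sign.
    obtain ⟨y₁, hy₁, h₁⟩ := gp_sub_one_mul_mem_coboundary hJ hH hsign hy hJy (F j)⁻¹
    have hmain := gp_mul_coIdem_trProd hJ hH hj
    rw [hc, nmProd_insert hjK] at hJy hly h₁
    rw [card_insert_of_notMem hj, pow_succ]
    generalize ((-1) ^ #I : GrpRing U) = e at *
    have hee : e * e = 1 := by rcases hsign with rfl | rfl <;> ring
    have heI : e ∈ intRing U := by
      rcases hsign with rfl | rfl
      exacts [one_mem _, neg_mem (one_mem _)]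
    obtain ⟨x₂, hx₂, h₂⟩ := exists_coboundary (F := F) hJ hH I (insert j I)ᶜ
      (disjoint_compl_left.mono_right (subset_insert j I))
      (by
        intro h
        have := mem_univ j
        rw [← h] at this
        simp [hj] at this) e hsign (nm U j * y) (mul_mem_lat (nm_mem j) hy) (by
          linear_combination hJy)
    obtain ⟨α, hα, hαx⟩ := exists_coIdem_mul_eq hx₂
    set s := nmProd U (insert j I)ᶜ with hs
    -- The leading coefficient of `x₂` and the desired half trace have the same image under `1 + e
    -- J`. Their difference is therefore a coboundary for the sign `-e`, with `w` as its half over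
    -- `H j`.
    set w := restr j (H j) (α - tr j (H j) * trProd H I) with hw
    have hwI : w ∈ intRing U := restr_mem _ _ (sub_mem hα (mul_mem (tr_mem _ _) (trProd_mem _ _)))
    have hd : coIdem U I * (s * (α - tr j (H j) * trProd H I)) =
        (1 - e * gp J) * (coIdem U I * (s * w)) := by
      have h3 : gp J * (coIdem U I * (s * (α - tr j (H j) * trProd H I))) =
          -e * (coIdem U I * (s * (α - tr j (H j) * trProd H I))) := by
        linear_combination (-s * (gp J + e)) * hαx - coIdem U I * e * h₂ + e * hly - hmain -
          coIdem U I * s * x₂ * gp J * hee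
      have h4 := eq_one_add_mul_restr (hH j) (e := -e)
        (by rcases hsign with rfl | rfl <;> simp) h3
      rw [restr_coIdem_mul hj, hs, restr_nmProd_mul hjK, ← hs, ← hw] at h4
      linear_combination h4
    have hεw : (∏ i ∈ I, eps F i) * w ∈ lat F I := by
      rw [mul_comm]; exact mul_mem_lat hwI (prod_eps_mem_lat I)
    have hcE := coIdem_mul_prod_eps (F := F) I
    -- The correction corrects the leading coefficient and is itself annihilated by `1 + e J`.
    refine ⟨eps F j * (x₂ - (1 - e * gp J) * ((∏ i ∈ I, eps F i) * w)) + nm U j * y₁,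
      (mem_lat_insert hj).2 ⟨_, sub_mem hx₂ (mul_mem_lat (sub_mem (one_mem _)
        (mul_mem heI (gp_mem J))) hεw), _, hy₁, rfl⟩, ?_, ?_⟩
    · set E := ∏ i ∈ I, eps F i
      have h5 := eps_mul_nm F j
      have h6 : frobSub F j * (nm U j * s * y) = -((1 + e * gp J) * (nm U j * s * y₁)) := by
        rw [frobSub]; linear_combination -h₁
      linear_combination (-e) * eps F j * h₂ - (eps F j * s * x₂ * gp J) * hee +
        e * s * y * h5 + e * h6 - (nm U j * s * y₁ * gp J) * hee +
        (eps F j * s * E * w) * (e * hJJ + gp J * hee)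
    · rw [coIdem_insert hj, trProd, prod_insert hj, ← trProd]
      set E := ∏ i ∈ I, eps F i
      linear_combination (coIdem U I * s * (x₂ - (1 - e * gp J) * (E * w))) *
        one_sub_idem_mul_eps F j + (coIdem U I * s * y₁) * one_sub_idem_mul_nm (U := U) j +
        (1 - idem U j) * (s * hαx - (1 - e * gp J) * s * w * hcE + hd)

/-- A multiple of `nm U i` has the same coefficients over every element of `U i`, so its part over
`1` determines it. -/
theorem nm_mul_restr_nm_mul (i : ι) (x : GrpRing U) :
    nm U i * restr i {1} (nm U i * x) = nm U i * x := by
  induction x using GrpRing.induction with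
  | h0 => simp
  | hadd x y hx hy => rw [mul_add, map_add, mul_add, hx, hy]
  | hgp r h =>
    rw [mul_smul_comm, map_smul, mul_smul_comm]
    congr 1
    have h1 : nm U i * gp h = nm U i * gp (Pi.mulSingle i (h i)⁻¹ * h) := by
      rw [map_mul]
      linear_combination -gp h * gp_mulSingle_mul_nm i (h i)⁻¹
    have h2 : restr i {1} (nm U i * gp (Pi.mulSingle i (h i)⁻¹ * h)) =
        gp (Pi.mulSingle i (h i)⁻¹ * h) := by
      rw [nm, tr, sum_mul, map_sum, sum_eq_single_of_mem 1 (mem_univ _)]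
      · rw [Pi.mulSingle_one, map_one, one_mul, restr_gp]; simp
      · intro c _ hc
        rw [← map_mul, restr_gp]
        simp [hc]
    rw [h1, h2]

/-- If `1 - e_i` kills an element, then it is `nm U i` times its part over `1`, which has integral
coefficients for integral `β`. Subtracting this part removes one index from `I`. -/
theorem exists_eq_sum_nm_mul {I K : Finset ι} (hd : Disjoint I K) {β : GrpRing U}
    (hβ : β ∈ intRing U) (h : coIdem U I * (nmProd U K * β) = 0) :
    ∃ γ : ι → GrpRing U, (∀ i, γ i ∈ intRing U) ∧
      nmProd U K * β = nmProd U K * ∑ i ∈ I, nm U i * γ i := by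
  induction I using Finset.induction_on generalizing β with
  | empty =>
    refine ⟨0, fun _ => zero_mem _, ?_⟩
    simpa [coIdem] using h
  | insert i I hi ih =>
    rw [disjoint_insert_left] at hd
    set β' := β - nm U i * restr i {1} β with hβ'
    have h1 : coIdem U I * (nmProd U K * β') = 0 := by
      have h2 : coIdem U I * (nmProd U K * β) =
          nm U i * (algebraMap ℚ _ (Fintype.card (U i) : ℚ)⁻¹ *
            (coIdem U I * (nmProd U K * β))) := by
        rw [coIdem_insert hi] at h
        have h3 : idem U i = algebraMap ℚ _ (Fintype.card (U i) : ℚ)⁻¹ * nm U i := rfl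
        linear_combination h + (coIdem U I * (nmProd U K * β)) * h3
      have h4 := nm_mul_restr_nm_mul i (algebraMap ℚ _ (Fintype.card (U i) : ℚ)⁻¹ *
            (coIdem U I * (nmProd U K * β)))
      rw [← h2, restr_coIdem_mul hi, restr_nmProd_mul hd.1] at h4
      rw [hβ']
      linear_combination -h4
    obtain ⟨γ, hγ, h5⟩ := ih hd.2 (sub_mem hβ (mul_mem (nm_mem i) (restr_mem i _ hβ))) h1
    refine ⟨Function.update γ i (restr i {1} β), ?_, ?_⟩
    · intro k
      by_cases hk : k = i
      · subst hk; simpa using restr_mem k _ hβ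
      · simpa [hk] using hγ k
    · rw [sum_insert hi, Function.update_self]
      have h6 : ∑ k ∈ I, nm U k * Function.update γ i (restr i {1} β) k =
          ∑ k ∈ I, nm U k * γ k := by
        refine sum_congr rfl fun k hk => ?_
        rw [Function.update_of_ne (by rintro rfl; exact hi hk)]
      rw [h6]
      linear_combination h5

/-- The generator of the universal distribution with support `I`. -/
def latGen (F : ι → ∀ i, U i) (I : Finset ι) : GrpRing U := (∏ i ∈ I, eps F i) * nmProd U Iᶜ

theorem nmProd_mul_latBasis (I : Finset ι) (g : ∀ i, U i) :
    nmProd U Iᶜ * latBasis F I g = gp g * latGen F (I.filter fun i => g i ≠ 1) := by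
  have h1 : (I.filter fun i => g i ≠ 1)ᶜ = Iᶜ ∪ I.filter fun i => g i = 1 := by
    ext i; by_cases hi : i ∈ I <;> simp [hi]
  have h2 : Disjoint Iᶜ (I.filter fun i => g i = 1) :=
    disjoint_compl_left.mono_right (filter_subset _ _)
  rw [latBasis, prod_ite, latGen, h1, nmProd, nmProd, prod_union h2]
  ring

theorem mul_mem_closure_of_mem_intRing {P : Set (GrpRing U)} (hP : ∀ g, ∀ x ∈ P, gp g * x ∈ P)
    {α x : GrpRing U} (hα : α ∈ intRing U) (hx : x ∈ AddSubgroup.closure P) :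
    α * x ∈ AddSubgroup.closure P := by
  rw [mem_intRing_iff] at hα
  induction hα using AddSubgroup.closure_induction with
  | mem y h =>
    obtain ⟨g, rfl⟩ := h
    induction hx using AddSubgroup.closure_induction with
    | mem y h => exact AddSubgroup.subset_closure (hP g y h)
    | zero => simp
    | add a b _ _ ha hb => rw [mul_add]; exact add_mem ha hb
    | neg a _ ha => rw [mul_neg]; exact neg_mem ha
  | zero => simp
  | add a b _ _ ha hb => rw [add_mul]; exact add_mem ha hb
  | neg a _ ha => rw [neg_mul]; exact neg_mem ha

theorem exists_sub_mul_latGen_mem {I : Finset ι} {y : GrpRing U} (hy : y ∈ lat F I) :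
    ∃ α ∈ intRing U, nmProd U Iᶜ * y - α * latGen F I ∈
      AddSubgroup.closure {x | ∃ g, ∃ L ⊂ I, x = gp g * latGen F L} := by
  have hy' := lat_le_closure I hy
  clear hy
  induction hy' using AddSubgroup.closure_induction with
  | mem y h =>
    obtain ⟨g, rfl⟩ := h
    rw [nmProd_mul_latBasis]
    rcases eq_or_ssubset_of_subset (filter_subset (fun i => g i ≠ 1) I) with h | h
    · exact ⟨gp g, gp_mem g, by rw [h, sub_self]; exact zero_mem _⟩
    · exact ⟨0, zero_mem _, AddSubgroup.subset_closure ⟨g, _, h, by ring⟩⟩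
  | zero => exact ⟨0, zero_mem _, by simp⟩
  | add a b _ _ ha hb =>
    obtain ⟨α, hα, h1⟩ := ha
    obtain ⟨β, hβ, h2⟩ := hb
    refine ⟨α + β, add_mem hα hβ, ?_⟩
    convert add_mem h1 h2 using 1; ring
  | neg a _ ha =>
    obtain ⟨α, hα, h1⟩ := ha
    refine ⟨-α, neg_mem hα, ?_⟩
    convert neg_mem h1 using 1; ring

/-- The generators themselves form a distribution. -/
theorem nm_mul_prod_eps_mul_nmProd {I : Finset ι} {i : ι} (hi : i ∈ I) :
    nm U i * latGen F I = frobSub F i * latGen F (I.erase i) := by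
  have h1 : (I.erase i)ᶜ = insert i Iᶜ := by
    ext k; by_cases hk : k = i <;> simp [hk]
  rw [latGen, latGen, ← mul_prod_erase I _ hi, h1, nmProd_insert (by simpa using hi)]
  linear_combination ((∏ k ∈ I.erase i, eps F k) * nmProd U Iᶜ) * eps_mul_nm F i

/-- For even `#I`, the half trace of the generator with support `I` is `J`-invariant up to terms
with smaller support. -/
theorem exists_invariant_sub_mem {J : ∀ i, U i} (hJ : J * J = 1) {H : ∀ i, Finset (U i)}
    (hH : ∀ i c, c ∈ H i ↔ J i * c ∉ H i) {I : Finset ι} (hI : Even #I) :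
    ∃ x : GrpRing U, gp J * x = x ∧ trProd H I * latGen F I - x ∈
      AddSubgroup.closure {x | ∃ g, ∃ L ⊂ I, x = gp g * latGen F L} := by
  obtain ⟨y, hy, hJy, hly⟩ := exists_eigen (F := F) hJ hH I
  rw [hI.neg_one_pow, one_mul] at hJy
  refine ⟨_, hJy, ?_⟩
  obtain ⟨α, hα, h1⟩ := exists_sub_mul_latGen_mem hy
  have hP : ∀ g, ∀ x ∈ {x | ∃ g, ∃ L ⊂ I, x = gp g * latGen F L},
      gp g * x ∈ {x | ∃ g, ∃ L ⊂ I, x = gp g * latGen F L} := by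
    rintro g _ ⟨h, L, hL, rfl⟩
    exact ⟨g * h, L, hL, by rw [map_mul, mul_assoc]⟩
  -- A generator of smaller support contains a norm over some `i ∈ I`, so `coIdem U I` kills it.
  -- Hence `α` and the half trace have the same leading part.
  have h2 : coIdem U I * (nmProd U Iᶜ * y - α * latGen F I) = 0 := by
    generalize nmProd U Iᶜ * y - α * latGen F I = z at h1
    induction h1 using AddSubgroup.closure_induction with
    | mem y h =>
      obtain ⟨g, L, hL, rfl⟩ := h
      obtain ⟨i, hi, hiL⟩ := exists_of_ssubset hL
      rw [latGen, nmProd, ← mul_prod_erase Lᶜ _ (mem_compl.2 hiL)]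
      linear_combination (gp g * (∏ i ∈ L, eps F i) * ∏ k ∈ Lᶜ.erase i, nm U k) *
        coIdem_mul_nm (U := U) hi
    | zero => simp
    | add a b _ _ ha hb => rw [mul_add, ha, hb, add_zero]
    | neg a _ ha => rw [mul_neg, ha, neg_zero]
  have h3 : coIdem U I * (nmProd U Iᶜ * (trProd H I - α)) = 0 := by
    have h4 := coIdem_mul_prod_eps (F := F) I
    rw [latGen] at h2
    linear_combination h2 - hly + α * nmProd U Iᶜ * h4
  obtain ⟨γ, hγ, h5⟩ := exists_eq_sum_nm_mul disjoint_compl_right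
    (sub_mem (trProd_mem H I) hα) h3
  -- The difference of the leading coefficients is a combination of norms over `I`, and a norm
  -- applied to `latGen F I` lowers the support.
  have h6 : (trProd H I - α) * latGen F I =
      ∑ i ∈ I, γ i * frobSub F i * latGen F (I.erase i) := by
    have h7 : ∑ i ∈ I, γ i * frobSub F i * latGen F (I.erase i) =
        (∑ i ∈ I, nm U i * γ i) * latGen F I := by
      rw [sum_mul]
      refine sum_congr rfl fun i hi => ?_
      linear_combination (-γ i) * nm_mul_prod_eps_mul_nmProd (F := F) hi
    rw [h7, latGen]
    linear_combination (∏ i ∈ I, eps F i) * h5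
  have h8 : trProd H I * latGen F I - nmProd U Iᶜ * y =
      ∑ i ∈ I, γ i * frobSub F i * latGen F (I.erase i) -
        (nmProd U Iᶜ * y - α * latGen F I) := by
    linear_combination h6
  rw [h8]
  refine sub_mem (sum_mem fun i hi => ?_) h1
  exact mul_mem_closure_of_mem_intRing hP (mul_mem (hγ i) (frobSub_mem F i))
    (AddSubgroup.subset_closure ⟨1, _, erase_ssubset hi, by simp⟩)

/-- Expansion of `∏ ((1 - e_i) + e_i)`; the `K`th summand projects to the characters that are
nontrivial exactly on the factors in `K`. -/
theorem sum_coIdem_mul_prod_idem : ∑ K : Finset ι, coIdem U K * ∏ i ∈ Kᶜ, idem U i = 1 := by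
  have h := prod_add (fun i => 1 - idem U i) (fun i => idem U i) univ
  simp only [sub_add_cancel, prod_const_one, powerset_univ] at h
  rw [h]
  exact sum_congr rfl fun K _ => by rw [coIdem, compl_eq_univ_sdiff]

/-- A family in the rational group ring that satisfies the relations of a distribution is obtained
from the generators of the universal distribution by multiplication with a fixed element. -/
theorem exists_latGen_mul_eq {w : Finset ι → GrpRing U}
    (hw1 : ∀ I, ∀ i ∈ I, nm U i * w I = frobSub F i * w (I.erase i))
    (hw2 : ∀ I, ∀ i ∉ I, ∀ c : U i, gp (Pi.mulSingle i c) * w I = w I) :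
    ∃ η : GrpRing U, (∀ I, latGen F I * η = w I) ∧
      ∀ x, (∀ I, x * w I = 0) → x * η = 0 := by
  have hidem (i : ι) : idem U i = algebraMap ℚ _ (Fintype.card (U i) : ℚ)⁻¹ * nm U i := rfl
  have hw3 : ∀ I, ∀ i ∉ I, idem U i * w I = w I := by
    intro I i hi
    rw [hidem, mul_assoc, nm, tr, sum_mul, sum_congr rfl fun c _ => hw2 I i hi c, sum_const,
      nsmul_eq_mul, ← mul_assoc, card_univ, mul_comm (algebraMap _ _ _), card_mul_algebraMap_inv,
      one_mul]
  -- On the `K`th summand `latGen F K` acts as the product of the `|U i|` over `i ∉ K`. Its inverse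
  -- `c K` forces the `K`th component of `η` to be that of `c K * w K`.
  set c : Finset ι → GrpRing U :=
    fun K => ∏ i ∈ Kᶜ, algebraMap ℚ _ (Fintype.card (U i) : ℚ)⁻¹ with hc
  have key : ∀ I K : Finset ι, latGen F I * (coIdem U K * (∏ i ∈ Kᶜ, idem U i) * (c K * w K)) =
      coIdem U K * (∏ i ∈ Kᶜ, idem U i) * w I := by
    intro I K
    by_cases hK : K ⊆ I
    · obtain ⟨A, hA, rfl⟩ : ∃ A, Disjoint K A ∧ I = K ∪ A :=
        ⟨I \ K, disjoint_sdiff, (union_sdiff_of_subset hK).symm⟩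
      clear hK
      induction A using Finset.induction_on with
      | empty =>
        rw [union_empty, latGen]
        have h1 : (∏ i ∈ Kᶜ, idem U i) * (nmProd U Kᶜ * c K) = ∏ i ∈ Kᶜ, idem U i := by
          rw [nmProd, hc, ← prod_mul_distrib, ← prod_mul_distrib]
          refine prod_congr rfl fun i _ => ?_
          rw [mul_comm (nm U i), ← hidem, idem_mul_idem]
        linear_combination ((∏ i ∈ Kᶜ, idem U i) * nmProd U Kᶜ * c K * w K) *
          coIdem_mul_prod_eps (F := F) K + coIdem U K * w K * h1
      | insert i A hi ih =>
        rw [disjoint_insert_right] at hA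
        have h1 : i ∉ K ∪ A := by simp [hA.1, hi]
        have h2 := hw1 (K ∪ insert i A) i (by simp)
        have h3 := nm_mul_prod_eps_mul_nmProd (F := F) (I := K ∪ insert i A) (i := i) (by simp)
        have h4 : (K ∪ insert i A).erase i = K ∪ A := by
          rw [union_insert, erase_insert h1]
        rw [h4] at h2 h3
        have h5 : ∏ i ∈ Kᶜ, idem U i = (∏ i ∈ Kᶜ, idem U i) * idem U i := by
          rw [← mul_prod_erase Kᶜ _ (mem_compl.2 hA.1)]
          linear_combination (-∏ k ∈ Kᶜ.erase i, idem U k) * idem_mul_idem (U := U) i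
        rw [h5, hidem]
        have h6 := ih hA.2
        linear_combination coIdem U K * (∏ i ∈ Kᶜ, idem U i) *
          algebraMap ℚ _ (Fintype.card (U i) : ℚ)⁻¹ * (c K * w K * h3 - h2) +
          algebraMap ℚ _ (Fintype.card (U i) : ℚ)⁻¹ * frobSub F i * h6
    · obtain ⟨i, hi, hiI⟩ := not_subset.1 hK
      have h1 := coIdem_mul_nm (U := U) hi
      have h2 := hw3 I i hiI
      rw [latGen, nmProd, ← mul_prod_erase Iᶜ _ (mem_compl.2 hiI), ← h2, hidem]
      linear_combination ((∏ i ∈ I, eps F i) * (∏ k ∈ Iᶜ.erase i, nm U k) *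
        (∏ i ∈ Kᶜ, idem U i) * (c K * w K) - (∏ i ∈ Kᶜ, idem U i) *
        algebraMap ℚ _ (Fintype.card (U i) : ℚ)⁻¹ * w I) * h1
  refine ⟨∑ K, coIdem U K * (∏ i ∈ Kᶜ, idem U i) * (c K * w K), fun I => ?_, fun x hx => ?_⟩
  · rw [mul_sum, sum_congr rfl fun K _ => key I K, ← sum_mul, sum_coIdem_mul_prod_idem, one_mul]
  · rw [mul_sum]
    refine sum_eq_zero fun K _ => ?_
    linear_combination (coIdem U K * (∏ i ∈ Kᶜ, idem U i) * c K) * hx K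

/-- In an odd distribution, the half trace of the generator with support `I` is an integral
combination of conjugates of generators with smaller support if `#I` is even. -/
theorem trProd_mul_mem {J : ∀ i, U i} (hJ : J * J = 1) {H : ∀ i, Finset (U i)}
    (hH : ∀ i c, c ∈ H i ↔ J i * c ∉ H i) {w : Finset ι → GrpRing U}
    (hw1 : ∀ I, ∀ i ∈ I, nm U i * w I = frobSub F i * w (I.erase i))
    (hw2 : ∀ I, ∀ i ∉ I, ∀ c : U i, gp (Pi.mulSingle i c) * w I = w I)
    (hw3 : ∀ I, gp J * w I = -w I) {I : Finset ι} (hI : Even #I) :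
    trProd H I * w I ∈ AddSubgroup.closure {x | ∃ g, ∃ L ⊂ I, x = gp g * w L} := by
  obtain ⟨η, hη, hη0⟩ := exists_latGen_mul_eq hw1 hw2
  obtain ⟨x, hx, hmem⟩ := exists_invariant_sub_mem (F := F) hJ hH hI
  have h1 : x * η = 0 := by
    have h2 := hη0 (gp J + 1) fun I => by rw [add_mul, hw3]; ring
    -- `J` fixes `x` and acts as `-1` on `η`.
    have h3 : (2 : ℚ) • (x * η) = 0 := by
      rw [two_smul]; linear_combination x * h2 - η * hx
    simpa using h3
  have h4 : trProd H I * w I = (trProd H I * latGen F I - x) * η := by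
    rw [← hη I]; linear_combination h1
  rw [h4]
  generalize trProd H I * latGen F I - x = z at hmem
  induction hmem using AddSubgroup.closure_induction with
  | mem y h =>
    obtain ⟨g, L, hL, rfl⟩ := h
    exact AddSubgroup.subset_closure ⟨g, L, hL, by rw [mul_assoc, hη]⟩
  | zero => simp
  | add a b _ _ ha hb => rw [add_mul]; exact add_mem ha hb
  | neg a _ ha => rw [neg_mul]; exact neg_mem ha

end

end OddDistribution

/-! ### Generation of an odd distribution by basis indices -/

namespace OddDistribution

open Finset

noncomputable section

variable {ι : Type*} [Fintype ι] [LinearOrder ι] {U : ι → Type*} [∀ i, CommGroup (U i)]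
  [∀ i, Fintype (U i)] [∀ i, DecidableEq (U i)] {F : ι → ∀ i, U i}

/-- The indices `(I, c)` of the basis elements `c • w I` of an odd distribution `w`. -/
structure IsBasisIndex (J : ∀ i, U i) (H : ∀ i, Finset (U i)) (I : Finset ι) (c : ∀ i, U i) :
    Prop where
  eq_one : ∀ i ∉ I, c i = 1
  ne_neg : ∀ i ∈ I, c i ≠ J i
  mem_half : ∀ k, c k ≠ 1 → (∀ l > k, c l = 1) → c k ∈ H k
  odd_card : c = 1 → Odd #I

theorem exists_last_ne_one {c : ∀ i, U i} (hc : c ≠ 1) :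
    ∃ k, c k ≠ 1 ∧ ∀ l > k, c l = 1 := by
  obtain ⟨i, hi⟩ := Function.ne_iff.1 hc
  have hne : (univ.filter fun i => c i ≠ 1).Nonempty := ⟨i, by simpa using hi⟩
  refine ⟨(univ.filter fun i => c i ≠ 1).max' hne, (mem_filter.1 (max'_mem _ hne)).2, ?_⟩
  intro l hl
  by_contra h
  exact absurd (le_max' _ l (by simpa using h)) (not_le.2 hl)

theorem gp_mul_eq_self {w : GrpRing U} {I : Finset ι}
    (hw : ∀ i ∉ I, ∀ c : U i, gp (Pi.mulSingle i c) * w = w) {g : ∀ i, U i}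
    (hg : ∀ i ∈ I, g i = 1) : gp g * w = w := by
  rw [← univ_prod_mulSingle g]
  refine prod_induction _ (fun g => gp g * w = w) ?_ (by simp) ?_
  · intro a b ha hb; rw [map_mul, mul_assoc, hb, ha]
  · intro i _
    by_cases hi : i ∈ I
    · simp [hg i hi]
    · exact hw i hi _

theorem gp_mul_congr {w : GrpRing U} {I : Finset ι}
    (hw : ∀ i ∉ I, ∀ c : U i, gp (Pi.mulSingle i c) * w = w) {g h : ∀ i, U i}
    (hgh : ∀ i ∈ I, g i = h i) : gp g * w = gp h * w := by
  have h1 := gp_mul_eq_self hw (g := h⁻¹ * g) fun i hi => by simp [hgh i hi]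
  conv_rhs => rw [← h1]
  rw [← mul_assoc, ← map_mul, mul_inv_cancel_left]

/-- Modulo `D` the norm over `U b` vanishes on `w`, so a conjugate with `b`th component `J b` is
minus the sum of those with the other components. The new elements change only in the offending
positions, which are treated one by one. -/
theorem mem_of_forall_reduced {D : AddSubgroup (GrpRing U)} {w : GrpRing U} {I : Finset ι}
    {J : ∀ i, U i}
    (hD : ∀ i ∈ I, ∀ c : ∀ i, U i, gp c * (nm U i * w) ∈ D) (B : Finset ι) (hB : B ⊆ I)
    (c : ∀ i, U i)
    (h : ∀ c' : ∀ i, U i, (∀ i, c i ≠ J i ∨ i ∉ B → c' i = c i) → (∀ i ∈ B, c' i ≠ J i) →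
      gp c' * w ∈ D) : gp c * w ∈ D := by
  induction B using Finset.induction_on generalizing c with
  | empty => exact h c (fun _ _ => rfl) (by simp)
  | insert b B hb ih =>
    rw [insert_subset_iff] at hB
    refine ih hB.2 c fun c' hc' hcB => ?_
    by_cases hcb : c' b = J b
    · have hc2 : c b = J b := by rw [← hc' b (Or.inr hb)]; exact hcb
      have h1 := hD b hB.1 (Pi.mulSingle b (c' b)⁻¹ * c')
      rw [← mul_assoc, nm, tr, mul_sum, sum_mul,
        ← add_sum_erase _ _ (mem_univ (c' b))] at h1
      have h2 : gp (Pi.mulSingle b (c' b)⁻¹ * c') * gp (Pi.mulSingle b (c' b)) =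
          (gp c' : GrpRing U) := by
        rw [← map_mul, mul_right_comm, ← Pi.mulSingle_mul]; simp
      rw [h2] at h1
      refine (AddSubgroup.add_mem_cancel_right _ (sum_mem fun d hd => ?_)).1 h1
      rw [← map_mul]
      refine h _ ?_ ?_
      · intro i hi
        have hib : i ≠ b := by
          rintro rfl
          rcases hi with hi | hi
          · exact hi hc2
          · exact hi (mem_insert_self _ _)
        have : c' i = c i := hc' i (hi.imp_right fun h h' => h (mem_insert_of_mem h'))
        simp [Pi.mulSingle_eq_of_ne hib, this]
      · intro i hi
        by_cases hib : i = b
        · subst hib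
          simp only [Pi.mul_apply, Pi.mulSingle_eq_same, inv_mul_cancel, one_mul, ← hcb]
          exact ne_of_mem_erase hd
        · simpa [Pi.mulSingle_eq_of_ne hib] using hcB i ((mem_insert.1 hi).resolve_left hib)
    · refine h c' (fun i hi => hc' i (hi.imp_right fun h h' => h (mem_insert_of_mem h'))) ?_
      intro i hi
      rcases mem_insert.1 hi with rfl | hi
      exacts [hcb, hcB i hi]

theorem trProd_eq_sum (H : ∀ i, Finset (U i)) (I : Finset ι) :
    trProd H I = ∑ x ∈ Fintype.piFinset fun i => if i ∈ I then H i else {1}, gp x := by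
  have h1 : trProd H I = ∏ i, tr i (if i ∈ I then H i else {1}) := by
    have h2 : ∏ i ∈ Iᶜ, tr i (if i ∈ I then H i else {1}) = 1 :=
      prod_eq_one fun i hi => by rw [if_neg (mem_compl.1 hi)]; simp [tr]
    rw [trProd, ← prod_mul_prod_compl I, h2, mul_one]
    exact prod_congr rfl fun i hi => by rw [if_pos hi]
  simp only [h1, tr]
  rw [prod_univ_sum]
  exact sum_congr rfl fun x _ => (gp_eq_prod x).symm

/-- The conjugates of the members of an odd distribution are integral combinations of those with a
basis index. -/
theorem gp_mul_mem_closure {J : ∀ i, U i} (hJ : J * J = 1) {H : ∀ i, Finset (U i)}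
    (hH : ∀ i c, c ∈ H i ↔ J i * c ∉ H i) (hH1 : ∀ i, 1 ∈ H i) {w : Finset ι → GrpRing U}
    (hw1 : ∀ I, ∀ i ∈ I, nm U i * w I = frobSub F i * w (I.erase i))
    (hw2 : ∀ I, ∀ i ∉ I, ∀ c : U i, gp (Pi.mulSingle i c) * w I = w I)
    (hw3 : ∀ I, gp J * w I = -w I) (I : Finset ι) (c : ∀ i, U i) :
    gp c * w I ∈ AddSubgroup.closure {x | ∃ L ⊆ I, ∃ c', IsBasisIndex J H L c' ∧
      x = gp c' * w L} := by
  induction I using Finset.strongInduction generalizing c with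
  | H I ih =>
  set D := AddSubgroup.closure {x | ∃ L ⊆ I, ∃ c', IsBasisIndex J H L c' ∧ x = gp c' * w L} with hDdef
  have hJJ (i : ι) : J i * J i = 1 := congrFun hJ i
  have hlow : ∀ L ⊂ I, ∀ g, gp g * w L ∈ D := fun L hL g =>
    AddSubgroup.closure_mono (by
      rintro x ⟨L', hL', c', h⟩
      exact ⟨L', hL'.trans hL.subset, c', h⟩) (ih L hL g)
  have hbas : ∀ c', IsBasisIndex J H I c' → gp c' * w I ∈ D := fun c' hc' =>
    AddSubgroup.subset_closure ⟨I, subset_rfl, c', hc', rfl⟩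
  have hD : ∀ i ∈ I, ∀ c : ∀ i, U i, gp c * (nm U i * w I) ∈ D := by
    intro i hi c
    have h1 : gp c * (nm U i * w I) = gp c * w (I.erase i) - gp (c * (F i)⁻¹) * w (I.erase i) := by
      rw [hw1 I i hi, frobSub, map_mul]; ring
    rw [h1]
    exact sub_mem (hlow _ (erase_ssubset hi) _) (hlow _ (erase_ssubset hi) _)
  have hJH (i : ι) : J i ∉ H i := by simpa using (hH i 1).1 (hH1 i)
  -- Downward induction on the last nontrivial position `k`. If `c k` lies in the wrong half,
  -- multiply by `J` and remove the components equal to `J i` for `i ≠ k`. Position `k` is then in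
  -- the right half, and the last nontrivial position is `k` or later.
  have hred : ∀ k, ∀ c : ∀ i, U i, (∀ i ∉ I, c i = 1) → (∀ i ∈ I, c i ≠ J i) → c k ≠ 1 →
      (∀ l > k, c l = 1) → gp c * w I ∈ D := by
    intro k
    induction k using WellFoundedGT.induction with
    | ind k ihk =>
    intro c hc1 hcJ hck hcl
    have hkI : k ∈ I := by by_contra h; exact hck (hc1 k h)
    by_cases hkH : c k ∈ H k
    · refine hbas c ⟨hc1, hcJ, fun k' hk' hl' => ?_, fun h => absurd (congrFun h k) hck⟩
      rcases lt_trichotomy k k' with h | rfl | h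
      · exact absurd (hcl k' h) hk'
      · exact hkH
      · exact absurd (hl' k h) hck
    · have hc1J : gp c * w I = -(gp (fun i => if i ∈ I then J i * c i else 1) * w I) := by
        have h1 := gp_mul_congr (hw2 I) (g := fun i => if i ∈ I then J i * c i else 1) (h := c * J)
          fun i hi => by simp [hi, mul_comm]
        rw [h1, map_mul, mul_assoc, hw3]
        ring
      rw [hc1J]
      refine neg_mem (mem_of_forall_reduced (J := J) hD (I.erase k) (erase_subset _ _) _ ?_)
      intro c' hc' hcB
      have hk' : c' k = J k * c k := by
        rw [hc' k (Or.inr (notMem_erase k I)), if_pos hkI]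
      have hkH' : c' k ∈ H k := by
        rw [hk']; by_contra h; exact hkH ((hH k _).2 h)
      have hkJ : c' k ≠ J k := by rw [hk']; simpa using hck
      have hk1 : c' k ≠ 1 := by
        rw [hk']
        intro h
        apply hcJ k hkI
        have := congrArg (J k * ·) h
        simpa [← mul_assoc, hJJ] using this
      have hoff : ∀ i ∉ I, c' i = 1 := fun i hi => by
        rw [hc' i (Or.inr fun h => hi (mem_of_mem_erase h)), if_neg hi]
      have hall : ∀ i ∈ I, c' i ≠ J i := fun i hi => by
        by_cases hik : i = k
        · subst hik; exact hkJ
        · exact hcB i (mem_erase.2 ⟨hik, hi⟩)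
      obtain ⟨k', hk'1, hk'2⟩ := exists_last_ne_one (c := c') fun h => hk1 (congrFun h k)
      rcases lt_trichotomy k k' with h | rfl | h
      · exact ihk k' h c' hoff hall hk'1 hk'2
      · refine hbas c' ⟨hoff, hall, fun k' hk' hl' => ?_, fun h => absurd (congrFun h k) hk1⟩
        rcases lt_trichotomy k k' with h | rfl | h
        · exact absurd (hk'2 k' h) hk'
        · exact hkH'
        · exact absurd (hl' k h) hk1
      · exact absurd (hk'2 k h) hk1
  -- For even `#I` the term `1` occurs once in the half-trace relation, and all other terms have
  -- components in the halves `H i`, so they have basis indices.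
  have hone : gp 1 * w I ∈ D := by
    rcases Nat.even_or_odd #I with hI | hI
    · have h1 : trProd H I * w I ∈ D := by
        refine (AddSubgroup.closure_le D).2 ?_ (trProd_mul_mem (F := F) hJ hH hw1 hw2 hw3 hI)
        rintro _ ⟨g, L, hL, rfl⟩
        exact hlow L hL g
      have hmem : (1 : ∀ i, U i) ∈ Fintype.piFinset fun i => if i ∈ I then H i else {1} := by
        rw [Fintype.mem_piFinset]
        intro i
        split_ifs
        · exact hH1 i
        · simp
      rw [trProd_eq_sum, ← add_sum_erase _ _ hmem, add_mul, sum_mul] at h1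
      refine (AddSubgroup.add_mem_cancel_right _ (sum_mem fun x hx => hbas x ?_)).1 h1
      rw [mem_erase, Fintype.mem_piFinset] at hx
      have hxI (i : ι) (hi : i ∈ I) : x i ∈ H i := by simpa [hi] using hx.2 i
      have hx1 (i : ι) (hi : i ∉ I) : x i = 1 := by simpa [hi] using hx.2 i
      refine ⟨hx1, fun i hi h => hJH i (h ▸ hxI i hi), fun k hk _ => hxI k ?_,
        fun h => absurd h hx.1⟩
      by_contra h; exact hk (hx1 k h)
    · refine hbas 1 ⟨fun _ _ => rfl, fun i _ h => hJH i ?_, fun k hk => absurd rfl hk, fun _ => hI⟩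
      rw [← h]; exact hH1 i
  rw [gp_mul_congr (hw2 I) (h := fun i => if i ∈ I then c i else 1) fun i hi => by simp [hi]]
  refine mem_of_forall_reduced (J := J) hD I subset_rfl _ fun c' hc' hcI => ?_
  by_cases h1 : c' = 1
  · rw [h1]; exact hone
  · obtain ⟨k, hk1, hk2⟩ := exists_last_ne_one h1
    refine hred k c' (fun i hi => ?_) hcI hk1 hk2
    rw [hc' i (Or.inr hi), if_neg hi]

/-! ### Counting basis indices -/

/-- The group elements `g` that encode a basis index `(I, c)`, where `I` is the set of all `i` with
`g i ≠ J i`, and `c` agrees with `g` on `I`. -/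
def basisCodes (J : ∀ i, U i) (H : ∀ i, Finset (U i)) : Set (∀ i, U i) :=
  {g | IsBasisIndex J H (univ.filter fun i => g i ≠ J i) fun i => if g i = J i then 1 else g i}

/-- The last index `k` for which `g k` is neither `1` nor `J k`, or `i₀` if there is none. -/
def flipIndex (J : ∀ i, U i) (i₀ : ι) (g : ∀ i, U i) : ι :=
  if h : (univ.filter fun i => g i ≠ 1 ∧ g i ≠ J i).Nonempty then
    (univ.filter fun i => g i ≠ 1 ∧ g i ≠ J i).max' h else i₀

/-- Multiply the component at `flipIndex` by `J`. -/
def flip (J : ∀ i, U i) (i₀ : ι) (g : ∀ i, U i) : ∀ i, U i :=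
  Pi.mulSingle (flipIndex J i₀ g) (J (flipIndex J i₀ g)) * g

theorem flipIndex_flip {J : ∀ i, U i} (hJ : J * J = 1) (i₀ : ι) (g : ∀ i, U i) :
    flipIndex J i₀ (flip J i₀ g) = flipIndex J i₀ g := by
  have hJJ (i : ι) : J i * J i = 1 := congrFun hJ i
  have h1 : (univ.filter fun i => flip J i₀ g i ≠ 1 ∧ flip J i₀ g i ≠ J i) =
      univ.filter fun i => g i ≠ 1 ∧ g i ≠ J i := by
    refine filter_congr fun i _ => ?_
    rw [flip]
    generalize flipIndex J i₀ g = k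
    by_cases hik : i = k
    · subst hik
      have h2 : J i * g i = 1 ↔ g i = J i := by
        rw [← inv_eq_iff_mul_eq_one, inv_eq_of_mul_eq_one_right (hJJ i), eq_comm]
      simp [h2, and_comm]
    · simp [Pi.mulSingle_eq_of_ne hik]
  rw [flipIndex, flipIndex]
  simp only [h1]

theorem flip_flip {J : ∀ i, U i} (hJ : J * J = 1) (i₀ : ι) (g : ∀ i, U i) :
    flip J i₀ (flip J i₀ g) = g := by
  have hJJ (i : ι) : J i * J i = 1 := congrFun hJ i
  conv_lhs => rw [flip, flipIndex_flip hJ]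
  rw [flip, ← mul_assoc, ← Pi.mulSingle_mul, hJJ]; simp

/-- Flipping the last component different from `1` and `J` moves it to the other half. If there is
none, then `c = 1`, and flipping at `i₀` changes the parity of the support. -/
theorem flip_notMem {J : ∀ i, U i} (hJ : J * J = 1) {H : ∀ i, Finset (U i)}
    (hH : ∀ i c, c ∈ H i ↔ J i * c ∉ H i) (i₀ : ι) {g : ∀ i, U i}
    (hg : g ∈ basisCodes J H) : flip J i₀ g ∉ basisCodes J H := by
  have hJJ (i : ι) : J i * J i = 1 := congrFun hJ i
  have hJ1 (i : ι) : J i ≠ 1 := fun h => by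
    have := hH i 1; rw [h, one_mul] at this; tauto
  intro hf
  by_cases hne : (univ.filter fun i => g i ≠ 1 ∧ g i ≠ J i).Nonempty
  · set k := (univ.filter fun i => g i ≠ 1 ∧ g i ≠ J i).max' hne with hk
    have hfi : flipIndex J i₀ g = k := by rw [flipIndex, dif_pos hne]
    have hkmem := (mem_filter.1 (max'_mem _ hne)).2
    rw [← hk] at hkmem
    have hlast : ∀ l > k, g l = 1 ∨ g l = J l := by
      intro l hl
      by_contra! h
      exact absurd (le_max' _ l (by simpa using h)) (not_le.2 hl)
    have h1 := hg.mem_half k (by simp [hkmem.1, hkmem.2]) fun l hl => by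
      rcases hlast l hl with h | h <;> simp [h]
    have hfk : flip J i₀ g k = J k * g k := by rw [flip, hfi]; simp
    have hfl : ∀ l > k, flip J i₀ g l = g l := fun l hl => by
      rw [flip, hfi]; simp [Pi.mulSingle_eq_of_ne hl.ne']
    have hne1 : J k * g k ≠ J k := by simpa using hkmem.1
    have hne2 : J k * g k ≠ 1 := by
      intro h
      apply hkmem.2
      have := congrArg (J k * ·) h
      simpa [← mul_assoc, hJJ] using this
    have h2 := hf.mem_half k (by simp [hfk, hne2, hkmem.1]) fun l hl => by
      rw [hfl l hl]
      rcases hlast l hl with h | h <;> simp [h]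
    simp only [hfk, if_neg hne1] at h2
    simp only [if_neg hkmem.2] at h1
    exact (hH k _).1 h1 h2
  · have hfi : flipIndex J i₀ g = i₀ := by rw [flipIndex, dif_neg hne]
    have hall : ∀ i, g i = 1 ∨ g i = J i := by
      intro i
      by_contra! h
      exact hne ⟨i, by simpa using h⟩
    have hf0 : flip J i₀ g i₀ = J i₀ * g i₀ := by rw [flip, hfi]; simp
    have hfl : ∀ l ≠ i₀, flip J i₀ g l = g l := fun l hl => by
      rw [flip, hfi]; simp [Pi.mulSingle_eq_of_ne hl]
    have h1 := hg.odd_card (by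
      funext i
      rcases hall i with h | h <;> simp [h])
    have hall' : ∀ i, flip J i₀ g i = 1 ∨ flip J i₀ g i = J i := by
      intro i
      by_cases hi : i = i₀
      · subst hi
        rw [hf0]
        rcases hall i with h | h <;> simp [h, hJJ]
      · rw [hfl i hi]; exact hall i
    have h2 := hf.odd_card (by
      funext i
      rcases hall' i with h | h <;> simp [h])
    have h3 : ∀ i ≠ i₀, (flip J i₀ g i ≠ J i ↔ g i ≠ J i) := fun i hi => by rw [hfl i hi]
    rcases hall i₀ with h | h
    · have h4 : (univ.filter fun i => g i ≠ J i) =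
          insert i₀ (univ.filter fun i => flip J i₀ g i ≠ J i) := by
        ext i
        by_cases hi : i = i₀
        · subst hi; simp [h, (hJ1 i).symm]
        · simp only [mem_filter, mem_univ, true_and, mem_insert, hi, false_or, h3 i hi]
      rw [h4, card_insert_of_notMem (by simp [hf0, h])] at h1
      exact (Nat.not_even_iff_odd.2 h2) (by simpa [Nat.odd_add_one] using h1)
    · have h4 : (univ.filter fun i => flip J i₀ g i ≠ J i) =
          insert i₀ (univ.filter fun i => g i ≠ J i) := by
        ext i
        by_cases hi : i = i₀
        · subst hi; simp [hf0, h, hJJ, (hJ1 i).symm]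
        · simp only [mem_filter, mem_univ, true_and, mem_insert, hi, false_or, h3 i hi]
      rw [h4, card_insert_of_notMem (by simp [h])] at h2
      exact (Nat.not_even_iff_odd.2 h1) (by simpa [Nat.odd_add_one] using h2)

-- The codes and their flips are disjoint sets of equal size.
open scoped Classical in
theorem two_mul_card_basisCodes_le {J : ∀ i, U i} (hJ : J * J = 1) {H : ∀ i, Finset (U i)}
    (hH : ∀ i c, c ∈ H i ↔ J i * c ∉ H i) [Nonempty ι] :
    2 * #(univ.filter fun g => g ∈ basisCodes J H) ≤ Fintype.card (∀ i, U i) := by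
  obtain ⟨i₀⟩ := ‹Nonempty ι›
  set B := univ.filter fun g => g ∈ basisCodes J H with hB
  have hd : Disjoint B (B.image (flip J i₀)) := by
    rw [disjoint_left]
    intro g hg hg'
    obtain ⟨h, hh, rfl⟩ := mem_image.1 hg'
    exact flip_notMem hJ hH i₀ (mem_filter.1 hh).2 (mem_filter.1 hg).2
  have hc : #(B.image (flip J i₀)) = #B :=
    card_image_of_injective _ fun a b hab => by
      rw [← flip_flip hJ i₀ a, hab, flip_flip hJ]
  have := card_le_univ (B ∪ B.image (flip J i₀))
  rw [card_union_of_disjoint hd, hc] at this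
  omega

-- The tuples equal to `J` except for a component `c ∈ H i` at one `i` are codes of support `{i}`.
-- They leave room for the `∑ #(H i)` elements that replace the basis elements supported at one
-- prime.
open scoped Classical in
theorem two_mul_card_add_le {J : ∀ i, U i} (hJ : J * J = 1) {H : ∀ i, Finset (U i)}
    (hH : ∀ i c, c ∈ H i ↔ J i * c ∉ H i) (hH1 : ∀ i, 1 ∈ H i) [Nonempty ι] :
    2 * (#(univ.filter fun g => g ∈ basisCodes J H ∧ 2 ≤ #(univ.filter fun i => g i ≠ J i)) +
      ∑ i, #(H i)) ≤ Fintype.card (∀ i, U i) := by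
  refine le_trans (Nat.mul_le_mul_left 2 ?_) (two_mul_card_basisCodes_le hJ hH)
  have hJH (i : ι) : J i ∉ H i := by simpa using (hH i 1).1 (hH1 i)
  set B := univ.filter fun g => g ∈ basisCodes J H with hB
  set B₂ := univ.filter fun g => g ∈ basisCodes J H ∧ 2 ≤ #(univ.filter fun i => g i ≠ J i)
    with hB₂
  set f : (Σ i, U i) → ∀ i, U i := fun p => Function.update J p.1 p.2 with hf
  have hsupp (i : ι) (c : U i) (hc : c ∈ H i) :
      (univ.filter fun l => Function.update J i c l ≠ J l) = {i} := by
    ext l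
    by_cases hl : l = i
    · subst hl
      simp only [Function.update_self, mem_filter, mem_univ, true_and, mem_singleton, iff_true]
      rintro rfl; exact hJH l hc
    · simp [hl]
  have hinj : Set.InjOn f (univ.sigma H : Finset (Σ i, U i)) := by
    rintro ⟨i, c⟩ hc ⟨i', c'⟩ hc' h
    simp only [coe_sigma, Set.mem_sigma_iff, mem_coe] at hc hc'
    have h1 := hsupp i c hc.2
    have h2 := hsupp i' c' hc'.2
    simp only [hf] at h
    rw [h, h2, singleton_inj] at h1
    subst h1
    have := congrFun h i'
    simp only [Function.update_self] at this
    rw [this]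
  have hd : Disjoint B₂ ((univ.sigma H).image f) := by
    rw [disjoint_left]
    intro g hg hg'
    obtain ⟨⟨i, c⟩, hc, rfl⟩ := mem_image.1 hg'
    have h1 := (mem_filter.1 hg).2.2
    rw [hf, hsupp i c (mem_sigma.1 hc).2] at h1
    simp at h1
  have hc : #((univ.sigma H).image f) = ∑ i, #(H i) := by
    rw [card_image_of_injOn hinj, card_sigma]
  rw [← hc, ← card_union_of_disjoint hd]
  refine card_le_card (union_subset (fun g hg => ?_) fun g hg => ?_)
  · exact mem_filter.2 ⟨mem_univ _, (mem_filter.1 hg).2.1⟩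
  · obtain ⟨⟨i, c⟩, hc, rfl⟩ := mem_image.1 hg
    have hcH := (mem_sigma.1 hc).2
    simp only at hcH
    refine mem_filter.2 ⟨mem_univ _, ?_⟩
    have hs := hsupp i c hcH
    have hval (l : ι) (hl : l ≠ i) : (if Function.update J i c l = J l then 1 else
        Function.update J i c l) = 1 := by simp [hl]
    have hvali : (if Function.update J i c i = J i then 1 else Function.update J i c i) = c := by
      rw [Function.update_self, if_neg (by rintro rfl; exact hJH i hcH)]
    refine ⟨?_, ?_, ?_, ?_⟩
    · intro l hl
      simp only [hf] at hl ⊢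
      rw [hs, mem_singleton] at hl
      exact hval l hl
    · intro l hl
      simp only [hf] at hl ⊢
      rw [hs, mem_singleton] at hl
      subst hl
      rw [hvali]
      rintro rfl; exact hJH l hcH
    · intro k hk _
      simp only [hf] at hk ⊢
      by_cases hki : k = i
      · subst hki; rw [hvali]; exact hcH
      · exact absurd (hval k hki) hk
    · intro _
      simp only [hf]
      rw [hs]; simp

end

end OddDistribution

/-! ### Distributions on `∏ ℤ / q i` as systems of group ring elements -/

namespace OddDistribution

open Finset

noncomputable section

section Local

theorem isUnit_or_isNilpotent {p e q : ℕ} (hp : p.Prime) (hq : q = p ^ e) (z : ZMod q) :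
    IsUnit z ∨ ∃ z', z = p * z' := by
  subst hq
  have : NeZero (p ^ e) := ⟨pow_ne_zero _ hp.ne_zero⟩
  by_cases h : p ∣ z.val
  · obtain ⟨k, hk⟩ := h
    right
    refine ⟨k, ?_⟩
    rw [← Nat.cast_mul, ← hk, ZMod.natCast_zmod_val]
  · left
    rw [← ZMod.natCast_zmod_val z, ZMod.isUnit_iff_coprime]
    exact Nat.Coprime.pow_right e ((hp.coprime_iff_not_dvd.2 h).symm)

theorem not_isUnit_iff {p e q : ℕ} (hp : p.Prime) (he : 0 < e) (hq : q = p ^ e) (z : ZMod q) :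
    ¬ IsUnit z ↔ ((q / p : ℕ) : ZMod q) * z = 0 := by
  have hqp : q / p * p = q := Nat.div_mul_cancel (hq ▸ dvd_pow_self p he.ne')
  have hq0 : 0 < q := hq ▸ pow_pos hp.pos e
  constructor
  · intro h
    obtain ⟨z', rfl⟩ := (isUnit_or_isNilpotent hp hq z).resolve_left h
    rw [← mul_assoc, ← Nat.cast_mul, hqp]; simp
  · intro h hu
    rw [hu.mul_left_eq_zero, ZMod.natCast_eq_zero_iff] at h
    have h1 : 0 < q / p := Nat.pos_of_ne_zero fun h0 => by rw [h0] at hqp; omega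
    exact absurd (Nat.le_of_dvd h1 h) (not_le.2 (Nat.div_lt_self hq0 hp.one_lt))

theorem isUnit_add {p e q : ℕ} (hp : p.Prime) (he : 0 < e) (hq : q = p ^ e) {u z : ZMod q}
    (hu : IsUnit u) (hz : ¬ IsUnit z) : IsUnit (u + z) := by
  by_contra h
  rw [not_isUnit_iff hp he hq] at h hz
  rw [mul_add, hz, add_zero, ← not_isUnit_iff hp he hq] at h
  exact h hu

end Local

variable {ι : Type*} [Fintype ι] [DecidableEq ι] {q : ι → ℕ} [∀ i, NeZero (q i)]

/-- The group ring element attached to a point `x` by a function `f`. -/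
def groupElt (f : (∀ i, ZMod (q i)) → ℚ) (x : ∀ i, ZMod (q i)) :
    GrpRing fun i => (ZMod (q i))ˣ :=
  ∑ g : ∀ i, (ZMod (q i))ˣ, f (x * fun i => (g i : ZMod (q i))) • gp g⁻¹

theorem gp_mul_groupElt (f : (∀ i, ZMod (q i)) → ℚ) (u : ∀ i, (ZMod (q i))ˣ)
    (x : ∀ i, ZMod (q i)) :
    gp u * groupElt f x = groupElt f ((fun i => (u i : ZMod (q i))) * x) := by
  rw [groupElt, groupElt, mul_sum, ← Equiv.sum_comp (Equiv.mulLeft u)]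
  refine sum_congr rfl fun g _ => ?_
  rw [mul_smul_comm, ← map_mul, Equiv.coe_mulLeft]
  congr 2
  · ext i; simp; ring
  · simp

theorem groupElt_neg {f : (∀ i, ZMod (q i)) → ℚ} (hf : ∀ x, f (-x) = -f x)
    (x : ∀ i, ZMod (q i)) : groupElt f (-x) = -groupElt f x := by
  simp only [groupElt, neg_mul, hf, neg_smul, sum_neg_distrib]

/-- Multiplication by a unit permutes the `n`-torsion, so the relation holds coefficient by
coefficient. -/
theorem sum_groupElt_add_single {f : (∀ i, ZMod (q i)) → ℚ} {i : ι} {n : ℕ}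
    (hf : ∀ x, ∑ z : ZMod (q i) with (n : ZMod (q i)) * z = 0, f (x + Pi.single i z) = f (n * x))
    (x : ∀ i, ZMod (q i)) :
    ∑ z : ZMod (q i) with (n : ZMod (q i)) * z = 0, groupElt f (x + Pi.single i z) = groupElt f (n * x) := by
  simp only [groupElt]
  rw [sum_comm]
  refine sum_congr rfl fun g _ => ?_
  rw [← sum_smul, mul_assoc, ← hf]
  congr 1
  refine sum_nbij' (fun z => z * (g i : ZMod (q i))) (fun z => z * ((g i)⁻¹ : (ZMod (q i))ˣ))
    ?_ ?_ ?_ ?_ ?_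
  · intro z hz
    rw [mem_filter] at hz ⊢
    exact ⟨mem_univ _, by rw [← mul_assoc, hz.2, zero_mul]⟩
  · intro z hz
    rw [mem_filter] at hz ⊢
    exact ⟨mem_univ _, by rw [← mul_assoc, hz.2, zero_mul]⟩
  · intro z _; simp
  · intro z _; simp
  · intro z _
    congr 1
    rw [add_mul]
    congr 1
    ext l
    by_cases hl : l = i
    · subst hl; simp
    · simp [Pi.single_eq_of_ne hl]

variable (q) in
/-- The point `∏ q l` over `l ∉ I`. -/
def basePoint (I : Finset ι) : ∀ i, ZMod (q i) := fun i => ((∏ l ∈ Iᶜ, q l : ℕ) : ZMod (q i))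

theorem basePoint_of_notMem {I : Finset ι} {i : ι} (hi : i ∉ I) : basePoint q I i = 0 := by
  rw [basePoint, ZMod.natCast_eq_zero_iff]
  exact dvd_prod_of_mem q (mem_compl.2 hi)

theorem isUnit_basePoint (hcop : ∀ i j, i ≠ j → Nat.Coprime (q i) (q j)) {I : Finset ι} {i : ι}
    (hi : i ∈ I) : IsUnit (basePoint q I i) := by
  rw [basePoint, ZMod.isUnit_iff_coprime]
  refine Nat.Coprime.prod_left fun l hl => hcop l i ?_
  rintro rfl; exact mem_compl.1 hl hi

theorem basePoint_erase {I : Finset ι} {i : ι} (hi : i ∈ I) :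
    basePoint q (I.erase i) = (q i : ∀ i, ZMod (q i)) * basePoint q I := by
  have h1 : (I.erase i)ᶜ = insert i Iᶜ := by
    ext k; by_cases hk : k = i <;> simp [hk]
  ext l
  simp only [basePoint, h1, Pi.mul_apply, Pi.natCast_apply]
  rw [prod_insert (by simpa using hi), Nat.cast_mul]

theorem coprime_prime {p e : ι → ℕ} (he : ∀ i, 0 < e i) (hqe : ∀ i, q i = p i ^ e i)
    (hcop : ∀ i j, i ≠ j → Nat.Coprime (q i) (q j)) {i l : ι} (h : l ≠ i) :
    Nat.Coprime (p i) (q l) :=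
  Nat.Coprime.coprime_dvd_left (hqe i ▸ dvd_pow_self (p i) (he i).ne') (hcop i l h.symm)

open scoped Classical in
/-- The Frobenius of `p i` away from the component `i`. -/
def frobElt (q p : ι → ℕ) (i l : ι) : (ZMod (q l))ˣ :=
  if h : l ≠ i ∧ Nat.Coprime (p i) (q l) then ZMod.unitOfCoprime (p i) h.2 else 1

section Prime

variable {p e : ι → ℕ} (hp : ∀ i, (p i).Prime) (he : ∀ i, 0 < e i) (hqe : ∀ i, q i = p i ^ e i)
  (hcop : ∀ i j, i ≠ j → Nat.Coprime (q i) (q j)) {f : (∀ i, ZMod (q i)) → ℚ}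

include hp he hqe hcop

theorem coe_frobElt {i l : ι} (h : l ≠ i) : (frobElt q p i l : ZMod (q l)) = p i := by
  rw [frobElt, dif_pos ⟨h, coprime_prime he hqe hcop h⟩, ZMod.coe_unitOfCoprime]

theorem nm_mul_groupElt_basePoint
    (hf : ∀ i (n : ℕ), n ∣ q i → ∀ x, ∑ z : ZMod (q i) with (n : ZMod (q i)) * z = 0, f (x + Pi.single i z) =
      f (n * x)) (I : Finset ι) (i : ι) (hi : i ∈ I) :
    nm (fun i => (ZMod (q i))ˣ) i * groupElt f (basePoint q I) =
      frobSub (frobElt q p) i * groupElt f (basePoint q (I.erase i)) := by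
  set b := basePoint q I with hb
  obtain ⟨u, hu⟩ := isUnit_basePoint hcop hi
  have hupd (z : ZMod (q i)) : b + Pi.single i (z - b i) = Function.update b i z := by
    ext l
    by_cases hl : l = i
    · subst hl; simp
    · simp [hl]
  -- The norm is the sum over the unit values of the `i`th component. The sum over all values is the
  -- distribution relation for `q i`; the nonunits are the `(q i / p i)`-torsion, and the relation
  -- for `q i / p i` brings in the inverse Frobenius.
  have h1 : groupElt f (basePoint q (I.erase i)) =
      ∑ z : ZMod (q i), groupElt f (Function.update b i z) := by
    rw [basePoint_erase hi, ← sum_groupElt_add_single (hf i (q i) dvd_rfl)]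
    simp only [CharP.cast_eq_zero, zero_mul, filter_true]
    rw [← Equiv.sum_comp (Equiv.subRight (b i))]
    exact sum_congr rfl fun z _ => by rw [← hupd]; rfl
  have h2 : gp (frobElt q p i)⁻¹ * groupElt f (basePoint q (I.erase i)) =
      ∑ z : ZMod (q i) with ¬ IsUnit z, groupElt f (Function.update b i z) := by
    have hqp : q i / p i * p i = q i :=
      Nat.div_mul_cancel (by rw [hqe i]; exact dvd_pow_self (p i) (he i).ne')
    have h3 := sum_groupElt_add_single (hf i (q i / p i) (Nat.div_dvd_of_dvd
      (by rw [hqe i]; exact dvd_pow_self (p i) (he i).ne'))) (Function.update b i 0)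
    have h4 : gp (frobElt q p i)⁻¹ * groupElt f (basePoint q (I.erase i)) =
        groupElt f ((q i / p i : ℕ) * Function.update b i 0) := by
      rw [gp_mul_groupElt, basePoint_erase hi]
      congr 1
      ext l
      by_cases hl : l = i
      · subst hl; simp
      · simp only [Pi.mul_apply, Pi.inv_apply, Pi.natCast_apply, Function.update_of_ne hl]
        rw [Units.inv_mul_eq_iff_eq_mul, coe_frobElt hp he hqe hcop hl, ← hb, ← mul_assoc,
          ← Nat.cast_mul, mul_comm (p i), hqp]
    rw [h4, ← h3]
    refine sum_congr (filter_congr fun z _ => (not_isUnit_iff (hp i) (he i) (hqe i) z).symm)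
      fun z _ => ?_
    congr 1
    ext l
    by_cases hl : l = i
    · subst hl; simp
    · simp [hl]
  have h5 : nm (fun i => (ZMod (q i))ˣ) i * groupElt f b =
      ∑ z : ZMod (q i) with IsUnit z, groupElt f (Function.update b i z) := by
    rw [nm, tr, sum_mul]
    refine sum_nbij (fun c => (c * u : (ZMod (q i))ˣ)) ?_ ?_ ?_ ?_
    · intro c _; simp
    · intro c _ c' _ h
      simpa [Units.ext_iff] using h
    · intro z hz
      obtain ⟨v, rfl⟩ := (mem_filter.1 hz).2
      exact ⟨v * u⁻¹, by simp, by simp⟩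
    · intro c _
      rw [gp_mul_groupElt]
      congr 1
      ext l
      by_cases hl : l = i
      · subst hl; simp [hb, hu]
      · simp [hl]
  rw [frobSub, sub_mul, one_mul, h2, h1, h5,
    ← sum_filter_add_sum_filter_not univ (fun z : ZMod (q i) => IsUnit z)]
  ring

/-- `B` contains the positions at which `x` may be neither zero nor a unit. Such a component is `p ^
k` times a unit, and the distribution relation for `p ^ k` expresses `x` through points with a unit
there and the same zeros. -/
theorem groupElt_mem_closure_units
    (hf : ∀ i (n : ℕ), n ∣ q i → ∀ x, ∑ z : ZMod (q i) with (n : ZMod (q i)) * z = 0, f (x + Pi.single i z) =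
      f (n * x)) (B : Finset ι) (x : ∀ i, ZMod (q i)) (hB : ∀ i, i ∉ B → x i = 0 ∨ IsUnit (x i)) :
    groupElt f x ∈ AddSubgroup.closure {w | ∃ y : ∀ i, ZMod (q i), (∀ i, y i = 0 ↔ x i = 0) ∧
      (∀ i, y i = 0 ∨ IsUnit (y i)) ∧ w = groupElt f y} := by
  induction B using Finset.induction_on generalizing x with
  | empty =>
    exact AddSubgroup.subset_closure ⟨x, fun _ => Iff.rfl, fun i => hB i (notMem_empty i), rfl⟩
  | insert i B hi ih =>
    by_cases hxi : x i = 0 ∨ IsUnit (x i)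
    · refine ih x fun l hl => ?_
      by_cases hli : l = i
      · subst hli; exact hxi
      · exact hB l (by simp [hli, hl])
    push Not at hxi
    obtain ⟨k, u', hu', hxu⟩ := Nat.exists_eq_pow_mul_and_not_dvd
      ((ZMod.val_ne_zero (x i)).2 hxi.1) (p i) (hp i).ne_one
    have hk : k < e i := by
      by_contra h
      apply hxi.1
      rw [← ZMod.val_eq_zero]
      refine Nat.eq_zero_of_dvd_of_lt ?_ (ZMod.val_lt (x i))
      rw [hxu]
      nth_rewrite 1 [hqe i]
      exact (pow_dvd_pow _ (not_lt.1 h)).mul_right _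
    have hnd : p i ^ k ∣ q i := by rw [hqe i]; exact pow_dvd_pow _ hk.le
    have hu : IsUnit (u' : ZMod (q i)) := by
      rw [ZMod.isUnit_iff_coprime, hqe i]
      exact Nat.Coprime.pow_right _ (((hp i).coprime_iff_not_dvd.2 hu').symm)
    set y : ∀ l, ZMod (q l) := Function.update
      (fun l => ((frobElt q p i l ^ k)⁻¹ : (ZMod (q l))ˣ) * x l) i u' with hy
    have hyx : ((p i ^ k : ℕ) : ∀ l, ZMod (q l)) * y = x := by
      ext l
      by_cases hl : l = i
      · subst hl
        simp only [hy, Pi.mul_apply, Pi.natCast_apply, Function.update_self]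
        rw [← Nat.cast_mul, ← hxu, ZMod.natCast_zmod_val]
      · simp only [hy, Pi.mul_apply, Pi.natCast_apply, Function.update_of_ne hl]
        rw [Nat.cast_pow, ← coe_frobElt hp he hqe hcop hl, ← Units.val_pow_eq_pow_val,
          Units.mul_inv_cancel_left]
    rw [← hyx, ← sum_groupElt_add_single (hf i _ hnd), hyx]
    refine sum_mem fun z hz => ?_
    -- Since `k < e i`, the `p ^ k`-torsion contains only nonunits; adding one to a unit leaves a
    -- unit.
    have hzu : ¬ IsUnit z := by
      intro h
      have h1 := (mem_filter.1 hz).2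
      rw [h.mul_left_eq_zero, ZMod.natCast_eq_zero_iff, hqe i,
        Nat.pow_dvd_pow_iff_le_right (hp i).one_lt] at h1
      omega
    obtain ⟨Y, hY⟩ : ∃ Y : ∀ l, ZMod (q l), Y = y + Pi.single i z := ⟨_, rfl⟩
    rw [← hY]
    have hun : IsUnit (Y i) := by
      have : Y i = u' + z := by simp [hY, hy]
      rw [this]
      exact isUnit_add (hp i) (he i) (hqe i) hu hzu
    have hq1 : Nontrivial (ZMod (q i)) := ⟨x i, 0, hxi.1⟩
    have hne (l : ι) (hl : l ≠ i) : Y l =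
        ((frobElt q p i l ^ k)⁻¹ : (ZMod (q l))ˣ) * x l := by
      simp [hY, hy, hl]
    have hiff (l : ι) : Y l = 0 ↔ x l = 0 := by
      by_cases hl : l = i
      · subst hl
        exact iff_of_false hun.ne_zero hxi.1
      · rw [hne l hl, Units.mul_right_eq_zero]
    have h2 := ih Y fun l hl => by
      by_cases hli : l = i
      · subst hli; exact Or.inr hun
      · rw [hne l hli, Units.mul_right_eq_zero, Units.isUnit_units_mul]
        exact hB l (by simp [hli, hl])
    refine AddSubgroup.closure_mono ?_ h2
    rintro w ⟨y', hy', hyu, rfl⟩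
    exact ⟨y', fun l => (hy' l).trans (hiff l), hyu, rfl⟩

end Prime

/-- The elements of `(ZMod n)ˣ` with representative less than `n / 2`. -/
def lowerHalf (n : ℕ) [NeZero n] : Finset (ZMod n)ˣ :=
  univ.filter fun c => 2 * (c : ZMod n).val < n

/-- For `n > 2` the representative `n / 2` is never prime to `n`, so negation has no boundary case.
-/
theorem mem_lowerHalf_iff_neg_notMem {n : ℕ} [NeZero n] (hn : 2 < n) (c : (ZMod n)ˣ) :
    c ∈ lowerHalf n ↔ -1 * c ∉ lowerHalf n := by
  have : Fact (1 < n) := ⟨by omega⟩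
  have hc0 : (c : ZMod n) ≠ 0 := c.ne_zero
  have h1 : (-(c : ZMod n)).val = n - (c : ZMod n).val := by
    rw [ZMod.neg_val, if_neg hc0]
  have h2 : (c : ZMod n).val < n := ZMod.val_lt _
  have h3 : 2 * (c : ZMod n).val ≠ n := by
    intro h
    have h4 := ZMod.val_coe_unit_coprime c
    have h5 : (c : ZMod n).val ∣ n := Dvd.intro_left 2 h
    have h6 := Nat.Coprime.eq_one_of_dvd h4 h5
    omega
  simp only [lowerHalf, mem_filter, mem_univ, true_and, neg_one_mul, Units.val_neg, h1]
  omega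

theorem one_mem_lowerHalf {n : ℕ} [NeZero n] (hn : 2 < n) : 1 ∈ lowerHalf n := by
  have : Fact (1 < n) := ⟨by omega⟩
  simp only [lowerHalf, mem_filter, mem_univ, true_and, Units.val_one, ZMod.val_one]
  omega

theorem two_mul_card_lowerHalf {n : ℕ} [NeZero n] (hn : 2 < n) :
    2 * #(lowerHalf n) = Nat.totient n := by
  have h1 : #(lowerHalf n) = #(lowerHalf n)ᶜ := by
    refine card_nbij' (fun c => -1 * c) (fun c => -1 * c) ?_ ?_ ?_ ?_
    · intro c hc
      exact mem_compl.2 ((mem_lowerHalf_iff_neg_notMem hn c).1 hc)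
    · intro c hc
      by_contra h
      exact mem_compl.1 hc ((mem_lowerHalf_iff_neg_notMem hn c).2 h)
    · intro c _; simp
    · intro c _; simp
  have h2 := card_add_card_compl (lowerHalf n)
  rw [← h1, ZMod.card_units_eq_totient] at h2
  omega

end

end OddDistribution

/-! ### The sawtooth function and its distribution relation -/

namespace OddDistribution

open Finset

noncomputable section

/-- The sawtooth function. -/
def saw (x : ℚ) : ℚ := if Int.fract x = 0 then 0 else Int.fract x - 1 / 2

theorem saw_add_int (x : ℚ) (n : ℤ) : saw (x + n) = saw x := by
  simp [saw]

theorem saw_neg (x : ℚ) : saw (-x) = -saw x := by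
  by_cases h : Int.fract x = 0
  · simp [saw, h, Int.fract_neg_eq_zero.2 h]
  · rw [saw, saw, if_neg h, if_neg (by rwa [Int.fract_neg_eq_zero]), Int.fract_neg h]; ring

theorem saw_of_lt {x : ℚ} (h0 : 0 < x) (h1 : x < 1) : saw x = x - 1 / 2 := by
  have : Int.fract x = x := Int.fract_eq_self.2 ⟨h0.le, h1⟩
  rw [saw, this, if_neg h0.ne']

theorem saw_zero : saw 0 = 0 := by simp [saw]

/-- The distribution relation of the sawtooth function. -/
theorem sum_saw {n : ℕ} (hn : 0 < n) (x : ℚ) :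
    ∑ k ∈ range n, saw (x + k / n) = saw (n * x) := by
  have hn' : (0 : ℚ) < n := by exact_mod_cast hn
  set S : ℚ → ℚ := fun x => ∑ k ∈ range n, saw (x + k / n) - saw (n * x) with hS
  -- Both sides have period `1 / n`, so it suffices to compare them on `[0, 1 / n)`. There every
  -- argument is below `1`, and only `x = 0` needs the exceptional value.
  have hper : Function.Periodic S (1 / n) := by
    intro x
    have h1 : saw (n * (x + 1 / n)) = saw (n * x) := by
      rw [mul_add, mul_one_div_cancel hn'.ne']
      exact_mod_cast saw_add_int (n * x) 1
    have h2 : ∑ k ∈ range n, saw (x + 1 / n + k / n) = ∑ k ∈ range n, saw (x + k / n) := by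
      have h3 := sum_range_succ (fun k : ℕ => saw (x + k / n)) n
      rw [sum_range_succ'] at h3
      have h4 : saw (x + (n : ℕ) / n) = saw (x + (0 : ℕ) / n) := by
        rw [div_self hn'.ne']
        simpa using saw_add_int x 1
      rw [h4] at h3
      rw [← add_right_cancel h3]
      refine sum_congr rfl fun k _ => ?_
      congr 1; push_cast; ring
    simp only [hS, h1, h2]
  have h0 : ∀ x : ℚ, 0 ≤ x → n * x < 1 → S x = 0 := by
    intro x hx0 hx1
    have hlt : ∀ k ∈ range n, x + k / n < 1 := by
      intro k hk
      have : (k : ℚ) + 1 ≤ n := by exact_mod_cast mem_range.1 hk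
      rw [← mul_lt_mul_iff_of_pos_left hn']
      rw [mul_add, mul_div_cancel₀ _ hn'.ne']; linarith
    have hsum : ∑ k ∈ range n, (x + (k : ℚ) / n - 1 / 2) = n * x - 1 / 2 := by
      have h5 : (∑ k ∈ range n, (k : ℚ)) = n * (n - 1) / 2 := by
        clear * -
        induction n with
        | zero => simp
        | succ n ih => rw [sum_range_succ, ih]; push_cast; ring
      rw [sum_sub_distrib, sum_add_distrib, ← sum_div, h5]
      simp only [sum_const, card_range, nsmul_eq_mul]
      field_simp; ring
    simp only [hS]
    rcases hx0.eq_or_lt with rfl | hx0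
    · rw [mul_zero, saw_zero, sub_zero]
      obtain ⟨n, rfl⟩ : ∃ k, n = k + 1 := ⟨n - 1, by omega⟩
      rw [sum_range_succ'] at hsum ⊢
      have : ∀ k ∈ range n, saw (0 + ((k + 1 : ℕ) : ℚ) / ((n + 1 : ℕ) : ℚ)) =
          0 + ((k + 1 : ℕ) : ℚ) / ((n + 1 : ℕ) : ℚ) - 1 / 2 := by
        intro k hk
        refine saw_of_lt (by positivity) (hlt (k + 1) ?_)
        rw [mem_range] at hk ⊢; omega
      rw [sum_congr rfl this]
      simp only [Nat.cast_zero, zero_div, add_zero, saw_zero] at hsum ⊢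
      linarith
    · rw [sum_congr rfl fun k hk => saw_of_lt (by positivity) (hlt k hk), hsum,
        saw_of_lt (by positivity) hx1, sub_self]
  have h1 : S x = S (x - ⌊n * x⌋ * (1 / n)) := (hper.sub_int_mul_eq _).symm
  have h2 : n * (x - ⌊n * x⌋ * (1 / n)) = Int.fract (n * x) := by
    rw [mul_sub, Int.fract]; field_simp
  have h3 : S x = 0 := by
    rw [h1]
    refine h0 _ ?_ ?_
    · rw [← mul_nonneg_iff_of_pos_left hn', h2]; exact Int.fract_nonneg _
    · rw [h2]; exact Int.fract_lt_one _
  exact sub_eq_zero.1 h3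

variable {ι : Type*} [Fintype ι] [DecidableEq ι] {q : ι → ℕ} [∀ i, NeZero (q i)]

/-- The Chinese remainder isomorphism. -/
def crt (hcop : ∀ i j, i ≠ j → Nat.Coprime (q i) (q j)) :
    ZMod (∏ i, q i) ≃+* ∀ i, ZMod (q i) :=
  ZMod.prodEquivPi q fun i j h => hcop i j h

/-- The sawtooth function of `-x / m` on `ℤ / m`, where `m = ∏ q i`. -/
def sawMod (hcop : ∀ i j, i ≠ j → Nat.Coprime (q i) (q j)) (x : ∀ i, ZMod (q i)) : ℚ :=
  saw (-((((crt hcop).symm x).val : ℚ) / (∏ i, q i : ℕ)))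

variable (hcop : ∀ i j, i ≠ j → Nat.Coprime (q i) (q j))

theorem saw_div_congr {m : ℕ} [NeZero m] {a b : ℤ} (h : (a : ZMod m) = b) :
    saw (-((a : ℚ) / m)) = saw (-((b : ℚ) / m)) := by
  obtain ⟨k, hk⟩ := (ZMod.intCast_eq_intCast_iff_dvd_sub _ _ _).1 h
  have hm : (m : ℚ) ≠ 0 := Nat.cast_ne_zero.2 (NeZero.ne m)
  have h1 : -((a : ℚ) / m) = -((b : ℚ) / m) + k := by
    have : (b : ℚ) - a = m * k := by exact_mod_cast hk
    field_simp; linarith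
  rw [h1, saw_add_int]

include hcop

theorem sawMod_intCast (a : ℤ) : sawMod hcop (a : ∀ i, ZMod (q i)) =
    saw (-((a : ℚ) / (∏ i, q i : ℕ))) := by
  have hm : NeZero (∏ i, q i) := ⟨prod_ne_zero_iff.2 fun i _ => NeZero.ne (q i)⟩
  rw [sawMod, map_intCast]
  refine saw_div_congr (a := (((a : ZMod (∏ i, q i)).val : ℕ) : ℤ)) ?_
  rw [Int.cast_natCast, ZMod.natCast_zmod_val]

theorem exists_intCast_eq (x : ∀ i, ZMod (q i)) : ∃ a : ℤ, (a : ∀ i, ZMod (q i)) = x := by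
  obtain ⟨a, ha⟩ := ZMod.intCast_surjective ((crt hcop).symm x)
  refine ⟨a, (crt hcop).symm.injective ?_⟩
  rw [map_intCast, ha]

theorem sawMod_neg (x : ∀ i, ZMod (q i)) : sawMod hcop (-x) = -sawMod hcop x := by
  obtain ⟨a, rfl⟩ := exists_intCast_eq hcop x
  rw [← Int.cast_neg, sawMod_intCast, sawMod_intCast, ← saw_neg]
  congr 1; push_cast; ring

/-- Under the Chinese remainder isomorphism the `n`-torsion of `ℤ / q i` consists of the residues `k
* (m / n)`, which turns the sum into `sum_saw`. -/
theorem sum_sawMod (i : ι) (n : ℕ) (hn : n ∣ q i) (x : ∀ i, ZMod (q i)) :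
    ∑ z : ZMod (q i) with (n : ZMod (q i)) * z = 0, sawMod hcop (x + Pi.single i z) =
      sawMod hcop (n * x) := by
  have hm : NeZero (∏ i, q i) := ⟨prod_ne_zero_iff.2 fun i _ => NeZero.ne (q i)⟩
  obtain ⟨a, rfl⟩ := exists_intCast_eq hcop x
  set m := ∏ i, q i with hmdef
  have hn0 : 0 < n := Nat.pos_of_dvd_of_pos hn (NeZero.pos _)
  have hqm : q i ∣ m := dvd_prod_of_mem q (mem_univ i)
  have hnm : m / n * n = m := Nat.div_mul_cancel (hn.trans hqm)
  have hm0 : (m : ℚ) ≠ 0 := Nat.cast_ne_zero.2 (NeZero.ne m)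
  have hmn0 : 0 < m / n := Nat.pos_of_ne_zero fun h => by
    rw [h, zero_mul] at hnm; exact NeZero.ne m hnm.symm
  have hn0' : (n : ℚ) ≠ 0 := Nat.cast_ne_zero.2 hn0.ne'
  have hnm' : ((m / n : ℕ) : ℚ) = m / n := by
    rw [eq_div_iff hn0']; exact_mod_cast hnm
  have hzero (l : ι) (hl : l ≠ i) : ((m / n : ℕ) : ZMod (q l)) = 0 := by
    rw [ZMod.natCast_eq_zero_iff]
    have h1 : q l * n ∣ m := by
      refine (Nat.mul_dvd_mul_left _ hn).trans ?_
      exact (hcop l i hl).mul_dvd_of_dvd_of_dvd (dvd_prod_of_mem q (mem_univ l)) hqm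
    exact (Nat.dvd_div_iff_mul_dvd (hn.trans hqm)).2 (by rwa [mul_comm])
  have hsm (a : ℤ) : sawMod hcop (a : ∀ i, ZMod (q i)) = saw (-((a : ℚ) / m)) :=
    sawMod_intCast hcop a
  have hsingle (k : ℕ) : Pi.single i (((k * (m / n) : ℕ)) : ZMod (q i)) =
      ((k * (m / n) : ℕ) : ∀ i, ZMod (q i)) := by
    ext l
    rw [Pi.natCast_apply]
    by_cases hl : l = i
    · subst hl; rw [Pi.single_eq_same]
    · rw [Pi.single_eq_of_ne hl, Nat.cast_mul, hzero l hl, mul_zero]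
  have h1 : ∑ z : ZMod (q i) with (n : ZMod (q i)) * z = 0,
      sawMod hcop ((a : ∀ i, ZMod (q i)) + Pi.single i z) =
      ∑ k ∈ range n, saw (-((a : ℚ) / m + k / n)) := by
    symm
    refine sum_bij (fun k _ => ((k * (m / n) : ℕ) : ZMod (q i))) ?_ ?_ ?_ ?_
    · intro k _
      rw [mem_filter]
      refine ⟨mem_univ _, ?_⟩
      rw [← Nat.cast_mul, ZMod.natCast_eq_zero_iff, mul_left_comm, mul_comm n, hnm]
      exact hqm.mul_left _
    · intro k hk k' hk' h
      have h2 : (Pi.single i ((k * (m / n) : ℕ) : ZMod (q i)) : ∀ i, ZMod (q i)) =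
        Pi.single i ((k' * (m / n) : ℕ) : ZMod (q i)) := congrArg _ h
      rw [hsingle, hsingle] at h2
      have h3 := congrArg (crt hcop).symm h2
      rw [map_natCast, map_natCast, ZMod.natCast_eq_natCast_iff] at h3
      have hlt : ∀ k ∈ range n, k * (m / n) < m := by
        intro k hk
        rw [mem_range] at hk
        calc k * (m / n) < n * (m / n) := Nat.mul_lt_mul_of_pos_right hk hmn0
          _ = m := by rw [mul_comm, hnm]
      have h4 := Nat.ModEq.eq_of_lt_of_lt h3 (hlt k hk) (hlt k' hk')
      exact Nat.eq_of_mul_eq_mul_right hmn0 h4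
    · intro z hz
      have hz' := (mem_filter.1 hz).2
      obtain ⟨b, hb⟩ : ∃ b : ℕ, b = ((crt hcop).symm (Pi.single i z)).val := ⟨_, rfl⟩
      have hbm : b < m := hb ▸ ZMod.val_lt _
      have hbz : (b : ∀ i, ZMod (q i)) = Pi.single i z := by
        apply (crt hcop).symm.injective
        rw [map_natCast, hb, ZMod.natCast_zmod_val]
      have hnb : m ∣ n * b := by
        rw [← ZMod.natCast_eq_zero_iff, ← map_eq_zero_iff (crt hcop) (crt hcop).injective,
          map_natCast, Nat.cast_mul, hbz]
        ext l
        by_cases hl : l = i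
        · subst hl; simpa using hz'
        · simp [hl]
      rw [← hnm, mul_comm] at hnb
      obtain ⟨k, hk⟩ := Nat.dvd_of_mul_dvd_mul_left hn0 hnb
      refine ⟨k, ?_, ?_⟩
      · rw [mem_range]
        by_contra h
        have : n * (m / n) ≤ k * (m / n) := Nat.mul_le_mul_right _ (not_lt.1 h)
        rw [mul_comm, hnm, mul_comm, ← hk] at this
        omega
      · have := congrFun hbz i
        rw [Pi.single_eq_same, Pi.natCast_apply, hk, mul_comm] at this
        exact this
    · intro k _
      have h2 : (a : ∀ i, ZMod (q i)) + ((k * (m / n) : ℕ) : ∀ i, ZMod (q i)) =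
        ((a + (k * (m / n) : ℕ) : ℤ) : ∀ i, ZMod (q i)) := by
        rw [Int.cast_add, Int.cast_natCast]
      rw [hsingle, h2, hsm, Int.cast_add, Int.cast_natCast, Nat.cast_mul, hnm']
      congr 2
      field_simp
  rw [h1, sum_congr rfl fun k _ => saw_neg _, sum_neg_distrib, sum_saw hn0]
  have h2 : ((n : ∀ i, ZMod (q i)) * (a : ∀ i, ZMod (q i))) =
      ((n * a : ℤ) : ∀ i, ZMod (q i)) := by rw [Int.cast_mul, Int.cast_natCast]
  rw [h2, hsm, ← saw_neg, Int.cast_mul, Int.cast_natCast]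
  congr 1
  ring

end

end OddDistribution

/-! ### Generators of the sawtooth distribution, in general and at prime power level -/

namespace OddDistribution

open Finset

noncomputable section

section Generation

variable {ι : Type*} [Fintype ι] [LinearOrder ι] {q : ι → ℕ} [∀ i, NeZero (q i)]
  (hcop : ∀ i j, i ≠ j → Nat.Coprime (q i) (q j)) (hpp : ∀ i, IsPrimePow (q i))
  (hq2 : ∀ i, 2 < q i)

theorem unit_mul_basePoint_eq_zero_iff [∀ i, Fact (1 < q i)]
    (hcop : ∀ i j, i ≠ j → Nat.Coprime (q i) (q j)) {L : Finset ι}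
    (c : ∀ i, (ZMod (q i))ˣ) (i : ι) :
    (c i : ZMod (q i)) * basePoint q L i = 0 ↔ i ∉ L := by
  constructor
  · intro h hi
    exact ((c i).isUnit.mul (isUnit_basePoint hcop hi)).ne_zero h
  · intro hi; rw [basePoint_of_notMem hi, mul_zero]

theorem mulSingle_mul_basePoint {L : Finset ι} {i : ι} (hi : i ∉ L) (c : (ZMod (q i))ˣ) :
    (fun l => ((Pi.mulSingle i c : ∀ l, (ZMod (q l))ˣ) l : ZMod (q l))) * basePoint q L =
      basePoint q L := by
  ext l
  rw [Pi.mul_apply]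
  by_cases hl : l = i
  · subst hl; rw [basePoint_of_notMem hi, mul_zero]
  · rw [Pi.mulSingle_eq_of_ne hl, Units.val_one, one_mul]

-- First all components become zero or units, then the generation theorem for odd distributions
-- applies with `J = -1`, the lower halves and the Frobenius elements of the `p i`. Supports never
-- grow.
include hpp hq2 in
theorem groupElt_sawMod_mem_closure (x : ∀ i, ZMod (q i)) :
    groupElt (sawMod hcop) x ∈ AddSubgroup.closure {w | ∃ (L : Finset ι) (c : ∀ i, (ZMod (q i))ˣ),
      (∀ i ∈ L, x i ≠ 0) ∧ IsBasisIndex (fun _ => -1) (fun i => lowerHalf (q i)) L c ∧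
      w = groupElt (sawMod hcop) ((fun i => (c i : ZMod (q i))) * basePoint q L)} := by
  choose p e hp he hpe using fun i => (isPrimePow_nat_iff (q i)).1 (hpp i)
  have : ∀ i, Fact (1 < q i) := fun i => ⟨by have := hq2 i; omega⟩
  refine AddSubgroup.closure_le _ |>.2 ?_ (groupElt_mem_closure_units hp he
    (fun i => (hpe i).symm) hcop (sum_sawMod hcop) univ x fun i hi => absurd (mem_univ i) hi)
  rintro _ ⟨y, hy0, hyu, rfl⟩
  have h1 : ∀ i, ∃ u : (ZMod (q i))ˣ,
      y i = u * basePoint q (univ.filter fun i => y i ≠ 0) i := by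
    intro i
    rcases hyu i with h | h
    · exact ⟨1, by rw [basePoint_of_notMem (by simpa using h), h, mul_zero]⟩
    · have h0 : i ∈ univ.filter fun i => y i ≠ 0 := by simpa using h.ne_zero
      obtain ⟨v, hv⟩ := isUnit_basePoint hcop h0
      obtain ⟨u, hu⟩ := h
      exact ⟨u * v⁻¹, by rw [← hu, ← hv, ← Units.val_mul, inv_mul_cancel_right]⟩
  choose u hu using h1
  have h2 : groupElt (sawMod hcop) y = gp u * groupElt (sawMod hcop)
      (basePoint q (univ.filter fun i => y i ≠ 0)) := by
    rw [gp_mul_groupElt]; congr 1; ext i; exact hu i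
  have h3 := gp_mul_mem_closure (F := frobElt q p) (J := fun i => (-1 : (ZMod (q i))ˣ))
    (H := fun i => lowerHalf (q i)) (w := fun I => groupElt (sawMod hcop) (basePoint q I))
    (by ext i; simp) (fun i c => mem_lowerHalf_iff_neg_notMem (hq2 i) c)
    (fun i => one_mem_lowerHalf (hq2 i))
    (fun I i hi => nm_mul_groupElt_basePoint hp he (fun i => (hpe i).symm) hcop
      (sum_sawMod hcop) I i hi)
    (fun I i hi c => by rw [gp_mul_groupElt, mulSingle_mul_basePoint hi])
    (fun I => by
      rw [gp_mul_groupElt, ← groupElt_neg (sawMod_neg hcop)]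
      congr 1; ext i; simp)
    (univ.filter fun i => y i ≠ 0) u
  rw [SetLike.mem_coe, h2]
  refine AddSubgroup.closure_mono ?_ h3
  rintro _ ⟨L, hL, c, hc, rfl⟩
  refine ⟨L, c, fun i hi => ?_, hc, gp_mul_groupElt _ _ _⟩
  have := (mem_filter.1 (hL hi)).2
  rwa [Ne, hy0] at this

end Generation

section Singles

/-- Generation of an odd distribution of prime power level. -/
theorem mem_closure_of_odd_distribution {E : Type*} [AddCommGroup E] {p q : ℕ} (hp : p.Prime)
    (hpq : p ∣ q) (hq : 0 < q) {f : ℤ → E} (hf0 : f 0 = 0) (hodd : ∀ y, f (-y) = -f y)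
    (hper : ∀ y, f (y + q) = f y)
    (hdist : ∀ y, ∑ j ∈ range p, f (y + j * (q / p : ℕ)) = f (p * y)) (k : ℕ) (b : ℤ)
    (hb : (q : ℤ) ∣ p ^ k * b) :
    f b ∈ AddSubgroup.closure {x | ∃ c : ℕ, 1 ≤ c ∧ 2 * c ≤ q - q / p ∧ x = f c} := by
  have hsmall (c : ℤ) (h1 : -((q - q / p : ℕ) : ℤ) ≤ 2 * c) (h2 : 2 * c ≤ (q - q / p : ℕ)) :
      f c ∈ AddSubgroup.closure {x | ∃ c : ℕ, 1 ≤ c ∧ 2 * c ≤ q - q / p ∧ x = f c} := by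
    rcases lt_trichotomy c 0 with h | h | h
    · rw [← neg_neg c, hodd]
      refine neg_mem (AddSubgroup.subset_closure ⟨c.natAbs, by omega, by omega, ?_⟩)
      congr 1; omega
    · rw [h, hf0]; exact zero_mem _
    · refine AddSubgroup.subset_closure ⟨c.natAbs, by omega, by omega, ?_⟩
      congr 1; omega
  have hper' (y : ℤ) (n : ℤ) : f (y + n * q) = f y := by
    induction n using Int.induction_on with
    | zero => simp
    | succ n ih =>
      rw [show y + ((n : ℤ) + 1) * q = y + n * q + q by ring, hper, ih]
    | pred n ih => rw [← ih, ← hper]; congr 1; ring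
  obtain ⟨d, rfl⟩ := hpq
  have hd : p * d / p = d := Nat.mul_div_cancel_left _ hp.pos
  rw [hd] at hsmall hdist ⊢
  have hd0 : 0 < d := Nat.pos_of_mul_pos_left hq
  have hdq : d ≤ p * d := Nat.le_mul_of_pos_left _ hp.pos
  induction k generalizing b with
  | zero =>
    obtain ⟨c, hc⟩ := hb
    have : b = 0 + c * (p * d : ℕ) := by rw [pow_zero, one_mul] at hc; rw [hc]; ring
    rw [this, hper', hf0]; exact zero_mem _
  | succ k ih =>
    have key (b : ℤ) (h1 : 0 ≤ b) (h2 : 2 * b ≤ (p * d : ℕ))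
        (hb : ((p * d : ℕ) : ℤ) ∣ p ^ (k + 1) * b) :
        f b ∈ AddSubgroup.closure {x | ∃ c : ℕ, 1 ≤ c ∧ 2 * c ≤ p * d - d ∧ x = f c} := by
      by_cases h3 : 2 * b ≤ (p * d - d : ℕ)
      · exact hsmall b (by omega) h3
      -- Here `(q - q/p) / 2 < b ≤ q / 2`. In the distribution relation `f (p b)` is covered by the
      -- induction on `k`, and the terms other than `f b`, shifted by one period, have arguments of
      -- absolute value at most `(q - q/p) / 2`.
      · have h4 := hdist b
        obtain ⟨r, hr⟩ : ∃ r, p = r + 1 := ⟨p - 1, by have := hp.pos; omega⟩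
        have h5 : f (p * b) ∈ AddSubgroup.closure
            {x | ∃ c : ℕ, 1 ≤ c ∧ 2 * c ≤ p * d - d ∧ x = f c} :=
          ih (p * b) (by rwa [← mul_assoc, ← pow_succ])
        rw [← h4] at h5
        have h6 : ∑ j ∈ range p, f (b + j * d) = ∑ j ∈ range r, f (b + (j + 1 : ℕ) * d) + f b := by
          rw [hr, sum_range_succ']; simp
        rw [h6] at h5
        refine (AddSubgroup.add_mem_cancel_left _ (sum_mem fun j hj => ?_)).1 h5
        rw [mem_range] at hj
        have h7 := hper' (b + (j + 1 : ℕ) * d) (-1)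
        rw [← h7]
        have h8 : (j + 1) * d ≤ p * d - d := by
          calc (j + 1) * d ≤ r * d := Nat.mul_le_mul_right _ hj
            _ = p * d - d := by rw [hr, Nat.succ_mul, Nat.add_sub_cancel]
        have h9 : d ≤ (j + 1) * d := Nat.le_mul_of_pos_left _ (Nat.succ_pos _)
        have h10 : (((j + 1 : ℕ) : ℤ) * d) = (((j + 1) * d : ℕ) : ℤ) := by push_cast; ring
        rw [h10]
        generalize (j + 1) * d = u at *
        generalize p * d = v at *
        exact hsmall _ (by omega) (by omega)
    obtain ⟨b', n, h1, h2, hbb⟩ : ∃ b' n : ℤ, 0 ≤ b' ∧ b' < (p * d : ℕ) ∧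
        b = b' + n * (p * d : ℕ) := by
      refine ⟨b % (p * d : ℕ), b / (p * d : ℕ), Int.emod_nonneg _ (by positivity),
        Int.emod_lt_of_pos _ (by exact_mod_cast hq), ?_⟩
      rw [mul_comm (b / _), Int.emod_add_mul_ediv]
    have hb' : ((p * d : ℕ) : ℤ) ∣ p ^ (k + 1) * b' := by
      rw [hbb, mul_add] at hb
      exact (Int.dvd_add_left (Dvd.intro_left (p ^ (k + 1) * n) (by ring))).1 hb
    rw [hbb, hper']
    by_cases h3 : 2 * b' ≤ (p * d : ℕ)
    · exact key b' h1 h3 hb'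
    · have h4 : b' = -((p * d : ℕ) - b') + 1 * (p * d : ℕ) := by ring
      rw [h4, hper', hodd]
      refine neg_mem (key _ (by omega) (by omega) ?_)
      rw [mul_sub]
      exact dvd_sub (dvd_mul_left _ _) hb'

end Singles

end

end OddDistribution

/-! ### Integers representing pairs of a support and a unit; the set `M_m` -/

namespace OddDistribution

open Finset

noncomputable section

section Represents

variable {ι : Type*} [Fintype ι] [LinearOrder ι] {q : ι → ℕ} [∀ i, NeZero (q i)]
  {m : ℕ}

/-- The residue of `a` is the multiple of the base point of support `L` by the unit `c`. -/
structure Represents (L : Finset ι) (c : ∀ i, (ZMod (q i))ˣ) (a : ℕ) : Prop where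
  eq_one : ∀ i ∉ L, c i = 1
  cast_eq : ∀ i, (a : ZMod (q i)) = c i * basePoint q L i

theorem dvd_of_forall_dvd {a : ℕ} {s : Finset ι} (hcop : ∀ i j, i ≠ j → Nat.Coprime (q i) (q j))
    (h : ∀ i ∈ s, q i ∣ a) : ∏ i ∈ s, q i ∣ a :=
  prod_dvd_of_isRelPrime (fun i _ j _ hij => Nat.coprime_iff_isRelPrime.1 (hcop i j hij)) h

variable (hcop : ∀ i j, i ≠ j → Nat.Coprime (q i) (q j)) [∀ i, Fact (1 < q i)]
  (hprod : m = ∏ i, q i) {L : Finset ι} {c : ∀ i, (ZMod (q i))ˣ} {a : ℕ}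

namespace Represents

include hcop in
theorem dvd_iff (h : Represents L c a) (i : ι) : q i ∣ a ↔ i ∉ L := by
  rw [← ZMod.natCast_eq_zero_iff, h.cast_eq, unit_mul_basePoint_eq_zero_iff hcop]

include hcop in
theorem coprime (h : Represents L c a) {i : ι} (hi : i ∈ L) : Nat.Coprime a (q i) := by
  rw [← ZMod.isUnit_iff_coprime, h.cast_eq]
  exact (c i).isUnit.mul (isUnit_basePoint hcop hi)

include hcop hprod in
theorem gcd_eq (h : Represents L c a) : Nat.gcd a m = ∏ i ∈ Lᶜ, q i := by
  apply Nat.dvd_antisymm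
  · have h1 : Nat.gcd a m ∣ (∏ i ∈ Lᶜ, q i) * ∏ i ∈ L, q i := by
      rw [mul_comm, prod_mul_prod_compl, ← hprod]; exact Nat.gcd_dvd_right _ _
    refine Nat.Coprime.dvd_of_dvd_mul_right ?_ h1
    exact Nat.Coprime.prod_right fun i hi => (h.coprime hcop hi).coprime_dvd_left
      (Nat.gcd_dvd_left _ _)
  · refine Nat.dvd_gcd (dvd_of_forall_dvd hcop fun i hi => ?_) ?_
    · exact (h.dvd_iff hcop i).2 (mem_compl.1 hi)
    · rw [hprod]; exact prod_dvd_prod_of_subset _ _ _ (subset_univ _)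

include hcop hprod in
theorem cast_gcd (h : Represents L c a) (i : ι) :
    ((Nat.gcd a m : ℕ) : ZMod (q i)) = basePoint q L i := by
  rw [h.gcd_eq hcop hprod, basePoint]

include hcop hprod in
theorem coprime_div (h : Represents L c a) : Nat.Coprime a (m / Nat.gcd a m) := by
  have h1 : m / Nat.gcd a m = ∏ i ∈ L, q i := by
    rw [h.gcd_eq hcop hprod, hprod, ← prod_mul_prod_compl L]
    exact Nat.mul_div_cancel _ (prod_pos fun i _ => NeZero.pos _)
  rw [h1]
  exact Nat.Coprime.prod_right fun i hi => h.coprime hcop hi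

include hcop hprod in
theorem modEq_neg_iff (h : Represents L c a) {i : ι} (hi : i ∈ L) :
    (a : ℤ) ≡ -(Nat.gcd a m : ℤ) [ZMOD q i] ↔ c i = -1 := by
  rw [← ZMod.intCast_eq_intCast_iff, Int.cast_neg, Int.cast_natCast, Int.cast_natCast,
    h.cast_gcd hcop hprod, h.cast_eq]
  obtain ⟨u, hu⟩ := isUnit_basePoint hcop hi
  rw [← hu, ← Units.val_mul, ← Units.val_neg, Units.val_inj, ← neg_one_mul, mul_left_inj]

include hcop hprod in
theorem modEq_iff (h : Represents L c a) (i : ι) :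
    a ≡ Nat.gcd a m [MOD q i] ↔ c i = 1 := by
  rw [← ZMod.natCast_eq_natCast_iff, h.cast_gcd hcop hprod, h.cast_eq]
  by_cases hi : i ∈ L
  · obtain ⟨u, hu⟩ := isUnit_basePoint hcop hi
    rw [← hu, ← Units.val_mul, Units.val_inj, mul_eq_right]
  · rw [basePoint_of_notMem hi, mul_zero]
    exact iff_of_true rfl (h.eq_one i hi)

-- Both sides say that `a` is congruent to its gcd with `m` modulo every `q i`; for `0 < a < m` this
-- means that `a` equals the gcd.
include hcop hprod in
theorem dvd_modulus_iff (h : Represents L c a) (h0 : 0 < a) (ham : a < m) : a ∣ m ↔ c = 1 := by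
  constructor
  · intro hd
    ext1 i
    rw [Pi.one_apply, ← h.modEq_iff hcop hprod, Nat.gcd_eq_left hd]
  · rintro rfl
    have h1 : ∀ i, q i ∣ a - Nat.gcd a m := fun i =>
      (Nat.modEq_iff_dvd' (Nat.gcd_le_left _ h0)).1 ((h.modEq_iff hcop hprod i).2 rfl).symm
    have h2 : m ∣ a - Nat.gcd a m := by
      have := dvd_of_forall_dvd (s := univ) hcop fun i _ => h1 i
      rwa [← hprod] at this
    have h3 := Nat.eq_zero_of_dvd_of_lt h2 (by omega)
    have h4 : a = Nat.gcd a m := le_antisymm (by omega) (Nat.gcd_le_left _ h0)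
    rw [h4]; exact Nat.gcd_dvd_right _ _

include hcop hprod in
theorem fract_lt_iff (h : Represents L c a) {k : ι} (hk : k ∈ L) :
    Int.fract ((a : ℚ) / (Nat.gcd a m * q k)) < 1 / 2 ↔ c k ∈ lowerHalf (q k) := by
  have hm0 : 0 < m := by rw [hprod]; exact prod_pos fun i _ => NeZero.pos _
  have hr : 0 < Nat.gcd a m := Nat.gcd_pos_of_pos_right _ hm0
  obtain ⟨b, hb⟩ := Nat.gcd_dvd_left a m
  have hqk : (0 : ℚ) < q k := Nat.cast_pos.2 (NeZero.pos _)
  have h1 : (b : ZMod (q k)) = c k := by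
    have h2 := h.cast_eq k
    rw [hb, Nat.cast_mul, h.cast_gcd hcop hprod, mul_comm] at h2
    exact (isUnit_basePoint hcop hk).mul_right_cancel h2
  have h2 : (a : ℚ) / (Nat.gcd a m * q k) = (b : ℚ) / q k := by
    have hr' : (Nat.gcd a m : ℚ) ≠ 0 := Nat.cast_ne_zero.2 hr.ne'
    have : (a : ℚ) = Nat.gcd a m * b := by exact_mod_cast hb
    rw [div_eq_div_iff (mul_ne_zero hr' hqk.ne') hqk.ne', this]; ring
  rw [h2, Int.fract_div_natCast_eq_div_natCast_mod, lowerHalf, mem_filter, ← h1, ZMod.val_natCast,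
    div_lt_div_iff₀ hqk two_pos, one_mul, and_iff_right (mem_univ _), mul_comm]
  exact_mod_cast Iff.rfl

include hcop hprod in
theorem eq_of_eq {a' : ℕ} (h : Represents L c a) (h' : Represents L c a') (ham : a < m)
    (ham' : a' < m) : a = a' := by
  have h1 : a ≡ a' [MOD m] := by
    rw [hprod]
    refine (Nat.modEq_iff_dvd.2 ?_)
    have : ∀ i, (q i : ℤ) ∣ (a' : ℤ) - a := fun i => by
      rw [← Nat.modEq_iff_dvd, ← ZMod.natCast_eq_natCast_iff, h.cast_eq, h'.cast_eq]
    rw [Nat.cast_prod]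
    exact Finset.prod_dvd_of_coprime
      (fun i _ j _ hij => Nat.isCoprime_iff_coprime.2 (hcop i j hij)) fun i _ => this i
  exact Nat.ModEq.eq_of_lt_of_lt h1 ham ham'

-- The coprimality condition makes `a` prime to every `q i` that does not divide it: a prime
-- dividing `a` cannot divide `m / (a, m)`, so the full power `q i` would divide `(a, m)`.
include hcop hprod in
theorem exists_of_coprime_div (hpp : ∀ i, IsPrimePow (q i))
    (h : Nat.Coprime a (m / Nat.gcd a m)) :
    ∃ (L : Finset ι) (c : ∀ i, (ZMod (q i))ˣ), Represents L c a := by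
  have hm0 : 0 < m := by rw [hprod]; exact prod_pos fun i _ => NeZero.pos _
  have h1 : ∀ i, ¬ q i ∣ a → Nat.Coprime a (q i) := by
    intro i hi
    obtain ⟨p, e, hp, he, hpe⟩ := (isPrimePow_nat_iff (q i)).1 (hpp i)
    rw [← hpe]
    refine Nat.Coprime.pow_right _ ((Nat.coprime_comm.1 ((hp.coprime_iff_not_dvd).2 ?_)))
    intro hpa
    have hpm : ¬ p ∣ m / Nat.gcd a m := fun hd =>
      hp.one_lt.ne' (Nat.eq_one_of_dvd_coprimes h hpa hd)
    have h2 : q i ∣ Nat.gcd a m * (m / Nat.gcd a m) := by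
      rw [Nat.mul_div_cancel' (Nat.gcd_dvd_right _ _), hprod]
      exact dvd_prod_of_mem q (mem_univ i)
    refine hi ((Nat.Coprime.dvd_of_dvd_mul_right ?_ h2).trans (Nat.gcd_dvd_left _ _))
    rw [← hpe]
    exact Nat.Coprime.pow_left _ ((hp.coprime_iff_not_dvd).2 hpm)
  have h2 : ∀ i, ∃ u : (ZMod (q i))ˣ, (i ∉ univ.filter (fun i => ¬ q i ∣ a) → u = 1) ∧
      (a : ZMod (q i)) = u * basePoint q (univ.filter fun i => ¬ q i ∣ a) i := by
    intro i
    by_cases hi : q i ∣ a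
    · refine ⟨1, fun _ => rfl, ?_⟩
      rw [basePoint_of_notMem (by simpa using hi), mul_zero, ZMod.natCast_eq_zero_iff]
      exact hi
    · have h0 : i ∈ univ.filter fun i => ¬ q i ∣ a := by simpa using hi
      obtain ⟨v, hv⟩ := isUnit_basePoint hcop h0
      refine ⟨ZMod.unitOfCoprime a (h1 i hi) * v⁻¹, fun h => absurd h0 h, ?_⟩
      rw [← hv, ← Units.val_mul, inv_mul_cancel_right, ZMod.coe_unitOfCoprime]
  choose u hu1 hu2 using h2
  exact ⟨_, u, hu1, hu2⟩

end Represents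

end Represents

section IndexSets

variable {t : ℕ} {q : Fin t → ℕ} [∀ i, NeZero (q i)] [∀ i, Fact (1 < q i)] {m : ℕ}
  (hcop : ∀ i j, i ≠ j → Nat.Coprime (q i) (q j)) (hprod : m = ∏ i, q i)

open Stickelberger

-- The conditions defining `M_m` are those of a basis index: excluding `-1`, the half condition at
-- the last nontrivial component, and the parity for `c = 1`.
include hcop hprod in
theorem mem_setM_iff {L : Finset (Fin t)} {c : ∀ i, (ZMod (q i))ˣ} {a : ℕ} (h : Represents L c a)
    (h0 : 0 < a) (ham : a < m) :
    a ∈ setM m q ↔ IsBasisIndex (fun _ => -1) (fun i => lowerHalf (q i)) L c := by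
  have hX : a ∈ setX m := ⟨h0, ham, h.coprime_div hcop hprod⟩
  have hgr (k : Fin t) : IsGreatest {i : Fin t | ¬ a ≡ Nat.gcd a m [MOD q i]} k ↔
      c k ≠ 1 ∧ ∀ l > k, c l = 1 := by
    simp only [IsGreatest, mem_upperBounds, Set.mem_ofPred_eq, h.modEq_iff hcop hprod]
    refine and_congr_right fun _ => ⟨fun hk l hl => ?_, fun hk l hl => ?_⟩
    · by_contra hc; exact absurd (hk l hc) (not_le.2 hl)
    · by_contra hc; exact hl (hk l (not_le.1 hc))
  have hL : (univ.filter fun i => ¬ q i ∣ a) = L := by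
    ext i; simp [h.dvd_iff hcop]
  have hmem {k : Fin t} (hk : c k ≠ 1) : k ∈ L := by
    by_contra hc; exact hk (h.eq_one k hc)
  constructor
  · rintro ⟨-, h1, h2, h3⟩
    refine ⟨h.eq_one, fun i hi => ?_, fun k hk hl => ?_, fun hc => ?_⟩
    · rw [Ne, ← h.modEq_neg_iff hcop hprod hi]
      exact h1 i (by rw [h.dvd_iff hcop]; simpa using hi)
    · have ham' : ¬ a ∣ m := by
        rw [h.dvd_modulus_iff hcop hprod h0 ham]; rintro rfl; exact hk rfl
      exact (h.fract_lt_iff hcop hprod (hmem hk)).1 (h2 ham' k ((hgr k).2 ⟨hk, hl⟩))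
    · rw [← hL]
      convert h3 ((h.dvd_modulus_iff hcop hprod h0 ham).2 hc)
  · intro hb
    refine ⟨hX, fun i hi => ?_, fun _ k hk => ?_, fun hd => ?_⟩
    · have hi' : i ∈ L := by rw [h.dvd_iff hcop] at hi; simpa using hi
      rw [h.modEq_neg_iff hcop hprod hi']
      exact hb.ne_neg i hi'
    · obtain ⟨hk1, hk2⟩ := (hgr k).1 hk
      exact (h.fract_lt_iff hcop hprod (hmem hk1)).2 (hb.mem_half k hk1 hk2)
    · have := hb.odd_card ((h.dvd_modulus_iff hcop hprod h0 ham).1 hd)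
      rw [← hL] at this
      convert this

theorem lt_of_mem_setM {a : ℕ} (h : a ∈ setM m q) : 0 < a ∧ a < m := ⟨h.1.1, h.1.2.1⟩

variable (hpp : ∀ i, IsPrimePow (q i)) (hq2 : ∀ i, 2 < q i)

/-- The element of the group ring attached to an integer. -/
def sawElt (hcop : ∀ i j, i ≠ j → Nat.Coprime (q i) (q j)) (a : ℤ) :
    GrpRing fun i => (ZMod (q i))ˣ :=
  groupElt (sawMod hcop) (a : ∀ i, ZMod (q i))

include hprod hpp hq2 in
theorem sawElt_mem_closure_setM (b : ℕ) :
    sawElt hcop b ∈ AddSubgroup.closure {w | ∃ a ∈ setM m q, (∀ i, q i ∣ b → q i ∣ a) ∧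
      w = sawElt hcop (a : ℕ)} := by
  refine AddSubgroup.closure_mono ?_ (groupElt_sawMod_mem_closure hcop hpp hq2 _)
  rintro _ ⟨L, c, hL, hc, rfl⟩
  have hm : NeZero (∏ i, q i) := ⟨prod_ne_zero_iff.2 fun i _ => NeZero.ne (q i)⟩
  obtain ⟨a, ha⟩ : ∃ a : ℕ, a = ((crt hcop).symm
    ((fun i => (c i : ZMod (q i))) * basePoint q L)).val := ⟨_, rfl⟩
  have ham : a < m := by rw [ha, hprod]; exact ZMod.val_lt _
  have hcast : (a : ∀ i, ZMod (q i)) = (fun i => (c i : ZMod (q i))) * basePoint q L := by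
    apply (crt hcop).symm.injective
    rw [map_natCast, ha, ZMod.natCast_zmod_val]
  have hrep : Represents L c a := ⟨hc.eq_one, fun i => by
    have := congrFun hcast i
    rwa [Pi.natCast_apply, Pi.mul_apply] at this⟩
  -- An empty support forces `c = 1`, contrary to the parity condition; so the representative is not
  -- `0`.
  have hLne : L.Nonempty := by
    rw [nonempty_iff_ne_empty]
    rintro rfl
    have : c = 1 := by ext1 i; exact hc.eq_one i (by simp)
    simpa using hc.odd_card this
  have h0 : 0 < a := by
    obtain ⟨i, hi⟩ := hLne
    refine Nat.pos_of_ne_zero ?_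
    rintro rfl
    exact (hrep.dvd_iff hcop i).1 (dvd_zero _) hi
  refine ⟨a, (mem_setM_iff hcop hprod hrep h0 ham).2 hc, fun i hi => ?_, ?_⟩
  · rw [hrep.dvd_iff hcop]
    intro hiL
    apply hL i hiL
    rw [Int.cast_natCast, Pi.natCast_apply, ZMod.natCast_eq_zero_iff]
    exact hi
  · rw [sawElt, Int.cast_natCast, hcast]

end IndexSets

end

end OddDistribution

/-! ### From `M_m` to `M'_m`: generation and cardinality -/

namespace OddDistribution

open Finset

noncomputable section

theorem sum_ker_mul_eq {E : Type*} [AddCommMonoid E] {n Q : ℕ} [NeZero Q] (hn : n ∣ Q)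
    (g : ZMod Q → E) :
    ∑ z : ZMod Q with (n : ZMod Q) * z = 0, g z = ∑ j ∈ range n, g ((j * (Q / n) : ℕ)) := by
  have hQ : 0 < Q := NeZero.pos Q
  have hn0 : 0 < n := Nat.pos_of_dvd_of_pos hn hQ
  have hQn : n * (Q / n) = Q := Nat.mul_div_cancel' hn
  have hd0 : 0 < Q / n := Nat.div_pos (Nat.le_of_dvd hQ hn) hn0
  symm
  refine sum_bij (fun j _ => ((j * (Q / n) : ℕ) : ZMod Q)) ?_ ?_ ?_ fun _ _ => rfl
  · intro j _
    rw [mem_filter]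
    refine ⟨mem_univ _, ?_⟩
    rw [← Nat.cast_mul, ZMod.natCast_eq_zero_iff, mul_left_comm, hQn]
    exact dvd_mul_left _ _
  · intro j hj k hk h
    have hlt : ∀ k ∈ range n, k * (Q / n) < Q := by
      intro k hk
      calc k * (Q / n) < n * (Q / n) := Nat.mul_lt_mul_of_pos_right (mem_range.1 hk) hd0
        _ = Q := hQn
    rw [ZMod.natCast_eq_natCast_iff] at h
    exact Nat.eq_of_mul_eq_mul_right hd0 (Nat.ModEq.eq_of_lt_of_lt h (hlt j hj) (hlt k hk))
  · intro z hz
    have hz' := (mem_filter.1 hz).2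
    rw [← ZMod.natCast_zmod_val z, ← Nat.cast_mul, ZMod.natCast_eq_zero_iff] at hz'
    nth_rw 1 [← hQn] at hz'
    obtain ⟨k, hk⟩ := Nat.dvd_of_mul_dvd_mul_left hn0 hz'
    refine ⟨k, mem_range.2 ?_, ?_⟩
    · by_contra h
      have h1 : (Q / n) * n ≤ (Q / n) * k := Nat.mul_le_mul_left _ (not_lt.1 h)
      rw [mul_comm, hQn, ← hk] at h1
      exact absurd (ZMod.val_lt z) (not_lt.2 h1)
    · rw [mul_comm, ← hk, ZMod.natCast_zmod_val]

variable {t : ℕ} {q : Fin t → ℕ} [∀ i, NeZero (q i)] [∀ i, Fact (1 < q i)] {m : ℕ}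
  (hcop : ∀ i j, i ≠ j → Nat.Coprime (q i) (q j)) (hprod : m = ∏ i, q i)
  (hpp : ∀ i, IsPrimePow (q i)) (hq2 : ∀ i, 2 < q i)

open Stickelberger

theorem sawElt_zero : sawElt hcop 0 = 0 := by
  have h : sawMod hcop 0 = 0 := by
    have := sawMod_intCast hcop 0
    rwa [Int.cast_zero, Int.cast_zero, zero_div, neg_zero, saw_zero] at this
  simp [sawElt, groupElt, h]

theorem sawElt_neg (a : ℤ) : sawElt hcop (-a) = -sawElt hcop a := by
  rw [sawElt, sawElt, Int.cast_neg, groupElt_neg (sawMod_neg hcop)]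

include hcop hprod in
theorem coprime_div_self (i : Fin t) : Nat.Coprime (m / q i) (q i) := by
  have h1 : m / q i = ∏ l ∈ univ.erase i, q l := by
    rw [hprod, ← mul_prod_erase univ q (mem_univ i)]
    exact Nat.mul_div_cancel_left _ (NeZero.pos _)
  rw [h1]
  exact Nat.Coprime.prod_left fun l hl => hcop l i (ne_of_mem_erase hl)

include hcop hprod in
theorem dvd_div_of_ne {i l : Fin t} (h : l ≠ i) : q l ∣ m / q i := by
  have hm (i) : q i ∣ m := by rw [hprod]; exact dvd_prod_of_mem q (mem_univ i)
  rw [Nat.dvd_div_iff_mul_dvd (hm i), mul_comm]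
  exact (hcop l i h).mul_dvd_of_dvd_of_dvd (hm l) (hm i)

-- The points `(m / q i) * y` are supported at `i`, where `m / q i` is a unit. This unit rescales
-- the torsion, and what results is a distribution of level `q i`.
include hprod in
theorem sum_sawElt_div_mul (i : Fin t) {n : ℕ} (hn : n ∣ q i) (y : ℤ) :
    ∑ j ∈ range n, sawElt hcop ((m / q i : ℕ) * (y + j * (q i / n : ℕ))) =
      sawElt hcop ((m / q i : ℕ) * (n * y)) := by
  have h0 := sum_groupElt_add_single (f := sawMod hcop) (i := i) (n := n)
    (sum_sawMod hcop i n hn) (((m / q i : ℕ) * y : ℤ) : ∀ i, ZMod (q i))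
  have h1 : sawElt hcop ((m / q i : ℕ) * (n * y)) =
      groupElt (sawMod hcop) (n * (((m / q i : ℕ) * y : ℤ) : ∀ i, ZMod (q i))) := by
    rw [sawElt, mul_left_comm, Int.cast_mul, Int.cast_natCast]
  rw [h1, ← h0]
  let u := ZMod.unitOfCoprime _ (coprime_div_self hcop hprod i)
  have h2 : ∑ z : ZMod (q i) with (n : ZMod (q i)) * z = 0,
      groupElt (sawMod hcop) ((((m / q i : ℕ) * y : ℤ) : ∀ i, ZMod (q i)) + Pi.single i z) =
      ∑ z : ZMod (q i) with (n : ZMod (q i)) * z = 0,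
      groupElt (sawMod hcop) ((((m / q i : ℕ) * y : ℤ) : ∀ i, ZMod (q i)) +
        Pi.single i ((u : ZMod (q i)) * z)) := by
    symm
    refine sum_nbij' (fun z => (u : ZMod (q i)) * z) (fun z => ((u⁻¹ : (ZMod (q i))ˣ) : ZMod (q i)) * z)
      ?_ ?_ ?_ ?_ fun _ _ => rfl
    · intro z hz
      rw [mem_filter] at hz ⊢
      exact ⟨mem_univ _, by rw [mul_left_comm, hz.2, mul_zero]⟩
    · intro z hz
      rw [mem_filter] at hz ⊢
      exact ⟨mem_univ _, by rw [mul_left_comm, hz.2, mul_zero]⟩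
    · intro z _; simp
    · intro z _; simp
  rw [h2, sum_ker_mul_eq hn]
  refine sum_congr rfl fun j _ => ?_
  rw [sawElt]
  congr 1
  ext l
  rw [Pi.add_apply, Pi.intCast_apply, Pi.intCast_apply, mul_add, Int.cast_add]
  congr 1
  have h3 : ((m / q i : ℕ) * (j * (q i / n : ℕ)) : ℤ) = ((m / q i * (j * (q i / n)) : ℕ) : ℤ) := by
    rw [Nat.cast_mul, Nat.cast_mul]
  rw [h3, Int.cast_natCast, Nat.cast_mul]
  by_cases hl : l = i
  · subst hl
    rw [Pi.single_eq_same, ZMod.coe_unitOfCoprime]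
  · rw [Pi.single_eq_of_ne hl, (ZMod.natCast_eq_zero_iff _ _).2 (dvd_div_of_ne hcop hprod hl),
      zero_mul]

include hprod hpp in
theorem sawElt_div_mul_mem_closure (i : Fin t) (y : ℤ) :
    sawElt hcop ((m / q i : ℕ) * y) ∈ AddSubgroup.closure
      {x | ∃ c : ℕ, 1 ≤ c ∧ 2 * c ≤ Nat.totient (q i) ∧
        x = sawElt hcop ((m / q i : ℕ) * (c : ℤ))} := by
  obtain ⟨p, e, hp, he, hpe⟩ := (isPrimePow_nat_iff (q i)).1 (hpp i)
  have hpq : p ∣ q i := hpe ▸ dvd_pow_self p he.ne'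
  have htot : Nat.totient (q i) = q i - q i / p := by
    rw [← hpe, Nat.totient_prime_pow hp he]
    obtain ⟨k, rfl⟩ : ∃ k, e = k + 1 := ⟨e - 1, by omega⟩
    rw [Nat.add_sub_cancel, pow_succ, Nat.mul_div_cancel _ hp.pos, Nat.mul_sub, mul_one]
  rw [htot]
  have hmi : q i ∣ m := by rw [hprod]; exact dvd_prod_of_mem q (mem_univ i)
  refine mem_closure_of_odd_distribution (E := GrpRing fun i => (ZMod (q i))ˣ) hp hpq
    (NeZero.pos _) (f := fun y => sawElt hcop ((m / q i : ℕ) * y)) ?_ ?_ ?_ ?_ e y ?_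
  · simp only [mul_zero]; exact sawElt_zero hcop
  · intro y; simp only [mul_neg]; exact sawElt_neg hcop _
  · intro y
    simp only [sawElt]
    congr 1
    have h1 : ((m / q i : ℕ) * (q i : ℤ)) = (m : ℕ) := by
      rw [← Nat.cast_mul, Nat.div_mul_cancel hmi]
    rw [mul_add, h1, Int.cast_add, Int.cast_natCast]
    have h2 : ((m : ℕ) : ∀ i, ZMod (q i)) = 0 := by
      ext l
      rw [Pi.natCast_apply, Pi.zero_apply, ZMod.natCast_eq_zero_iff, hprod]
      exact dvd_prod_of_mem q (mem_univ l)
    rw [h2, add_zero]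
  · intro y; exact sum_sawElt_div_mul hcop hprod i hpq y
  · rw [← hpe, Nat.cast_pow]; exact dvd_mul_right _ _

include hcop hprod in
theorem not_dvd_of_div_dvd {a : ℕ} {i : Fin t} (h0 : 0 < a) (ham : a < m) (h : m / q i ∣ a) :
    ¬ q i ∣ a := by
  intro hi
  have hmi : q i ∣ m := by rw [hprod]; exact dvd_prod_of_mem q (mem_univ i)
  have := (coprime_div_self hcop hprod i).mul_dvd_of_dvd_of_dvd h hi
  rw [Nat.div_mul_cancel hmi] at this
  exact absurd (Nat.le_of_dvd h0 this) (not_le.2 ham)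

include hprod in
theorem pos_lt_of_mem_setM' {a : ℕ} (h : a ∈ setM' m q) : 0 < a ∧ a < m := by
  rcases h with h | h
  · exact lt_of_mem_setM h.1
  · obtain ⟨i, c, h1, h2, rfl⟩ := Set.mem_iUnion.1 h
    have hmi : q i ∣ m := by rw [hprod]; exact dvd_prod_of_mem q (mem_univ i)
    have hm0 : 0 < m := by rw [hprod]; exact prod_pos fun i _ => NeZero.pos _
    have hd : 0 < m / q i := Nat.div_pos (Nat.le_of_dvd hm0 hmi) (NeZero.pos _)
    have h3 := Nat.totient_le (q i)
    have h4 : 0 < q i := NeZero.pos _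
    refine ⟨Nat.mul_pos hd h1, ?_⟩
    calc m / q i * c < m / q i * q i := Nat.mul_lt_mul_of_pos_left (by omega) hd
      _ = m := Nat.div_mul_cancel hmi

-- Only elements of `M_m` divisible by some `m / q i` need replacing, and these belong to a
-- distribution of prime power level.
include hprod hpp hq2 in
theorem sawElt_mem_closure_setM' (b : ℕ) :
    sawElt hcop b ∈ AddSubgroup.closure {w | ∃ a ∈ setM' m q, (∀ i, q i ∣ b → q i ∣ a) ∧
      w = sawElt hcop (a : ℕ)} := by
  refine (AddSubgroup.closure_le _).2 ?_ (sawElt_mem_closure_setM hcop hprod hpp hq2 b)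
  rintro _ ⟨a, ha, hab, rfl⟩
  by_cases h : ∀ i, ¬ m / q i ∣ a
  · exact AddSubgroup.subset_closure ⟨a, Or.inl ⟨ha, h⟩, hab, rfl⟩
  · push Not at h
    obtain ⟨i, hi⟩ := h
    obtain ⟨h0, ham⟩ := lt_of_mem_setM ha
    have hqa := not_dvd_of_div_dvd hcop hprod h0 ham hi
    obtain ⟨y, rfl⟩ := hi
    have h1 := sawElt_div_mul_mem_closure hcop hprod hpp i y
    rw [Nat.cast_mul]
    refine AddSubgroup.closure_mono ?_ h1
    rintro _ ⟨c, hc1, hc2, rfl⟩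
    refine ⟨m / q i * c, Or.inr (Set.mem_iUnion.2 ⟨i, c, hc1, by omega, rfl⟩), fun l hl => ?_, ?_⟩
    -- The replacement does not lose divisibility: `q i` does not divide the old element, and every
    -- other `q l` divides `m / q i`.
    · have hli : l ≠ i := by rintro rfl; exact hqa (hab l hl)
      exact (dvd_div_of_ne hcop hprod hli).mul_right _
    · rw [Nat.cast_mul]

theorem rPart_dvd (hcop : ∀ i j, i ≠ j → Nat.Coprime (q i) (q j)) {a b : ℕ}
    (h : ∀ i, q i ∣ b → q i ∣ a) : rPart q b ∣ a := by
  rw [rPart]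
  exact dvd_of_forall_dvd hcop fun i hi => h i (mem_filter.1 hi).2

include hcop hprod hpp in
open scoped Classical in
theorem ncard_setM_le : ({a | a ∈ setM m q ∧ ∀ i, ¬ m / q i ∣ a} : Set ℕ).ncard ≤
    #(univ.filter fun g : ∀ i, (ZMod (q i))ˣ =>
      g ∈ basisCodes (fun _ => -1) (fun i => lowerHalf (q i)) ∧
      2 ≤ #(univ.filter fun i => g i ≠ -1)) := by
  have hrep : ∀ a : ℕ, ∃ (L : Finset (Fin t)) (c : ∀ i, (ZMod (q i))ˣ),
      a ∈ setM m q → Represents L c a := by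
    intro a
    by_cases ha : a ∈ setM m q
    · obtain ⟨L, c, h⟩ := Represents.exists_of_coprime_div hcop hprod hpp ha.1.2.2
      exact ⟨L, c, fun _ => h⟩
    · exact ⟨∅, 1, fun h => absurd h ha⟩
  choose L c hLc using hrep
  have hb (a : ℕ) (ha : a ∈ setM m q) :=
    (mem_setM_iff hcop hprod (hLc a ha) ha.1.1 ha.1.2.1).1 ha
  let g : ℕ → ∀ i, (ZMod (q i))ˣ := fun a i => if i ∈ L a then c a i else -1
  have hgL (a : ℕ) (ha : a ∈ setM m q) : (univ.filter fun i => g a i ≠ -1) = L a := by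
    ext i
    by_cases hi : i ∈ L a
    · simp [g, hi, (hb a ha).ne_neg i hi]
    · simp [g, hi]
  have hgc (a : ℕ) (ha : a ∈ setM m q) : (fun i => if g a i = -1 then 1 else g a i) = c a := by
    ext1 i
    by_cases hi : i ∈ L a
    · simp [g, hi, (hb a ha).ne_neg i hi]
    · simp [g, hi, (hb a ha).eq_one i hi]
  rw [← Set.ncard_coe_finset]
  refine Set.ncard_le_ncard_of_injOn g ?_ ?_ (Finset.finite_toSet _)
  · rintro a ⟨ha, ha'⟩
    rw [mem_coe, mem_filter]
    refine ⟨mem_univ _, ?_, ?_⟩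
    · change IsBasisIndex _ _ _ _
      have := hb a ha
      convert this using 1
      · convert hgL a ha
      · convert hgc a ha
    · rw [hgL a ha]
      by_contra! h
      have hr := (hLc a ha)
      have h1 : #(L a) ≠ 0 := by
        intro h0
        rw [card_eq_zero] at h0
        have h2 : ∀ i ∈ univ, q i ∣ a := fun i _ => (hr.dvd_iff hcop i).2 (by simp [h0])
        have h3 := dvd_of_forall_dvd hcop h2
        rw [← hprod] at h3
        exact absurd (Nat.le_of_dvd ha.1.1 h3) (not_le.2 ha.1.2.1)
      obtain ⟨i, hi⟩ := card_eq_one.1 (by omega : #(L a) = 1)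
      apply ha' i
      have h1 : m / q i = ∏ l ∈ univ.erase i, q l := by
        rw [hprod, ← mul_prod_erase univ q (mem_univ i)]
        exact Nat.mul_div_cancel_left _ (NeZero.pos _)
      rw [h1]
      refine dvd_of_forall_dvd hcop fun l hl => (hr.dvd_iff hcop l).2 ?_
      rw [hi]; simpa using hl
  · rintro a ⟨ha, -⟩ a' ⟨ha', -⟩ h
    have h1 := hgL a ha
    have h2 := hgc a ha
    rw [h] at h1 h2
    have h3 : L a = L a' := by rw [← h1, hgL a' ha']
    have h4 : c a = c a' := by rw [← h2, hgc a' ha']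
    have hr := hLc a ha
    rw [h3, h4] at hr
    exact hr.eq_of_eq hcop hprod (hLc a' ha') ha.1.2.1 ha'.1.2.1

theorem finite_setM' (hprod : m = ∏ i, q i) : (setM' m q).Finite :=
  (Set.finite_lt_nat m).subset fun _ h => (pos_lt_of_mem_setM' hprod h).2

-- The two parts of `M'_m` inject into, or are covered by, the two families counted in
-- `two_mul_card_add_le`, with `#(lowerHalf (q i)) = φ(q i) / 2`.
include hcop hprod hpp hq2 in
theorem two_mul_ncard_setM'_le (hm : 1 < m) : 2 * (setM' m q).ncard ≤ Nat.totient m := by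
  classical
  have hne : Nonempty (Fin t) := by
    by_contra h
    rw [not_nonempty_iff] at h
    rw [Fintype.prod_empty] at hprod
    omega
  have h1 := two_mul_card_add_le (J := fun i => (-1 : (ZMod (q i))ˣ))
    (H := fun i => lowerHalf (q i)) (by ext i; simp)
    (fun i c => mem_lowerHalf_iff_neg_notMem (hq2 i) c) (fun i => one_mem_lowerHalf (hq2 i))
  have h2 : Fintype.card (∀ i, (ZMod (q i))ˣ) = Nat.totient m := by
    have hm0 : NeZero (∏ i, q i) := ⟨prod_ne_zero_iff.2 fun i _ => NeZero.ne (q i)⟩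
    rw [hprod, ← ZMod.card_units_eq_totient]
    exact Fintype.card_congr
      ((Units.mapEquiv (crt hcop).toMulEquiv).trans MulEquiv.piUnits).toEquiv.symm
  have h3 : (⋃ i, {a | ∃ b : ℕ, 1 ≤ b ∧ b ≤ Nat.totient (q i) / 2 ∧ a = m / q i * b} : Set ℕ) ⊆
      (univ.biUnion fun i => (Icc 1 (Nat.totient (q i) / 2)).image fun b => m / q i * b :
        Finset ℕ) := by
    intro a ha
    obtain ⟨i, b, hb1, hb2, rfl⟩ := Set.mem_iUnion.1 ha
    rw [mem_coe, mem_biUnion]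
    exact ⟨i, mem_univ _, mem_image.2 ⟨b, mem_Icc.2 ⟨hb1, hb2⟩, rfl⟩⟩
  have h4 : (⋃ i, {a | ∃ b : ℕ, 1 ≤ b ∧ b ≤ Nat.totient (q i) / 2 ∧ a = m / q i * b} :
      Set ℕ).ncard ≤ ∑ i, #(lowerHalf (q i)) := by
    refine (Set.ncard_le_ncard h3 (Finset.finite_toSet _)).trans ?_
    rw [Set.ncard_coe_finset]
    refine card_biUnion_le.trans (sum_le_sum fun i _ => card_image_le.trans ?_)
    have := two_mul_card_lowerHalf (hq2 i)
    rw [Nat.card_Icc]; omega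
  have h5 := ncard_setM_le hcop hprod hpp
  have h6 : (setM' m q).ncard ≤ _ := Set.ncard_union_le _ _
  rw [h2] at h1
  refine le_trans (Nat.mul_le_mul_left 2 (h6.trans (Nat.add_le_add h5 h4))) ?_
  convert h1

end

end OddDistribution

/-! ### The periodic zeta function at `1` -/

namespace OddDistribution

open Filter Topology Finset

/-- Summation by parts for a Dirichlet series with bounded partial sums of coefficients. -/
theorem tendsto_sum_mul_of_bounded {z : ℕ → ℂ} {b : ℝ} (hz : ∀ n, ‖∑ i ∈ range n, z i‖ ≤ b)
    {w : ℕ → ℝ} (hw : Tendsto w atTop (𝓝 0)) {B : ℕ → ℝ} (hB : Summable B)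
    (hwB : ∀ n, |w n - w (n + 1)| ≤ B n) :
    Tendsto (fun n => ∑ i ∈ range n, (w i : ℂ) * z i) atTop
      (𝓝 (∑' n, ((w n - w (n + 1) : ℝ) : ℂ) * ∑ i ∈ range (n + 1), z i)) := by
  have hb : 0 ≤ b := (norm_nonneg _).trans (hz 0)
  have hs : Summable fun n => ((w n - w (n + 1) : ℝ) : ℂ) * ∑ i ∈ range (n + 1), z i := by
    refine Summable.of_norm_bounded (hB.mul_right b) fun n => ?_
    rw [norm_mul, Complex.norm_real]
    exact mul_le_mul (hwB n) (hz _) (norm_nonneg _) ((abs_nonneg _).trans (hwB n))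
  have h1 (n : ℕ) : ∑ i ∈ range n, (w i : ℂ) * z i = (w n : ℂ) * ∑ i ∈ range n, z i +
      ∑ k ∈ range n, ((w k - w (k + 1) : ℝ) : ℂ) * ∑ i ∈ range (k + 1), z i := by
    induction n with
    | zero => simp
    | succ n ih =>
      rw [sum_range_succ, ih, sum_range_succ (fun k => ((w k - w (k + 1) : ℝ) : ℂ) *
        ∑ i ∈ range (k + 1), z i) n, sum_range_succ z n]
      push_cast; ring
  simp_rw [h1]
  rw [← zero_add (∑' n, _)]
  refine Tendsto.add ?_ hs.hasSum.tendsto_sum_nat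
  refine squeeze_zero_norm (a := fun n => |w n| * b) (fun n => ?_) ?_
  · rw [norm_mul, Complex.norm_real]
    exact mul_le_mul_of_nonneg_left (hz n) (norm_nonneg _)
  · simpa using (hw.abs).mul_const b

/-- A summable bound uniform in `s`, needed for dominated convergence as `s` tends to `1`. -/
theorem abs_rpow_neg_sub_le {s x : ℝ} (hs1 : 1 ≤ s) (hs2 : s ≤ 2) (hx : 1 ≤ x) :
    |x ^ (-s) - (x + 1) ^ (-s)| ≤ 2 * (1 / x ^ 2) := by
  have hx0 : 0 < x := by linarith
  have h1 : (x + 1) ^ (-s) = x ^ (-s) * (x / (x + 1)) ^ s := by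
    rw [Real.div_rpow hx0.le (by linarith), Real.rpow_neg hx0.le, Real.rpow_neg (by linarith)]
    have := Real.rpow_pos_of_pos hx0 s
    field_simp
  have h2 : x / (x + 1) ≤ 1 := by rw [div_le_one (by linarith)]; linarith
  have h3 : (x / (x + 1)) ^ s ≤ 1 := Real.rpow_le_one (by positivity) h2 (by linarith)
  have h4 : (x / (x + 1)) ^ (2 : ℝ) ≤ (x / (x + 1)) ^ s :=
    Real.rpow_le_rpow_of_exponent_ge (by positivity) h2 hs2
  have h5 : x ^ (-s) ≤ x ^ (-1 : ℝ) := Real.rpow_le_rpow_of_exponent_le hx (by linarith)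
  rw [h1, ← mul_one_sub, abs_of_nonneg (mul_nonneg (Real.rpow_nonneg hx0.le _) (by linarith))]
  calc x ^ (-s) * (1 - (x / (x + 1)) ^ s) ≤ x ^ (-1 : ℝ) * (1 - (x / (x + 1)) ^ (2 : ℝ)) :=
        mul_le_mul h5 (by linarith) (by linarith) (Real.rpow_nonneg hx0.le _)
    _ ≤ 2 * (1 / x ^ 2) := by
      rw [Real.rpow_neg_one, Real.rpow_two]
      have h6 : 2 * (1 / x ^ 2) - x⁻¹ * (1 - (x / (x + 1)) ^ 2) =
          (3 * x + 2) / (x ^ 2 * (x + 1) ^ 2) := by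
        field_simp; ring
      have h7 : 0 ≤ (3 * x + 2) / (x ^ 2 * (x + 1) ^ 2) := by positivity
      linarith

theorem summable_two_mul_one_div : Summable fun n : ℕ => 2 * (1 / ((n : ℝ) + 1) ^ 2) := by
  refine Summable.mul_left 2 ?_
  have := (summable_nat_add_iff 1).2 (Real.summable_one_div_nat_pow.2 one_lt_two)
  simpa using this

theorem norm_geom_sum_le {z : ℂ} (hz : ‖z‖ = 1) (hz1 : z ≠ 1) (n : ℕ) :
    ‖∑ i ∈ range n, z ^ (i + 1)‖ ≤ 2 / ‖z - 1‖ := by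
  have h0 : 0 < ‖z - 1‖ := norm_pos_iff.2 (sub_ne_zero.2 hz1)
  simp_rw [pow_succ]
  rw [← sum_mul, norm_mul, hz, mul_one, geom_sum_eq hz1, norm_div]
  gcongr
  refine (norm_sub_le _ _).trans ?_
  rw [norm_pow, hz, one_pow, norm_one]; norm_num

theorem tendsto_rpow_neg_succ {s : ℝ} (hs : 1 ≤ s) :
    Tendsto (fun n : ℕ => ((n : ℝ) + 1) ^ (-s)) atTop (𝓝 0) :=
  (tendsto_rpow_neg_atTop (by linarith : 0 < s)).comp
    (tendsto_atTop_add_const_right _ 1 tendsto_natCast_atTop_atTop)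

/-- The polylogarithm of order `s` tends to the logarithm as `s` tends to `1`. -/
theorem tendsto_tsum_pow_mul_rpow {z : ℂ} (hz : ‖z‖ = 1) (hz1 : z ≠ 1) :
    Tendsto (fun s : ℝ => ∑' n : ℕ, ((((n : ℝ) + 1) ^ (-s) : ℝ) : ℂ) * z ^ (n + 1)) (𝓝[>] 1)
      (𝓝 (-Complex.log (1 - z))) := by
  -- The series summed by parts; it converges absolutely down to `s = 1`.
  set T : ℝ → ℂ := fun s => ∑' n : ℕ,
    ((((n : ℝ) + 1) ^ (-s) - (((n + 1 : ℕ) : ℝ) + 1) ^ (-s) : ℝ) : ℂ) *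
      ∑ i ∈ range (n + 1), z ^ (i + 1) with hT
  have hbound (s : ℝ) (h1 : 1 ≤ s) (h2 : s ≤ 2) (n : ℕ) :
      |((n : ℝ) + 1) ^ (-s) - (((n + 1 : ℕ) : ℝ) + 1) ^ (-s)| ≤ 2 * (1 / ((n : ℝ) + 1) ^ 2) := by
    rw [Nat.cast_add_one]
    exact abs_rpow_neg_sub_le h1 h2 (by have := Nat.cast_nonneg (α := ℝ) n; linarith)
  have hpart (s : ℝ) (h1 : 1 ≤ s) (h2 : s ≤ 2) := tendsto_sum_mul_of_bounded
    (norm_geom_sum_le hz hz1) (tendsto_rpow_neg_succ h1) summable_two_mul_one_div (hbound s h1 h2)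
  have hT1 : T 1 = -Complex.log (1 - z) := by
    have h1 := hpart 1 le_rfl one_le_two
    have h2 : Tendsto (fun n => ∑ i ∈ range n, z ^ i / i) atTop (𝓝 (T 1)) := by
      refine (tendsto_add_atTop_iff_nat 1).1 (h1.congr fun n => ?_)
      rw [sum_range_succ']
      simp only [pow_zero, Nat.cast_zero, div_zero, add_zero]
      refine sum_congr rfl fun i _ => ?_
      rw [Real.rpow_neg_one]; push_cast; field_simp
    -- Abel's limit theorem identifies the conditionally convergent value at `s = 1`.
    have h3 := Complex.tendsto_tsum_powerSeries_nhdsWithin_lt h2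
    rw [tendsto_map'_iff] at h3
    have h4 : Tendsto (fun x : ℝ => -Complex.log (1 - z * x)) (𝓝[<] 1)
        (𝓝 (-Complex.log (1 - z))) := by
      have hs : 1 - z * ((1 : ℝ) : ℂ) ∈ Complex.slitPlane := by
        left
        have h5 : z.re < 1 := by
          refine lt_of_le_of_ne (hz ▸ Complex.re_le_norm z) fun h => hz1 ?_
          have h6 := Complex.sq_norm z
          rw [hz, Complex.normSq_apply, h] at h6
          apply Complex.ext
          · simpa using h
          · have : z.im * z.im = 0 := by linarith
            simpa using this
        simp; exact h5
      have h7 : ContinuousAt (fun x : ℝ => 1 - z * (x : ℂ)) 1 := by fun_prop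
      have h5 : ContinuousAt (fun x : ℝ => -Complex.log (1 - z * x)) 1 := (h7.clog hs).neg
      have h6 := h5.tendsto
      simp only [Complex.ofReal_one, mul_one] at h6
      exact h6.mono_left nhdsWithin_le_nhds
    refine tendsto_nhds_unique (h3.congr' ?_) h4
    filter_upwards [Ioo_mem_nhdsLT (show (0 : ℝ) < 1 from one_pos)] with x hx
    have h5 : ‖z * x‖ < 1 := by
      rw [norm_mul, hz, one_mul, Complex.norm_real, Real.norm_of_nonneg hx.1.le]; exact hx.2
    rw [Function.comp, ← (Complex.hasSum_taylorSeries_neg_log h5).tsum_eq]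
    refine tsum_congr fun n => ?_
    rw [mul_pow]; ring
  have hTlim : Tendsto T (𝓝[>] 1) (𝓝 (T 1)) := by
    refine tendsto_tsum_of_dominated_convergence
      (bound := fun n : ℕ => 2 * (1 / ((n : ℝ) + 1) ^ 2) * (2 / ‖z - 1‖))
      (summable_two_mul_one_div.mul_right _) (fun n => ?_) ?_
    · refine Tendsto.mul_const _ ?_
      refine (Complex.continuous_ofReal.tendsto _).comp ?_
      refine Tendsto.mono_left ?_ nhdsWithin_le_nhds
      have h1 : ContinuousAt (fun s : ℝ => ((n : ℝ) + 1) ^ (-s) -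
          (((n + 1 : ℕ) : ℝ) + 1) ^ (-s)) 1 := by
        refine ContinuousAt.sub ?_ ?_
        · exact ContinuousAt.rpow continuousAt_const (by fun_prop) (Or.inl (by positivity))
        · exact ContinuousAt.rpow continuousAt_const (by fun_prop) (Or.inl (by positivity))
      exact h1.tendsto
    · filter_upwards [Ioo_mem_nhdsGT (show (1 : ℝ) < 2 from one_lt_two)] with s hs n
      rw [norm_mul, Complex.norm_real]
      exact mul_le_mul (hbound s hs.1.le hs.2.le n) (norm_geom_sum_le hz hz1 _) (norm_nonneg _)
        (by positivity)
  rw [← hT1]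
  refine hTlim.congr' ?_
  filter_upwards [Ioo_mem_nhdsGT (show (1 : ℝ) < 2 from one_lt_two)] with s hs
  refine tendsto_nhds_unique (hpart s hs.1.le hs.2.le) (Summable.hasSum ?_).tendsto_sum_nat
  have h1 : Summable fun n : ℕ => ((n : ℝ) + 1) ^ (-s) := by
    have := (summable_nat_add_iff 1).2 (Real.summable_nat_rpow.2 (show -s < -1 by linarith [hs.1]))
    simpa using this
  refine Summable.of_norm_bounded h1 fun n => ?_
  rw [norm_mul, norm_pow, hz, one_pow, mul_one, Complex.norm_real,
    Real.norm_of_nonneg (by positivity)]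

open HurwitzZeta in
theorem expZeta_one {a : ℝ} (ha : (a : UnitAddCircle) ≠ 0) :
    expZeta a 1 = -Complex.log (1 - Complex.exp (2 * Real.pi * Complex.I * a)) := by
  set z := Complex.exp (2 * Real.pi * Complex.I * a) with hzdef
  have hz : ‖z‖ = 1 := by
    rw [hzdef, show 2 * (Real.pi : ℂ) * Complex.I * a = ((2 * Real.pi * a : ℝ) : ℂ) * Complex.I by
      push_cast; ring, Complex.norm_exp_ofReal_mul_I]
  have hz1 : z ≠ 1 := by
    intro h
    apply ha
    obtain ⟨n, hn⟩ := Complex.exp_eq_one_iff.1 h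
    rw [AddCircle.coe_eq_zero_iff]
    refine ⟨n, ?_⟩
    have h1 : (a : ℂ) = n := by
      have h2 : (2 * (Real.pi : ℂ) * Complex.I) ≠ 0 := Complex.two_pi_I_ne_zero
      apply mul_left_cancel₀ h2
      rw [hn]; ring
    have h3 : a = n := by exact_mod_cast h1
    rw [h3]; simp
  have h1 : Tendsto (fun s : ℝ => expZeta a s) (𝓝[>] 1) (𝓝 (expZeta a 1)) := by
    have h2 : ContinuousAt (fun s : ℂ => expZeta a s) ((1 : ℝ) : ℂ) :=
      (differentiableAt_expZeta a _ (Or.inr ha)).continuousAt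
    have h3 := h2.comp (Complex.continuous_ofReal.continuousAt (x := 1))
    have h4 := h3.tendsto
    simp only [Function.comp_def, Complex.ofReal_one] at h4
    exact h4.mono_left nhdsWithin_le_nhds
  refine tendsto_nhds_unique h1 ((tendsto_tsum_pow_mul_rpow hz hz1).congr' ?_)
  filter_upwards [self_mem_nhdsWithin] with s hs
  have hs' : 1 < (s : ℂ).re := by simpa using hs
  have h2 := hasSum_expZeta_of_one_lt_re a hs'
  have hs0 : (s : ℂ) ≠ 0 := by
    intro h; rw [h] at hs'; simp at hs'; linarith
  have h3 := ((hasSum_nat_add_iff' 1).2 h2).tsum_eq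
  rw [sum_range_one, Nat.cast_zero, Complex.zero_cpow hs0, div_zero, sub_zero] at h3
  rw [← h3]
  refine tsum_congr fun n => ?_
  rw [Complex.ofReal_cpow (by positivity), mul_comm, hzdef, ← Complex.exp_nat_mul]
  rw [Complex.ofReal_neg, Complex.cpow_neg, ← div_eq_mul_inv]
  push_cast
  congr 2
  ring

end OddDistribution

/-! ### Odd characters and the sawtooth function -/

namespace OddDistribution

open Filter Topology Finset

section SinZeta

open HurwitzZeta

theorem one_sub_exp_two_pi_mul (x : ℝ) : 1 - Complex.exp (2 * Real.pi * Complex.I * x) =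
    ((2 * Real.sin (Real.pi * x) : ℝ) : ℂ) *
      Complex.exp ((Real.pi * (x - 1 / 2) : ℝ) * Complex.I) := by
  have h1 : Complex.exp (2 * Real.pi * Complex.I * x) =
      Complex.exp ((Real.pi * x : ℝ) * Complex.I) * Complex.exp ((Real.pi * x : ℝ) * Complex.I) := by
    rw [← Complex.exp_add]; congr 1; push_cast; ring
  have h2 : Complex.exp ((Real.pi * (x - 1 / 2) : ℝ) * Complex.I) =
      Complex.exp ((Real.pi * x : ℝ) * Complex.I) * (-Complex.I) := by
    rw [← Complex.exp_neg_pi_div_two_mul_I, ← Complex.exp_add]; congr 1; push_cast; ring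
  have h3 : ((Real.sin (Real.pi * x) : ℝ) : ℂ) = Complex.sin ((Real.pi * x : ℝ) : ℂ) := by
    rw [Complex.ofReal_sin]
  have h4 := Complex.exp_mul_I ((Real.pi * x : ℝ) : ℂ)
  have h5 := Complex.sin_sq_add_cos_sq ((Real.pi * x : ℝ) : ℂ)
  rw [h1, h2, Complex.ofReal_mul 2, h3, h4, Complex.ofReal_ofNat]
  linear_combination -h5 + Complex.sin ((Real.pi * x : ℝ) : ℂ) ^ 2 * Complex.I_sq

theorem log_one_sub_exp {x : ℝ} (hx : 0 < Real.sin (Real.pi * x)) (h0 : -(1 / 2) < x)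
    (h1 : x < 3 / 2) : Complex.log (1 - Complex.exp (2 * Real.pi * Complex.I * x)) =
      Real.log (2 * Real.sin (Real.pi * x)) + (Real.pi * (x - 1 / 2) : ℝ) * Complex.I := by
  have hpi := Real.pi_pos
  rw [one_sub_exp_two_pi_mul, Complex.log_ofReal_mul (by linarith) (Complex.exp_ne_zero _),
    Complex.log_exp]
  · simp only [Complex.mul_im, Complex.ofReal_re, Complex.I_im, Complex.ofReal_im, Complex.I_re]
    nlinarith
  · simp only [Complex.mul_im, Complex.ofReal_re, Complex.I_im, Complex.ofReal_im, Complex.I_re]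
    nlinarith

theorem coe_ne_zero_of_mem_Ioo {x : ℝ} (h0 : 0 < x) (h1 : x < 1) : (x : UnitAddCircle) ≠ 0 := by
  intro h
  obtain ⟨n, hn⟩ := (AddCircle.coe_eq_zero_iff 1).1 h
  simp only [zsmul_eq_mul, mul_one] at hn
  rw [← hn] at h0 h1
  have h2 : (0 : ℤ) < n := by exact_mod_cast h0
  have h3 : n < (1 : ℤ) := by exact_mod_cast h1
  omega

/-- The two logarithms for `x` and `1 - x` have equal real parts, and their arguments are `± π (x -
1/2)`. -/
theorem sinZeta_one {x : ℝ} (h0 : 0 < x) (h1 : x < 1) :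
    sinZeta x 1 = (Real.pi * (1 / 2 - x) : ℝ) := by
  have hne := coe_ne_zero_of_mem_Ioo h0 h1
  have hs1 : 0 < Real.sin (Real.pi * x) :=
    Real.sin_pos_of_pos_of_lt_pi (by positivity) (by nlinarith [Real.pi_pos])
  have hs2 : Real.sin (Real.pi * (1 - x)) = Real.sin (Real.pi * x) := by
    rw [mul_sub, mul_one, Real.sin_pi_sub]
  have hx : -(x : UnitAddCircle) = ((1 - x : ℝ) : UnitAddCircle) := by
    rw [AddCircle.coe_sub, AddCircle.coe_period, zero_sub]
  have hne' : ((1 - x : ℝ) : UnitAddCircle) ≠ 0 := by rw [← hx]; exact neg_ne_zero.2 hne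
  rw [sinZeta_eq, hx, expZeta_one hne, expZeta_one hne',
    log_one_sub_exp hs1 (by linarith) (by linarith),
    log_one_sub_exp (by rw [hs2]; exact hs1) (by linarith) (by linarith), hs2]
  push_cast
  field_simp
  ring

end SinZeta

noncomputable section

/-- The sawtooth function of `-x / m` on `ℤ / m`. -/
def sawZ (m : ℕ) (x : ZMod m) : ℚ := saw (-((x.val : ℚ) / m))

theorem sawZ_intCast {m : ℕ} [NeZero m] (a : ℤ) : sawZ m a = saw (-((a : ℚ) / m)) :=
  saw_div_congr (a := (((a : ZMod m).val : ℕ) : ℤ)) (by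
    rw [Int.cast_natCast, ZMod.natCast_zmod_val])

theorem sawZ_natCast {m : ℕ} [NeZero m] (a : ℕ) : sawZ m a = saw (-((a : ℚ) / m)) := by
  have := sawZ_intCast (m := m) a
  rwa [Int.cast_natCast, Int.cast_natCast] at this

open HurwitzZeta in
theorem sinZeta_toAddCircle {N : ℕ} [NeZero N] (j : ZMod N) :
    sinZeta (ZMod.toAddCircle j) 1 = ((Real.pi : ℝ) : ℂ) * ((sawZ N j : ℚ) : ℂ) := by
  by_cases hj : j = 0
  · subst hj
    have h : sinZeta 0 1 = 0 := by
      have := sinZeta_neg 0 1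
      rw [neg_zero] at this
      exact self_eq_neg.1 this
    simp [sawZ, saw_zero, h]
  · have hN : (0 : ℝ) < N := Nat.cast_pos.2 (NeZero.pos N)
    have h1 : 0 < j.val := Nat.pos_of_ne_zero ((ZMod.val_ne_zero j).2 hj)
    have h2 : j.val < N := ZMod.val_lt j
    rw [ZMod.toAddCircle_apply, sinZeta_one (div_pos (Nat.cast_pos.2 h1) hN)
      ((div_lt_one hN).2 (Nat.cast_lt.2 h2)), sawZ, saw_neg, saw_of_lt]
    · push_cast; ring
    · exact div_pos (Nat.cast_pos.2 h1) (Nat.cast_pos.2 (NeZero.pos N))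
    · exact (div_lt_one (Nat.cast_pos.2 (NeZero.pos N))).2 (Nat.cast_lt.2 h2)

-- Up to a nonzero factor the sum is the value at `1` of the L-function of the Fourier transform of
-- `χ`. For primitive `χ` this transform is a Gauss sum multiple of `χ⁻¹`, so vanishing would
-- contradict `L(1, χ⁻¹) ≠ 0`.
open HurwitzZeta ZMod in
theorem sum_mul_sawZ_ne_zero_of_isPrimitive {N : ℕ} [NeZero N] {χ : DirichletCharacter ℂ N}
    (hχ : χ.IsPrimitive) (hodd : χ.Odd) : ∑ j, χ j * (sawZ N j : ℂ) ≠ 0 := by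
  intro h0
  have hχ1 : χ ≠ 1 := by
    rintro rfl
    have h1 : (1 : DirichletCharacter ℂ N) (-1) = -1 := hodd
    rw [MulChar.one_apply (isUnit_one.neg)] at h1
    norm_num at h1
  have hN : N ≠ 1 := by rintro rfl; exact hχ1 (DirichletCharacter.level_one χ)
  have hz : χ 0 = 0 := χ.map_zero' hN
  have h1 := ZMod.LFunction_dft χ (s := 1) (Or.inl hz)
  have hneg (j : ZMod N) : χ (-j) = -χ j := by
    rw [← neg_one_mul, map_mul, hodd, neg_one_mul]
  have h2 : ∑ j : ZMod N, χ j * expZeta (toAddCircle (-j)) 1 = 0 := by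
    have h3 : ∑ j : ZMod N, χ j * expZeta (toAddCircle (-j)) 1 =
        -∑ j : ZMod N, χ j * expZeta (toAddCircle j) 1 := by
      rw [← Equiv.sum_comp (Equiv.neg (ZMod N)), ← sum_neg_distrib]
      refine sum_congr rfl fun j _ => ?_
      rw [Equiv.neg_apply, neg_neg, hneg, neg_mul]
    have h4 : ∑ j : ZMod N, χ j * expZeta (toAddCircle j) 1 -
        ∑ j : ZMod N, χ j * expZeta (toAddCircle (-j)) 1 =
        2 * Complex.I * Real.pi * ∑ j, χ j * (sawZ N j : ℂ) := by
      rw [← sum_sub_distrib, mul_sum]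
      refine sum_congr rfl fun j _ => ?_
      have h5 := sinZeta_toAddCircle j
      rw [sinZeta_eq, div_eq_iff (by simp)] at h5
      rw [map_neg, ← mul_sub, h5]; ring
    rw [h0, mul_zero] at h4
    have h5 : (2 : ℂ) * ∑ j : ZMod N, χ j * expZeta (toAddCircle (-j)) 1 = 0 := by
      linear_combination h3 - h4
    simpa using h5
  rw [h2] at h1
  have h3 : ZMod.dft (χ : ZMod N → ℂ) = fun k => (-gaussSum χ stdAddChar) * χ⁻¹ k := by
    ext k
    rw [hχ.fourierTransform_eq_inv_mul_gaussSum, ← neg_one_mul k, map_mul]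
    have : χ⁻¹ (-1) = -1 := by
      rw [MulChar.inv_apply_eq_inv', hodd]; norm_num
    rw [this]; ring
  have h4 : ZMod.LFunction (ZMod.dft (χ : ZMod N → ℂ)) 1 =
      (-gaussSum χ stdAddChar) * DirichletCharacter.LFunction χ⁻¹ 1 := by
    rw [h3, DirichletCharacter.LFunction, ZMod.LFunction, ZMod.LFunction, mul_left_comm]
    congr 1
    rw [mul_sum]
    exact sum_congr rfl fun j _ => by ring
  rw [h4, mul_eq_zero, neg_eq_zero] at h1
  rcases h1 with h1 | h1
  -- If the Gauss sum were zero, the Fourier transform of `χ` would vanish, and with it `χ`.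
  · have h5 : ZMod.dft (χ : ZMod N → ℂ) = 0 := by
      rw [h3, h1]; ext k; simp
    rw [LinearEquiv.map_eq_zero_iff] at h5
    have h6 := congrFun h5 1
    rw [map_one] at h6
    exact one_ne_zero h6
  · exact DirichletCharacter.LFunction_apply_one_ne_zero (inv_ne_one.2 hχ1) h1

theorem sum_comp_hom {G H : Type*} [Group G] [Group H] [Fintype G] [Fintype H] [DecidableEq H]
    (φ : G →* H) (hφ : Function.Surjective φ) (F : H → ℂ) :
    ∑ g, F (φ g) = #(univ.filter fun g => φ g = 1) * ∑ h, F h := by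
  rw [← sum_fiberwise univ φ, mul_sum]
  refine sum_congr rfl fun h _ => ?_
  rw [sum_congr rfl fun g hg => by rw [(mem_filter.1 hg).2], sum_const, nsmul_eq_mul]
  congr 2
  exact MonoidHom.card_fiber_eq_of_mem_range φ (hφ h) (hφ 1)

/-- With `f` the conductor, take `a = m / f`. Then both `χ` and the sawtooth function factor through
the units modulo `f`, and the sum is the primitive one times the order of a kernel. -/
theorem exists_sum_mul_sawZ_ne_zero {m : ℕ} [NeZero m] {χ : DirichletCharacter ℂ m}
    (hodd : χ.Odd) : ∃ a : ZMod m, ∑ u : (ZMod m)ˣ, χ u * (sawZ m (a * u) : ℂ) ≠ 0 := by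
  classical
  set f := χ.conductor with hf
  have hfm : f ∣ m := χ.conductor_dvd_level
  have : NeZero f := ⟨χ.conductor_ne_zero⟩
  set ψ := χ.primitiveCharacter
  have hcl : DirichletCharacter.changeLevel hfm ψ = χ := χ.changeLevel_primitiveCharacter
  have hχψ (u : (ZMod m)ˣ) : χ u = ψ (ZMod.unitsMap hfm u : ZMod f) := by
    conv_lhs => rw [← hcl]
    rw [DirichletCharacter.changeLevel_eq_cast_of_dvd, ZMod.unitsMap_val]
  have hψodd : ψ.Odd := by
    have h1 := hχψ (-1)
    rw [Units.val_neg, Units.val_one, hodd] at h1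
    rw [DirichletCharacter.Odd, h1]
    rw [ZMod.unitsMap_val, Units.val_neg, Units.val_one, ZMod.cast_neg hfm, ZMod.cast_one hfm]
  refine ⟨((m / f : ℕ) : ZMod m), ?_⟩
  have hsaw (u : (ZMod m)ˣ) : sawZ m ((m / f : ℕ) * u) = sawZ f (ZMod.unitsMap hfm u : ZMod f) := by
    have h1 : (ZMod.unitsMap hfm u : ZMod f) = ((u : ZMod m).val : ZMod f) := by
      rw [ZMod.unitsMap_val, ZMod.natCast_val]
    have h2 : ((m / f : ℕ) * u : ZMod m) = ((m / f * (u : ZMod m).val : ℕ) : ZMod m) := by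
      rw [Nat.cast_mul, ZMod.natCast_zmod_val]
    have hf0 : (f : ℚ) ≠ 0 := Nat.cast_ne_zero.2 (NeZero.ne f)
    have hm0 : (m : ℚ) ≠ 0 := Nat.cast_ne_zero.2 (NeZero.ne m)
    rw [h1, h2, sawZ_natCast, sawZ_natCast, Nat.cast_mul, Nat.cast_div hfm hf0]
    congr 2
    field_simp
  simp_rw [hχψ, hsaw]
  rw [sum_comp_hom (ZMod.unitsMap hfm) (ZMod.unitsMap_surjective hfm)
    (fun v => ψ (v : ZMod f) * (sawZ f (v : ZMod f) : ℂ))]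
  refine mul_ne_zero ?_ ?_
  · rw [Nat.cast_ne_zero, card_ne_zero]
    exact ⟨1, by simp⟩
  · have h1 := sum_mul_sawZ_ne_zero_of_isPrimitive χ.primitiveCharacter_isPrimitive hψodd
    convert h1 using 1
    refine sum_bij_ne_zero (fun v _ _ => (v : ZMod f)) (fun _ _ _ => mem_univ _)
      (fun _ _ _ _ _ _ h => Units.ext h) (fun j _ hj => ?_) fun _ _ _ => rfl
    by_cases hu : IsUnit j
    · obtain ⟨v, rfl⟩ := hu
      exact ⟨v, mem_univ _, hj, rfl⟩
    · exact absurd (by rw [MulChar.map_nonunit _ hu, zero_mul]) hj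

end

end OddDistribution

/-! ### Linear independence by counting odd characters -/

namespace OddDistribution

open Finset

noncomputable section

-- Sum `1 - χ(-1)` over all `χ`: the values `χ(-1)` add up to zero because `-1 ≠ 1`.
open scoped Classical in
theorem two_mul_card_odd {m : ℕ} [NeZero m] (hm : 2 < m) :
    2 * #(univ.filter fun χ : DirichletCharacter ℂ m => χ.Odd) = Nat.totient m := by
  have h1 : (-1 : ZMod m) ≠ 1 := by
    have : Fact (2 < m) := ⟨hm⟩
    exact ZMod.neg_one_ne_one
  have h2 := DirichletCharacter.sum_characters_eq_zero ℂ h1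
  have h3 : ∑ χ : DirichletCharacter ℂ m, (1 - χ (-1)) =
      2 * #(univ.filter fun χ : DirichletCharacter ℂ m => χ.Odd) := by
    rw [card_eq_sum_ones, Nat.cast_sum, mul_sum, sum_filter]
    refine sum_congr rfl fun χ _ => ?_
    rcases χ.even_or_odd with h | h
    · have hn : ¬ χ.Odd := h.not_odd
      have h' : χ (-1) = 1 := h
      rw [if_neg hn, h', sub_self]
    · have h' : χ (-1) = -1 := h
      rw [if_pos h, h']; norm_num
  have h4 := DirichletCharacter.card_eq_totient_of_hasEnoughRootsOfUnity ℂ m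
  rw [sum_sub_distrib, h2, sub_zero, sum_const, card_univ, nsmul_eq_mul, mul_one,
    ← Nat.card_eq_fintype_card, h4] at h3
  exact_mod_cast h3.symm

/-- A Dirichlet character as a homomorphism from the unit group. -/
def unitChar {m : ℕ} (χ : DirichletCharacter ℂ m) : (ZMod m)ˣ →* ℂ :=
  (χ : ZMod m →* ℂ).comp (Units.coeHom (ZMod m))

theorem unitChar_injective {m : ℕ} :
    Function.Injective (unitChar : DirichletCharacter ℂ m → (ZMod m)ˣ →* ℂ) := by
  intro χ ψ h
  exact MulChar.ext fun u => DFunLike.congr_fun h u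

theorem linearIndependent_unitChar (m : ℕ) :
    LinearIndependent ℂ fun χ : DirichletCharacter ℂ m => (unitChar χ : (ZMod m)ˣ → ℂ) :=
  (linearIndependent_monoidHom (ZMod m)ˣ ℂ).comp _ unitChar_injective

/-- A span of translates of the sawtooth function contains all odd characters. -/
theorem unitChar_mem_of_odd {m : ℕ} [NeZero m] {W : Submodule ℂ ((ZMod m)ˣ → ℂ)}
    (hW : ∀ a : ZMod m, (fun u : (ZMod m)ˣ => (sawZ m (a * u) : ℂ)) ∈ W)
    {χ : DirichletCharacter ℂ m} (hodd : χ.Odd) : (unitChar χ : (ZMod m)ˣ → ℂ) ∈ W := by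
  have hodd' : χ⁻¹.Odd := by
    rw [DirichletCharacter.Odd, MulChar.inv_apply_eq_inv', hodd]; norm_num
  obtain ⟨a, ha⟩ := exists_sum_mul_sawZ_ne_zero hodd'
  -- Projecting the translate by `a` to the `χ`-component gives `χ` times the nonzero sum for `χ⁻¹`.
  have h1 : ∑ u : (ZMod m)ˣ, χ⁻¹ u • (fun s : (ZMod m)ˣ => (sawZ m (a * u * s) : ℂ)) ∈ W :=
    sum_mem fun u _ => W.smul_mem _ (hW _)
  have h2 : ∑ u : (ZMod m)ˣ, χ⁻¹ u • (fun s : (ZMod m)ˣ => (sawZ m (a * u * s) : ℂ)) =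
      (∑ u : (ZMod m)ˣ, χ⁻¹ u * (sawZ m (a * u) : ℂ)) • (unitChar χ : (ZMod m)ˣ → ℂ) := by
    ext s
    rw [Finset.sum_apply, Pi.smul_apply, smul_eq_mul, sum_mul,
      ← Equiv.sum_comp (Equiv.mulRight s⁻¹)]
    refine sum_congr rfl fun u _ => ?_
    have h3 : χ⁻¹ ((s⁻¹ : (ZMod m)ˣ) : ZMod m) = χ s := by
      rw [MulChar.inv_apply_eq_inv', ← MulChar.coe_toUnitHom, ← MulChar.coe_toUnitHom, map_inv,
        Units.val_inv_eq_inv_val, inv_inv]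
    have h4 : (unitChar χ : (ZMod m)ˣ → ℂ) s = χ s := rfl
    rw [Pi.smul_apply, smul_eq_mul, Equiv.coe_mulRight, Units.val_mul, map_mul, h3, h4,
      ← mul_assoc a, mul_assoc (a * u), Units.inv_mul, mul_one]
    ring
  rw [h2] at h1
  exact (W.smul_mem_iff ha).1 h1

/-- A spanning family of the sawtooth functions and constants which is small enough is
linearly independent. -/
theorem linearIndependent_of_forall_mem_span {m : ℕ} [NeZero m] (hm : 2 < m) {κ : Type*}
    [Fintype κ] {v : κ → (ZMod m)ˣ → ℂ} (hcard : 2 * Fintype.card κ ≤ Nat.totient m + 2)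
    (h1 : (1 : (ZMod m)ˣ → ℂ) ∈ Submodule.span ℂ (Set.range v))
    (h2 : ∀ a : ZMod m, (fun u : (ZMod m)ˣ => (sawZ m (a * u) : ℂ)) ∈
      Submodule.span ℂ (Set.range v)) : LinearIndependent ℂ v := by
  classical
  rw [linearIndependent_iff_card_le_finrank_span]
  -- The trivial character stands for the constants. Together with the odd characters it gives
  -- `φ(m)/2 + 1` independent vectors in the span.
  let O := insert 1 (univ.filter fun χ : DirichletCharacter ℂ m => χ.Odd)
  have hO1 : (1 : DirichletCharacter ℂ m) ∉ univ.filter fun χ : DirichletCharacter ℂ m => χ.Odd := by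
    rw [mem_filter]
    rintro ⟨-, h⟩
    have h' : (1 : DirichletCharacter ℂ m) (-1) = -1 := h
    rw [MulChar.one_apply (isUnit_one.neg)] at h'
    norm_num at h'
  have hO : 2 * #O = Nat.totient m + 2 := by
    rw [card_insert_of_notMem hO1, mul_add, two_mul_card_odd hm]
  have hli : LinearIndependent ℂ fun χ : O => (unitChar (χ : DirichletCharacter ℂ m) :
      (ZMod m)ˣ → ℂ) :=
    (linearIndependent_unitChar m).comp _ Subtype.val_injective
  have hmem : Set.range (fun χ : O => (unitChar (χ : DirichletCharacter ℂ m) : (ZMod m)ˣ → ℂ)) ⊆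
      Submodule.span ℂ (Set.range v) := by
    rintro _ ⟨⟨χ, hχ⟩, rfl⟩
    rcases mem_insert.1 hχ with rfl | h
    · have h3 : (unitChar (1 : DirichletCharacter ℂ m) : (ZMod m)ˣ → ℂ) = 1 := by
        ext u; exact MulChar.one_apply u.isUnit
      change (unitChar (1 : DirichletCharacter ℂ m) : (ZMod m)ˣ → ℂ) ∈ Submodule.span ℂ (Set.range v)
      rw [h3]; exact h1
    · exact unitChar_mem_of_odd h2 (mem_filter.1 h).2
  have h3 := Submodule.finrank_mono (Submodule.span_le.2 hmem)
  rw [finrank_span_eq_card hli, Fintype.card_coe] at h3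
  change _ ≤ Module.finrank ℂ (Submodule.span ℂ (Set.range v))
  omega

end

end OddDistribution

/-! ### Passage to functions on `(ℤ / m)ˣ` and to the Galois group ring -/

namespace OddDistribution

open Finset

noncomputable section

/-- The function `u ↦ ((-au/m))` on the unit group. -/
def sawFun (m : ℕ) (a : ZMod m) : (ZMod m)ˣ → ℚ := fun u => sawZ m (a * u)

section Transfer

variable {t : ℕ} {q : Fin t → ℕ} [∀ i, NeZero (q i)] {m : ℕ} [NeZero m]
  (hcop : ∀ i j, i ≠ j → Nat.Coprime (q i) (q j)) (hprod : m = ∏ i, q i)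

/-- Coefficients of an element of the group ring of `∏ (ℤ/qᵢ)ˣ`, as a function on `(ℤ/m)ˣ`. -/
def coeffHom (hprod : m = ∏ i, q i) :
    GrpRing (fun i => (ZMod (q i))ˣ) →+ ((ZMod m)ˣ → ℚ) where
  toFun x u := x.coeff fun i => (ZMod.unitsMap (hprod ▸ dvd_prod_of_mem q (mem_univ i)) u)⁻¹
  map_zero' := rfl
  map_add' _ _ := rfl

theorem coeffHom_sawElt (a : ℤ) : coeffHom hprod (sawElt hcop a) = sawFun m a := by
  ext u
  have hdvd (i) : q i ∣ m := hprod ▸ dvd_prod_of_mem q (mem_univ i)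
  set g : ∀ i, (ZMod (q i))ˣ := fun i => ZMod.unitsMap (hdvd i) u with hg
  have h1 : coeffHom hprod (sawElt hcop a) u =
      sawMod hcop ((a : ∀ i, ZMod (q i)) * fun i => (g i : ZMod (q i))) := by
    change (sawElt hcop a).coeff (g⁻¹) = _
    rw [sawElt, groupElt, MonoidAlgebra.coeff_sum, Finsupp.finsetSum_apply, sum_eq_single g]
    · rw [gp_eq_single, MonoidAlgebra.coeff_smul_apply, MonoidAlgebra.coeff_single,
        Finsupp.single_eq_same, smul_eq_mul, mul_one]
    · intro h _ hne
      rw [gp_eq_single, MonoidAlgebra.coeff_smul_apply, MonoidAlgebra.coeff_single,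
        Finsupp.single_eq_of_ne (fun h' => hne (inv_injective h'.symm)), smul_zero]
    · intro h; exact absurd (mem_univ _) h
  rw [h1, sawFun]
  have h2 : (a : ∀ i, ZMod (q i)) * (fun i => (g i : ZMod (q i))) =
      ((a * ((u : ZMod m).val : ℤ) : ℤ) : ∀ i, ZMod (q i)) := by
    ext i
    rw [Pi.mul_apply, Int.cast_mul, Pi.mul_apply, Int.cast_natCast, Pi.natCast_apply, hg,
      ZMod.unitsMap_val, ZMod.natCast_val]
  have h3 : (a : ZMod m) * u = ((a * ((u : ZMod m).val : ℤ) : ℤ) : ZMod m) := by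
    rw [Int.cast_mul, Int.cast_natCast, ZMod.natCast_zmod_val]
  rw [h2, h3, sawMod_intCast, sawZ_intCast, ← hprod]

include hcop hprod in
theorem sawFun_mem_closure_setM' [∀ i, Fact (1 < q i)] (hpp : ∀ i, IsPrimePow (q i))
    (hq2 : ∀ i, 2 < q i) (b : ℕ) :
    sawFun m b ∈ AddSubgroup.closure {w | ∃ a ∈ Stickelberger.setM' m q,
      (∀ i, q i ∣ b → q i ∣ a) ∧ w = sawFun m (a : ℕ)} := by
  have h1 := AddSubgroup.mem_map_of_mem (coeffHom hprod)
    (sawElt_mem_closure_setM' hcop hprod hpp hq2 b)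
  rw [AddMonoidHom.map_closure, coeffHom_sawElt, Int.cast_natCast] at h1
  refine AddSubgroup.closure_mono ?_ h1
  rintro _ ⟨_, ⟨a, ha, hab, rfl⟩, rfl⟩
  exact ⟨a, ha, hab, by rw [coeffHom_sawElt, Int.cast_natCast]⟩

end Transfer

section FractFun

/-- The fractional part of `-x / n` on `ℤ / n`. -/
def fractZ (n : ℕ) (x : ZMod n) : ℚ := Int.fract (-((x.val : ℚ) / n))

theorem fractZ_intCast {n : ℕ} [NeZero n] (a : ℤ) :
    fractZ n a = Int.fract (-((a : ℚ) / n)) := by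
  obtain ⟨k, hk⟩ := (ZMod.intCast_eq_intCast_iff_dvd_sub _ _ _).1
    (show (((a : ZMod n).val : ℤ) : ZMod n) = a by rw [Int.cast_natCast, ZMod.natCast_zmod_val])
  have hn : (n : ℚ) ≠ 0 := Nat.cast_ne_zero.2 (NeZero.ne n)
  have h1 : -(((a : ZMod n).val : ℚ) / n) = -((a : ℚ) / n) + k := by
    have : (a : ℚ) - (a : ZMod n).val = n * k := by exact_mod_cast hk
    field_simp; linarith
  rw [fractZ, h1, Int.fract_add_intCast]

theorem fractZ_zero (n : ℕ) : fractZ n 0 = 0 := by simp [fractZ]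

theorem sawZ_zero (n : ℕ) : sawZ n 0 = 0 := by simp [sawZ, saw_zero]

theorem fractZ_eq {n : ℕ} [NeZero n] {x : ZMod n} (hx : x ≠ 0) :
    fractZ n x = sawZ n x + 1 / 2 := by
  have hn : (0 : ℚ) < n := Nat.cast_pos.2 (NeZero.pos n)
  have h1 : (0 : ℚ) < x.val := Nat.cast_pos.2 (Nat.pos_of_ne_zero ((ZMod.val_ne_zero x).2 hx))
  have h2 : (x.val : ℚ) < n := Nat.cast_lt.2 (ZMod.val_lt x)
  have h3 : Int.fract ((x.val : ℚ) / n) = x.val / n :=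
    Int.fract_eq_self.2 ⟨(div_pos h1 hn).le, (div_lt_one hn).2 h2⟩
  have h4 : Int.fract ((x.val : ℚ) / n) ≠ 0 := by rw [h3]; exact (div_pos h1 hn).ne'
  rw [sawZ, fractZ, saw, if_neg (by rwa [Int.fract_neg_eq_zero])]
  ring

end FractFun

section GroupRing

open Stickelberger

/-- The isomorphism of the unit group with the Galois group. -/
def galUnits (m : ℕ) [NeZero m] : (ZMod m)ˣ ≃* G m :=
  (IsCyclotomicExtension.Rat.galEquivZMod m (cycField m)).symm

theorem sigma_eq {m : ℕ} [NeZero m] {s : ℕ} (h : Nat.Coprime s m) :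
    sigma m s = galUnits m (ZMod.unitOfCoprime s h) := by
  rw [sigma, dif_pos h, galUnits]

theorem restrictGal_galUnits {n d : ℕ} [NeZero n] [NeZero d] (h : d ∣ n) (u : (ZMod n)ˣ) :
    restrictGal n d h (galUnits n u) = galUnits d (ZMod.unitsMap h u) := by
  let : Algebra (cycField d) (cycField n) :=
    (IntermediateField.inclusion (cycField_le h)).toRingHom.toAlgebra
  have h1 := IsCyclotomicExtension.Rat.galEquivZMod_restrictNormal_apply n (cycField n)
    (cycField d) h (galUnits n u)
  have h2 : IsCyclotomicExtension.Rat.galEquivZMod n (cycField n) (galUnits n u) = u :=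
    MulEquiv.apply_symm_apply _ _
  rw [h2] at h1
  change _ = (IsCyclotomicExtension.Rat.galEquivZMod d (cycField d)).symm _
  rw [MulEquiv.eq_symm_apply, ← h1]
  rfl

/-- The element of the rational group ring with given coefficients at the `σ_u⁻¹`. -/
def toQG (m : ℕ) [NeZero m] : ((ZMod m)ˣ → ℚ) →ₗ[ℚ] QG m where
  toFun φ := ∑ u, MonoidAlgebra.single (galUnits m u)⁻¹ (φ u)
  map_add' φ ψ := by
    simp only [Pi.add_apply, MonoidAlgebra.single_add, sum_add_distrib]
  map_smul' c φ := by
    simp only [Pi.smul_apply, RingHom.id_apply, smul_sum, MonoidAlgebra.smul_single]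

theorem toQG_apply {m : ℕ} [NeZero m] (φ : (ZMod m)ˣ → ℚ) :
    toQG m φ = ∑ u, MonoidAlgebra.single (galUnits m u)⁻¹ (φ u) := rfl

theorem coeff_toQG {m : ℕ} [NeZero m] (φ : (ZMod m)ˣ → ℚ) (u : (ZMod m)ˣ) :
    (toQG m φ).coeff (galUnits m u)⁻¹ = φ u := by
  rw [toQG_apply, MonoidAlgebra.coeff_sum, Finsupp.finsetSum_apply, sum_eq_single u]
  · rw [MonoidAlgebra.coeff_single, Finsupp.single_eq_same]
  · intro v _ hv
    rw [MonoidAlgebra.coeff_single, Finsupp.single_eq_of_ne]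
    intro h
    exact hv ((galUnits m).injective (inv_injective h)).symm
  · intro h; exact absurd (mem_univ _) h

theorem toQG_injective (m : ℕ) [NeZero m] : Function.Injective (toQG m) := by
  intro φ ψ h
  ext u
  rw [← coeff_toQG φ, h, coeff_toQG]

theorem normElt_eq (m : ℕ) [NeZero m] : normElt m = toQG m 1 := by
  rw [normElt, toQG_apply]
  exact (Equiv.sum_comp ((galUnits m).toEquiv.trans (Equiv.inv (G m))) _).symm

/-- Sums over the integers in `[1, n]` prime to `n`. -/
theorem sum_Icc_coprime {A : Type*} [AddCommMonoid A] {n : ℕ} [NeZero n] (f : ℕ → A)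
    (g : (ZMod n)ˣ → A) (h : ∀ s (hs : Nat.Coprime s n), f s = g (ZMod.unitOfCoprime s hs)) :
    ∑ s ∈ Icc 1 n with Nat.Coprime s n, f s = ∑ u, g u := by
  refine sum_bij (fun s hs => ZMod.unitOfCoprime s (mem_filter.1 hs).2) (fun _ _ => mem_univ _)
    ?_ ?_ fun s hs => h s _
  · intro s hs s' hs' heq
    have h1 := congrArg (fun u : (ZMod n)ˣ => (u : ZMod n)) heq
    simp only [ZMod.coe_unitOfCoprime] at h1
    have h2 := mem_Icc.1 (mem_filter.1 hs).1
    have h3 := mem_Icc.1 (mem_filter.1 hs').1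
    rw [ZMod.natCast_eq_natCast_iff] at h1
    have h4 : (n : ℤ) ∣ s' - s := Nat.modEq_iff_dvd.1 h1
    have h5 : (s' : ℤ) - s = 0 := by
      refine Int.eq_zero_of_abs_lt_dvd h4 ?_
      rw [abs_lt]; omega
    omega
  · intro u _
    by_cases h0 : (u : ZMod n).val = 0
    · have h1 := ZMod.val_coe_unit_coprime u
      rw [h0, Nat.coprime_zero_left] at h1
      subst h1
      exact ⟨1, by simp, Subsingleton.elim _ _⟩
    · refine ⟨(u : ZMod n).val, mem_filter.2 ⟨mem_Icc.2 ⟨Nat.pos_of_ne_zero h0, ?_⟩,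
        ZMod.val_coe_unit_coprime u⟩, ?_⟩
      · exact (ZMod.val_lt _).le
      · ext; rw [ZMod.coe_unitOfCoprime, ZMod.natCast_zmod_val]

theorem theta_eq {m : ℕ} [NeZero m] (a : ℤ) :
    theta m a = toQG m fun u => fractZ m (a * u) := by
  rw [theta, toQG_apply]
  refine sum_Icc_coprime _ (fun u : (ZMod m)ˣ =>
    (MonoidAlgebra.single (galUnits m u)⁻¹ (fractZ m (a * u)) : QG m)) fun s hs => ?_
  rw [sigma_eq hs, ZMod.coe_unitOfCoprime]
  have h1 : (a : ZMod m) * (s : ZMod m) = ((a * s : ℤ) : ZMod m) := by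
    rw [Int.cast_mul, Int.cast_natCast]
  rw [h1, fractZ_intCast, Int.cast_mul, Int.cast_natCast]

theorem omega_eq {m : ℕ} [NeZero m] (a : ℤ) : omega m a = toQG m (sawFun m a) := by
  rw [omega]
  split_ifs with h
  · have h1 : (a : ZMod m) = 0 := (ZMod.intCast_zmod_eq_zero_iff_dvd a m).2 h
    have h2 : sawFun m (a : ZMod m) = 0 := by ext u; simp [sawFun, h1, sawZ_zero]
    rw [h2, map_zero]
  · have h1 : (a : ZMod m) ≠ 0 := fun h' => h ((ZMod.intCast_zmod_eq_zero_iff_dvd a m).1 h')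
    rw [theta_eq, normElt_eq, ← map_smul, ← map_sub]
    congr 1
    ext u
    have h2 : (a : ZMod m) * u ≠ 0 := by rwa [Ne, Units.mul_left_eq_zero]
    simp [sawFun, fractZ_eq h2]

open scoped Classical in
theorem cor_single_smul (m n : ℕ) [NeZero m] [NeZero n] (h : n ∣ m) (τ : G n) (c : ℚ) :
    cor m n h (MonoidAlgebra.single τ c) =
      ∑ σ : G m with restrictGal m n h σ = τ, MonoidAlgebra.single σ c := by
  have h1 : (MonoidAlgebra.single τ c : QG n) = c • MonoidAlgebra.single τ 1 := by
    rw [MonoidAlgebra.smul_single, smul_eq_mul, mul_one]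
  rw [h1, map_smul, cor_single, smul_sum]
  refine sum_congr rfl fun σ _ => ?_
  rw [MonoidAlgebra.smul_single, smul_eq_mul, mul_one]

/-- Restriction sends `σ_v` to its image at level `(m, n)`, and corestriction distributes the
coefficient over all `u` with that image. This is where the Galois groups disappear from the
description of the generators. -/
theorem thetaRel_eq {m n : ℕ} [NeZero m] [NeZero n] (a : ℤ) :
    thetaRel m n a = toQG m fun u =>
      ∑ v : (ZMod n)ˣ with ZMod.unitsMap (Nat.gcd_dvd_right m n) v =
        ZMod.unitsMap (Nat.gcd_dvd_left m n) u, fractZ n (a * v) := by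
  classical
  have h1 (v : (ZMod n)ˣ) (c : ℚ) : cor m (Nat.gcd m n) (Nat.gcd_dvd_left m n)
      (res n (Nat.gcd m n) (Nat.gcd_dvd_right m n) (MonoidAlgebra.single (galUnits n v)⁻¹ c)) =
      ∑ u : (ZMod m)ˣ with ZMod.unitsMap (Nat.gcd_dvd_right m n) v =
        ZMod.unitsMap (Nat.gcd_dvd_left m n) u, MonoidAlgebra.single (galUnits m u)⁻¹ c := by
    have h2 : res n (Nat.gcd m n) (Nat.gcd_dvd_right m n)
        (MonoidAlgebra.single (galUnits n v)⁻¹ c) = MonoidAlgebra.single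
        (galUnits (Nat.gcd m n) (ZMod.unitsMap (Nat.gcd_dvd_right m n) v))⁻¹ c := by
      rw [← restrictGal_galUnits, ← map_inv, res]
      simp [MonoidAlgebra.mapDomain_single]
    rw [h2, cor_single_smul]
    symm
    refine sum_bij (fun u _ => (galUnits m u)⁻¹) ?_ ?_ ?_ fun _ _ => rfl
    · intro u hu
      rw [mem_filter] at hu ⊢
      refine ⟨mem_univ _, ?_⟩
      rw [map_inv, restrictGal_galUnits, hu.2]
    · intro u _ u' _ h
      exact (galUnits m).injective (inv_injective h)
    · intro σ hσ
      have h3 := (mem_filter.1 hσ).2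
      refine ⟨(galUnits m).symm σ⁻¹, mem_filter.2 ⟨mem_univ _, ?_⟩, by simp⟩
      apply (galUnits (Nat.gcd m n)).injective
      rw [← restrictGal_galUnits (Nat.gcd_dvd_left m n), MulEquiv.apply_symm_apply, map_inv, h3, inv_inv]
  rw [thetaRel, theta_eq, toQG_apply, map_sum, map_sum, sum_congr rfl fun v _ => h1 v _, toQG_apply]
  simp_rw [sum_filter]
  rw [sum_comm]
  refine sum_congr rfl fun u _ => ?_
  rw [← MonoidAlgebra.singleAddHom_apply, map_sum]
  refine sum_congr rfl fun v _ => ?_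
  split_ifs
  · rfl
  · rw [map_zero]

end GroupRing

end

end OddDistribution

/-! ### Sums of sawtooth values over units in a residue class -/

namespace OddDistribution

open Finset

noncomputable section

theorem sum_range_zmod {E : Type*} [AddCommMonoid E] {K : ℕ} [NeZero K] (f : ZMod K → E) :
    ∑ k ∈ range K, f k = ∑ z, f z := by
  have h := sum_ker_mul_eq (dvd_refl K) f
  simp only [Nat.div_self (NeZero.pos K), mul_one, ZMod.natCast_self, zero_mul, filter_true] at h
  exact h.symm

theorem saw_add_val_div {K : ℕ} [NeZero K] (x : ℚ) (b : ℤ) :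
    saw (x + (((b : ZMod K).val : ℕ) : ℚ) / K) = saw (x + (b : ℚ) / K) := by
  obtain ⟨k, hk⟩ := (ZMod.intCast_eq_intCast_iff_dvd_sub _ _ _).1
    (show (((b : ZMod K).val : ℤ) : ZMod K) = b by rw [Int.cast_natCast, ZMod.natCast_zmod_val])
  have hn : (K : ℚ) ≠ 0 := Nat.cast_ne_zero.2 (NeZero.ne K)
  have h1 : x + (b : ℚ) / K = x + (((b : ZMod K).val : ℕ) : ℚ) / K + k := by
    have : (b : ℚ) - (b : ZMod K).val = K * k := by exact_mod_cast hk
    field_simp; linarith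
  rw [h1, saw_add_int]

theorem sum_saw_sub_of_coprime {K : ℕ} [NeZero K] {a : ℤ} (ha : IsCoprime a K) (x : ℚ) :
    ∑ k ∈ range K, saw (x - a * k / K) = saw (K * x) := by
  have hu : IsUnit ((-a : ℤ) : ZMod K) := by
    rw [ZMod.coe_int_isUnit_iff_isCoprime]; exact ha.symm.neg_right
  obtain ⟨u, hu⟩ := hu
  have h1 (k : ℕ) : saw (x - a * k / K) = saw (x + ((u * (k : ZMod K)).val : ℚ) / K) := by
    have h2 : (u : ZMod K) * (k : ZMod K) = ((-a * k : ℤ) : ZMod K) := by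
      rw [hu, Int.cast_mul, Int.cast_natCast]
    rw [h2, saw_add_val_div]
    congr 1; push_cast; ring
  simp_rw [h1]
  rw [sum_range_zmod (fun z : ZMod K => saw (x + ((u * z).val : ℚ) / K)),
    show ∑ z : ZMod K, saw (x + ((u * z).val : ℚ) / K) = ∑ z : ZMod K, saw (x + (z.val : ℚ) / K) from
      Equiv.sum_comp (Units.mulLeft u) (fun z : ZMod K => saw (x + (z.val : ℚ) / K)),
    ← sum_range_zmod, ← sum_saw (NeZero.pos K)]
  refine sum_congr rfl fun k _ => ?_
  have := saw_add_val_div (K := K) x k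
  rwa [Int.cast_natCast, Int.cast_natCast] at this

theorem sum_range_mul_of_periodic {f : ℕ → ℚ} {K : ℕ} (hf : ∀ k, f (K + k) = f k) (g : ℕ) :
    ∑ k ∈ range (g * K), f k = g * ∑ k ∈ range K, f k := by
  induction g with
  | zero => simp
  | succ g ih =>
    rw [Nat.succ_mul, Nat.add_comm, sum_range_add, sum_congr rfl fun k _ => hf k, ih]
    push_cast; ring

/-- With `g = gcd (a, K)` the summand has period `K' = K / g` in `k`, and over one period `a'` only
permutes the residues. -/
theorem sum_saw_sub {K : ℕ} (hK : 0 < K) (a : ℤ) :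
    ∃ (g : ℕ) (a' : ℤ) (K' : ℕ), 0 < K' ∧ a = g * a' ∧ K = g * K' ∧
      ∀ x : ℚ, ∑ k ∈ range K, saw (x - a * k / K) = g * saw (K' * x) := by
  have hg : 0 < Int.gcd a K := Int.gcd_pos_of_ne_zero_right _ (by exact_mod_cast hK.ne')
  obtain ⟨a', ha'⟩ := Int.gcd_dvd_left a K
  obtain ⟨K', hK'⟩ := Int.natCast_dvd_natCast.1 (Int.gcd_dvd_right a K)
  set g := Int.gcd a K with hgdef
  have hK'0 : 0 < K' := Nat.pos_of_ne_zero fun h => by rw [h, mul_zero] at hK'; omega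
  have : NeZero K' := ⟨hK'0.ne'⟩
  have hcop : IsCoprime a' (K' : ℤ) := by
    rw [Int.isCoprime_iff_gcd_eq_one]
    have h1 : Int.gcd (g * a') (g * K') = g * Int.gcd a' K' := by
      rw [Int.gcd_mul_left, Int.natAbs_natCast]
    have h2 : Int.gcd (g * a') (g * K' : ℤ) = g := by
      rw [← ha', ← Nat.cast_mul, ← hK', ← hgdef]
    rw [h2] at h1
    exact (Nat.eq_of_mul_eq_mul_left hg (by rw [← h1, mul_one])).symm
  refine ⟨g, a', K', hK'0, ha', hK', fun x => ?_⟩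
  have hg0 : (g : ℚ) ≠ 0 := Nat.cast_ne_zero.2 hg.ne'
  have hK0 : (K' : ℚ) ≠ 0 := Nat.cast_ne_zero.2 hK'0.ne'
  have h1 (k : ℕ) : x - a * k / K = x - a' * k / K' := by
    have h2 : (a : ℚ) = g * a' := by exact_mod_cast ha'
    have h3 : (K : ℚ) = g * K' := by exact_mod_cast hK'
    rw [h2, h3]; field_simp
  simp_rw [h1]
  rw [← sum_saw_sub_of_coprime hcop, hK']
  refine sum_range_mul_of_periodic (f := fun k : ℕ => saw (x - a' * k / K')) (fun k => ?_) g
  have h2 : x - a' * ((K' + k : ℕ) : ℚ) / K' = x - a' * k / K' + ((-a' : ℤ) : ℚ) := by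
    push_cast; field_simp; ring
  rw [h2, saw_add_int]

theorem sum_range_filter_eq {d K : ℕ} [NeZero d] (z : ZMod d) (F : ℕ → ℚ) :
    ∑ w ∈ (range (d * K)).filter (fun w : ℕ => (w : ZMod d) = z), F w = ∑ k ∈ range K, F (z.val + d * k) := by
  have hd : 0 < d := NeZero.pos d
  have hz : z.val < d := ZMod.val_lt z
  symm
  refine sum_bij (fun k _ => z.val + d * k) ?_ ?_ ?_ fun _ _ => rfl
  · intro k hk
    rw [mem_filter, mem_range]
    constructor
    · calc z.val + d * k < d + d * k := Nat.add_lt_add_right hz _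
        _ = d * (k + 1) := by ring
        _ ≤ d * K := Nat.mul_le_mul_left _ (mem_range.1 hk)
    · push_cast
      rw [ZMod.natCast_zmod_val, ZMod.natCast_self, zero_mul, add_zero]
  · intro k _ k' _ h
    exact Nat.eq_of_mul_eq_mul_left hd (Nat.add_left_cancel h)
  · intro w hw
    rw [mem_filter, mem_range] at hw
    refine ⟨w / d, mem_range.2 (Nat.div_lt_of_lt_mul hw.1), ?_⟩
    rw [← hw.2, ZMod.val_natCast, Nat.mod_add_div]

theorem sawZ_div_mul {m d : ℕ} [NeZero m] [NeZero d] (h : d ∣ m) (z : ℤ) :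
    sawZ m ((((m / d : ℕ) : ℤ) * z : ℤ) : ZMod m) = sawZ d z := by
  have hd : (d : ℚ) ≠ 0 := Nat.cast_ne_zero.2 (NeZero.ne d)
  have hm : (m : ℚ) ≠ 0 := Nat.cast_ne_zero.2 (NeZero.ne m)
  rw [sawZ_intCast, sawZ_intCast, Int.cast_mul, Int.cast_natCast, Nat.cast_div h hd]
  congr 2
  field_simp

/-- Writing `w = c + d k`, the sum over `k` collapses to `g` times a sawtooth value of level `d`,
which is a value of level `m` at a multiple of `m / d`. -/
theorem sum_saw_congr_mem_closure {m d K : ℕ} [NeZero m] [NeZero d] (hd : d ∣ m) (hK : 0 < K)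
    (a e : ℤ) : (fun u : (ZMod m)ˣ => ∑ w ∈ (range (d * K)).filter (fun w : ℕ =>
      (w : ZMod d) = ((e * ((u : ZMod m).val : ℤ) : ℤ) : ZMod d)),
        saw (-((a : ℚ) * w / (d * K : ℕ)))) ∈
      AddSubgroup.closure (Set.range (sawFun m)) := by
  have hd0 : (d : ℚ) ≠ 0 := Nat.cast_ne_zero.2 (NeZero.ne d)
  have hK0 : (K : ℚ) ≠ 0 := Nat.cast_ne_zero.2 hK.ne'
  obtain ⟨g, a', K', hK', ha, hKg, hsum⟩ := sum_saw_sub hK a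
  have ha0 : (a : ℚ) = g * a' := by exact_mod_cast ha
  have hKg0 : (K : ℚ) = g * K' := by exact_mod_cast hKg
  have hK'0 : (K' : ℚ) ≠ 0 := Nat.cast_ne_zero.2 hK'.ne'
  have hg0 : (g : ℚ) ≠ 0 := by rintro h; rw [h, zero_mul] at hKg0; exact hK0 hKg0
  have key (c : ℕ) : ∑ k ∈ range K, saw (-((a : ℚ) * (c + d * k : ℕ) / (d * K : ℕ))) =
      g * saw (-(((a' * c : ℤ) : ℚ) / d)) := by
    have h1 : (-(((a' * c : ℤ) : ℚ) / d)) = K' * (-((a : ℚ) * c / (d * K))) := by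
      rw [ha0, hKg0]; push_cast; field_simp
    rw [h1, ← hsum]
    refine sum_congr rfl fun k _ => ?_
    congr 1
    push_cast; field_simp; ring
  have h1 : (fun u : (ZMod m)ˣ => ∑ w ∈ (range (d * K)).filter (fun w : ℕ =>
      (w : ZMod d) = ((e * ((u : ZMod m).val : ℤ) : ℤ) : ZMod d)),
        saw (-((a : ℚ) * w / (d * K : ℕ)))) =
      g • sawFun m ((((m / d : ℕ) : ℤ) * (a' * e) : ℤ) : ZMod m) := by
    ext u
    rw [sum_range_filter_eq _ fun w : ℕ => saw (-((a : ℚ) * w / (d * K : ℕ))), key, Pi.smul_apply,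
      nsmul_eq_mul, sawFun]
    congr 1
    have h2 : ((((m / d : ℕ) : ℤ) * (a' * e) : ℤ) : ZMod m) * u =
        ((((m / d : ℕ) : ℤ) * (a' * (e * ((u : ZMod m).val : ℤ))) : ℤ) : ZMod m) := by
      have h3 : (u : ZMod m) = (((u : ZMod m).val : ℤ) : ZMod m) := by
        rw [Int.cast_natCast, ZMod.natCast_zmod_val]
      conv_lhs => rw [h3]
      rw [← Int.cast_mul]; congr 1; ring
    rw [h2, sawZ_div_mul hd, ← sawZ_intCast]
    congr 1
    rw [Int.cast_mul, Int.cast_mul a', Int.cast_natCast, ZMod.natCast_zmod_val]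
  rw [h1]
  exact AddSubgroup.nsmul_mem _ (AddSubgroup.subset_closure (Set.mem_range_self _)) g

theorem sum_divisors_moebius {n v : ℕ} (hn : 0 < n) :
    ∑ e ∈ n.divisors with e ∣ v, ArithmeticFunction.moebius e =
      if Nat.Coprime v n then 1 else 0 := by
  have hg : Nat.gcd v n ≠ 0 := (Nat.gcd_pos_of_pos_right _ hn).ne'
  have h1 : n.divisors.filter (fun e => e ∣ v) = (Nat.gcd v n).divisors := by
    ext e
    rw [mem_filter, Nat.mem_divisors, Nat.mem_divisors, Nat.dvd_gcd_iff, and_iff_left hn.ne',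
      and_iff_left hg, and_comm]
  rw [h1, ← ArithmeticFunction.coe_mul_zeta_apply, ArithmeticFunction.moebius_mul_coe_zeta,
    ArithmeticFunction.one_apply]

/-- The partial sums of the sawtooth function over units in a residue class lie in the group
spanned by its translates. -/
theorem sum_sawZ_unitsMap_mem_closure {m n d : ℕ} [NeZero m] [NeZero n] (hdm : d ∣ m)
    (hdn : d ∣ n) (a : ℤ) :
    (fun u : (ZMod m)ˣ => ∑ v : (ZMod n)ˣ with ZMod.unitsMap hdn v = ZMod.unitsMap hdm u,
      sawZ n (a * v)) ∈ AddSubgroup.closure (Set.range (sawFun m)) := by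
  have hn : 0 < n := NeZero.pos n
  have : NeZero d := ⟨fun h => NeZero.ne m (Nat.eq_zero_of_zero_dvd (h ▸ hdm))⟩
  -- Möbius inversion: the sum over `v` prime to `n` becomes an alternating sum over `e ∣ n` of sums
  -- over multiples of `e`.
  let S : ℕ → (ZMod m)ˣ → ℚ := fun e u => ∑ v ∈ (range n).filter (fun v : ℕ =>
    e ∣ v ∧ (v : ZMod d) = (((u : ZMod m).val : ℕ) : ZMod d)), saw (-((a : ℚ) * v / n))
  have h1 : (fun u : (ZMod m)ˣ => ∑ v : (ZMod n)ˣ with ZMod.unitsMap hdn v = ZMod.unitsMap hdm u,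
      sawZ n (a * v)) = ∑ e ∈ n.divisors, ArithmeticFunction.moebius e • S e := by
    ext u
    have h2 : ∑ v : (ZMod n)ˣ with ZMod.unitsMap hdn v = ZMod.unitsMap hdm u, sawZ n (a * v) =
        ∑ v ∈ (range n).filter (fun v : ℕ => Nat.Coprime v n ∧
          (v : ZMod d) = (((u : ZMod m).val : ℕ) : ZMod d)), saw (-((a : ℚ) * v / n)) := by
      refine sum_bij (fun v _ => (v : ZMod n).val) ?_ ?_ ?_ ?_
      · intro v hv
        have h3 := congrArg (fun w : (ZMod d)ˣ => (w : ZMod d)) (mem_filter.1 hv).2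
        simp only [ZMod.unitsMap_val] at h3
        rw [mem_filter, mem_range, ZMod.natCast_val, ZMod.natCast_val]
        exact ⟨ZMod.val_lt _, ZMod.val_coe_unit_coprime v, h3⟩
      · intro v _ v' _ h
        exact Units.ext (ZMod.val_injective n h)
      · intro v hv
        rw [mem_filter, mem_range] at hv
        refine ⟨ZMod.unitOfCoprime v hv.2.1, mem_filter.2 ⟨mem_univ _, ?_⟩, ?_⟩
        · ext
          rw [ZMod.unitsMap_val, ZMod.unitsMap_val, ZMod.coe_unitOfCoprime, ZMod.cast_natCast hdn,
            hv.2.2, ZMod.natCast_val]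
        · rw [ZMod.coe_unitOfCoprime, ZMod.val_cast_of_lt hv.1]
      · intro v _
        have h3 : (a : ZMod n) * v = ((a * ((v : ZMod n).val : ℤ) : ℤ) : ZMod n) := by
          rw [Int.cast_mul, Int.cast_natCast, ZMod.natCast_zmod_val]
        rw [h3, sawZ_intCast, Int.cast_mul, Int.cast_natCast]
    rw [h2, Finset.sum_apply]
    simp only [S, Pi.smul_apply, smul_sum, sum_filter]
    rw [sum_comm]
    refine sum_congr rfl fun v _ => ?_
    have h3 := sum_divisors_moebius (v := v) hn
    rw [sum_filter] at h3
    by_cases hv : (v : ZMod d) = (((u : ZMod m).val : ℕ) : ZMod d)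
    · simp only [hv, and_true]
      have h4 : ∑ e ∈ n.divisors, (if e ∣ v then
          ArithmeticFunction.moebius e • saw (-((a : ℚ) * v / n)) else 0) =
          (∑ e ∈ n.divisors, if e ∣ v then ArithmeticFunction.moebius e else 0) •
            saw (-((a : ℚ) * v / n)) := by
        rw [sum_smul]
        refine sum_congr rfl fun e _ => ?_
        split_ifs <;> simp
      have h5 : ∀ e : ℕ, (ArithmeticFunction.moebius e • if e ∣ v then
          saw (-((a : ℚ) * v / n)) else 0) = if e ∣ v then
          ArithmeticFunction.moebius e • saw (-((a : ℚ) * v / n)) else 0 := by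
        intro e; split_ifs <;> simp
      simp only [h5]
      rw [h4, h3]
      split_ifs <;> simp
    · simp only [hv, and_false, if_false, smul_zero, sum_const_zero]
  rw [h1]
  refine sum_mem fun e he => AddSubgroup.zsmul_mem _ ?_ _
  obtain ⟨N, rfl⟩ := Nat.dvd_of_mem_divisors he
  have he0 : 0 < e := Nat.pos_of_ne_zero fun h => by rw [h, zero_mul] at hn; omega
  have hN0 : 0 < N := Nat.pos_of_ne_zero fun h => by rw [h, mul_zero] at hn; omega
  -- If `e` is prime to `d`, then `d` divides `n / e`, and `v = e w` gives a complete progression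
  -- modulo `d` with `w` in the class of `e⁻¹ u`. Otherwise no multiple of `e` is congruent to a
  -- unit modulo `d`, and the sum is empty.
  by_cases hed : Nat.Coprime e d
  · obtain ⟨K, rfl⟩ : d ∣ N := hed.symm.dvd_of_dvd_mul_left hdn
    have hK : 0 < K := Nat.pos_of_mul_pos_left hN0
    let ε := ZMod.unitOfCoprime e hed
    obtain ⟨e', he'⟩ := ZMod.intCast_surjective ((ε⁻¹ : (ZMod d)ˣ) : ZMod d)
    convert sum_saw_congr_mem_closure hdm hK a e' using 1
    ext u
    symm
    refine sum_bij (fun w _ => e * w) ?_ ?_ ?_ ?_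
    · intro w hw
      rw [mem_filter, mem_range] at hw ⊢
      refine ⟨Nat.mul_lt_mul_of_pos_left hw.1 he0, dvd_mul_right _ _, ?_⟩
      have h3 : (e : ZMod d) = ε := (ZMod.coe_unitOfCoprime e hed).symm
      rw [Nat.cast_mul, hw.2, Int.cast_mul, he', h3, Units.mul_inv_cancel_left, Int.cast_natCast]
    · intro w _ w' _ h
      exact Nat.eq_of_mul_eq_mul_left he0 h
    · intro v hv
      rw [mem_filter, mem_range] at hv
      obtain ⟨hv1, ⟨w, rfl⟩, hv3⟩ := hv
      refine ⟨w, mem_filter.2 ⟨mem_range.2 (Nat.lt_of_mul_lt_mul_left hv1), ?_⟩, rfl⟩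
      have h3 : (e : ZMod d) = ε := (ZMod.coe_unitOfCoprime e hed).symm
      rw [Int.cast_mul, he', Int.cast_natCast, ← hv3, Nat.cast_mul, h3, Units.inv_mul_cancel_left]
    · intro w _
      have he0' : (e : ℚ) ≠ 0 := Nat.cast_ne_zero.2 he0.ne'
      congr 1
      push_cast
      field_simp
  · have h2 : S e = 0 := by
      ext u
      refine sum_eq_zero fun v hv => absurd ?_ hed
      obtain ⟨-, hv1, hv2⟩ := mem_filter.1 hv
      have h3 : IsUnit ((v : ℕ) : ZMod d) := by
        rw [hv2, ZMod.natCast_val, ← ZMod.unitsMap_val hdm]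
        exact Units.isUnit _
      rw [ZMod.isUnit_iff_coprime] at h3
      exact h3.coprime_dvd_left hv1
    rw [h2]; exact zero_mem _

end

end OddDistribution

/-! ### Sinnott's group in terms of sawtooth functions, and its bases -/

namespace OddDistribution

open Finset

noncomputable section

section Basis

variable {A : Type*} [AddCommGroup A] {κ : Type*}

theorem mk_mem_span_of_mem_closure {S : AddSubgroup A} {s : Set A} (t : Set S)
    (hst : ∀ x ∈ s, ∃ hx : x ∈ S, (⟨x, hx⟩ : S) ∈ t) {x : A} (hx : x ∈ AddSubgroup.closure s) :
    ∃ hx : x ∈ S, (⟨x, hx⟩ : S) ∈ Submodule.span ℤ t := by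
  induction hx using AddSubgroup.closure_induction with
  | mem x hx =>
    obtain ⟨h1, h2⟩ := hst x hx
    exact ⟨h1, Submodule.subset_span h2⟩
  | zero => exact ⟨zero_mem _, zero_mem (Submodule.span ℤ t)⟩
  | add x y _ _ hx hy =>
    obtain ⟨h1, h2⟩ := hx
    obtain ⟨h3, h4⟩ := hy
    exact ⟨add_mem h1 h3, add_mem h2 h4⟩
  | neg x _ hx =>
    obtain ⟨h1, h2⟩ := hx
    exact ⟨neg_mem h1, neg_mem h2⟩

theorem exists_basis_of_closure_eq {S : AddSubgroup A} {w : κ → A} (hli : LinearIndependent ℤ w)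
    (hS : AddSubgroup.closure (Set.range w) = S) :
    ∃ B : Module.Basis κ ℤ S, ∀ k, (B k : A) = w k := by
  have hmem (k : κ) : w k ∈ S := hS ▸ AddSubgroup.subset_closure ⟨k, rfl⟩
  have hli' : LinearIndependent ℤ fun k => (⟨w k, hmem k⟩ : S) :=
    LinearIndependent.of_comp S.subtype.toIntLinearMap hli
  refine ⟨Module.Basis.mk hli' ?_, fun k => by rw [Module.Basis.mk_apply]⟩
  rintro ⟨x, hx⟩ -
  obtain ⟨_, h⟩ := mk_mem_span_of_mem_closure (S := S)
    (Set.range fun k => (⟨w k, hmem k⟩ : S)) (s := Set.range w)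
    (by rintro _ ⟨k, rfl⟩; exact ⟨hmem k, k, rfl⟩) (hS ▸ hx)
  exact h

theorem repr_eq_zero_of_mem_closure {S : AddSubgroup A} (B : Module.Basis κ ℤ S) (K : Set κ)
    {x : A} (hx : x ∈ AddSubgroup.closure {y : A | ∃ k ∈ K, y = (B k : A)}) :
    ∃ hx : x ∈ S, ∀ k ∉ K, B.repr ⟨x, hx⟩ k = 0 := by
  obtain ⟨h1, h2⟩ := mk_mem_span_of_mem_closure (S := S) (B '' K)
    (by rintro _ ⟨k, hk, rfl⟩; exact ⟨(B k).2, k, hk, rfl⟩) hx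
  rw [Module.Basis.mem_span_image] at h2
  refine ⟨h1, fun k hk => ?_⟩
  by_contra h
  exact hk (h2 (Finsupp.mem_support_iff.2 h))

end Basis

section Sinnott

open Stickelberger

/-- The group of functions corresponding to Sinnott's group. -/
def sawGroup (m : ℕ) : AddSubgroup ((ZMod m)ˣ → ℚ) :=
  AddSubgroup.closure (insert (fun _ => 1 / 2) (Set.range (sawFun m)))

theorem half_mem_sawGroup (m : ℕ) : (fun _ => 1 / 2 : (ZMod m)ˣ → ℚ) ∈ sawGroup m :=
  AddSubgroup.subset_closure (Set.mem_insert _ _)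

theorem sawFun_mem_sawGroup (m : ℕ) (a : ZMod m) : sawFun m a ∈ sawGroup m :=
  AddSubgroup.subset_closure (Set.mem_insert_of_mem _ (Set.mem_range_self _))

/-- Fractional parts are sawtooth values plus `1/2`, and all fibres of the reduction map have the
same size, so the halves add up to an integral multiple of the constant `1/2`. -/
theorem sum_fractZ_mem_sawGroup {m n d : ℕ} [NeZero m] [NeZero n] (hdm : d ∣ m) (hdn : d ∣ n)
    (a : ℤ) : (fun u : (ZMod m)ˣ => ∑ v : (ZMod n)ˣ with ZMod.unitsMap hdn v = ZMod.unitsMap hdm u,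
      fractZ n (a * v)) ∈ sawGroup m := by
  by_cases ha : (a : ZMod n) = 0
  · have h1 : (fun u : (ZMod m)ˣ => ∑ v : (ZMod n)ˣ with
        ZMod.unitsMap hdn v = ZMod.unitsMap hdm u, fractZ n (a * v)) = 0 := by
      ext u
      refine sum_eq_zero fun v _ => ?_
      rw [ha, zero_mul, fractZ_zero]
    rw [h1]; exact zero_mem _
  · have : NeZero d := ⟨fun h => NeZero.ne m (Nat.eq_zero_of_zero_dvd (h ▸ hdm))⟩
    have h1 : (fun u : (ZMod m)ˣ => ∑ v : (ZMod n)ˣ with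
        ZMod.unitsMap hdn v = ZMod.unitsMap hdm u, fractZ n (a * v)) =
        (fun u : (ZMod m)ˣ => ∑ v : (ZMod n)ˣ with
          ZMod.unitsMap hdn v = ZMod.unitsMap hdm u, sawZ n (a * v)) +
        #(univ.filter fun v : (ZMod n)ˣ => ZMod.unitsMap hdn v = 1) •
          (fun _ => 1 / 2 : (ZMod m)ˣ → ℚ) := by
      ext u
      rw [Pi.add_apply, Pi.smul_apply,
        ← MonoidHom.card_fiber_eq_of_mem_range (ZMod.unitsMap hdn)
          (ZMod.unitsMap_surjective hdn (ZMod.unitsMap hdm u)) (ZMod.unitsMap_surjective hdn 1),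
        ← sum_const, ← sum_add_distrib]
      refine sum_congr rfl fun v _ => fractZ_eq ?_
      rwa [Ne, Units.mul_left_eq_zero]
    rw [h1]
    refine add_mem ?_ (AddSubgroup.nsmul_mem _ (half_mem_sawGroup m) _)
    exact AddSubgroup.closure_mono (Set.subset_insert _ _)
      (sum_sawZ_unitsMap_mem_closure hdm hdn a)

theorem unitsMap_eq_unitsMap_iff {m d : ℕ} (h h' : d ∣ m) (hd : d = m) (u v : (ZMod m)ˣ) :
    ZMod.unitsMap h v = ZMod.unitsMap h' u ↔ v = u := by
  subst hd
  rw [ZMod.unitsMap_self]; rfl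

theorem thetaRel_self {m : ℕ} [NeZero m] (a : ℤ) : thetaRel m m a = theta m a := by
  rw [thetaRel_eq, theta_eq]
  congr 1
  ext u
  simp only [unitsMap_eq_unitsMap_iff _ _ (Nat.gcd_self m), filter_eq', mem_univ, if_true,
    sum_singleton]

/-- The unit group modulo `2` is trivial and the only coefficient is `⟨-1/2⟩ = 1/2`; this puts `½
N_m` into Sinnott's group. -/
theorem thetaRel_two_one (m : ℕ) [NeZero m] : thetaRel m 2 1 = toQG m fun _ => 1 / 2 := by
  rw [thetaRel_eq]
  congr 1
  ext u
  have h1 : (univ.filter fun v : (ZMod 2)ˣ => ZMod.unitsMap (Nat.gcd_dvd_right m 2) v =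
      ZMod.unitsMap (Nat.gcd_dvd_left m 2) u) = {1} := by
    ext v
    have hv : v = 1 := Subsingleton.elim _ _
    obtain ⟨w, hw⟩ := ZMod.unitsMap_surjective (Nat.gcd_dvd_right m 2)
      (ZMod.unitsMap (Nat.gcd_dvd_left m 2) u)
    have hw1 : w = 1 := Subsingleton.elim _ _
    rw [mem_filter, mem_singleton, ← hw, hw1, hv]
    exact iff_of_true ⟨mem_univ _, rfl⟩ rfl
  rw [h1, sum_singleton, Units.val_one, mul_one, fractZ_intCast]
  norm_num [Int.fract_eq_iff]

theorem sinnott_eq_map (m : ℕ) [NeZero m] :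
    sinnott m = (sawGroup m).map (toQG m).toAddMonoidHom := by
  have hhalf : toQG m (fun _ => 1 / 2) ∈ sinnott m :=
    AddSubgroup.subset_closure ⟨2, inferInstance, 1, (thetaRel_two_one m).symm⟩
  apply le_antisymm
  · rw [sinnott, AddSubgroup.closure_le]
    rintro _ ⟨n, hn, a, rfl⟩
    rw [thetaRel_eq]
    exact ⟨_, sum_fractZ_mem_sawGroup _ _ a, rfl⟩
  · rw [sawGroup, AddMonoidHom.map_closure, AddSubgroup.closure_le]
    rintro _ ⟨_, rfl | ⟨a, rfl⟩, rfl⟩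
    · exact hhalf
    · obtain ⟨b, rfl⟩ := ZMod.intCast_surjective a
      change toQG m (sawFun m b) ∈ sinnott m
      rw [← omega_eq, omega]
      split_ifs with h
      · exact zero_mem _
      · refine sub_mem (AddSubgroup.subset_closure ⟨m, inferInstance, b, (thetaRel_self b).symm⟩) ?_
        rw [normElt_eq, ← map_smul]
        convert hhalf using 2
        ext u; simp

/-- A generating family of at most `φ(m)/2 + 1` members is independent over `ℂ` by the character
count, hence over `ℤ`. -/
theorem linearIndependent_of_closure_eq {m : ℕ} [NeZero m] (hm : 2 < m) {κ : Type*} [Fintype κ]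
    {v : κ → (ZMod m)ˣ → ℚ} (hcard : 2 * Fintype.card κ ≤ Nat.totient m + 2)
    (hv : AddSubgroup.closure (Set.range v) = sawGroup m) :
    LinearIndependent ℤ fun k => toQG m (v k) := by
  let φ : ((ZMod m)ˣ → ℚ) →+ ((ZMod m)ˣ → ℂ) :=
    { toFun := fun f u => (f u : ℂ)
      map_zero' := by ext u; simp
      map_add' := fun f g => by ext u; simp }
  have hspan : ∀ f ∈ sawGroup m, φ f ∈ Submodule.span ℂ (Set.range fun k => φ (v k)) := by
    intro f hf
    rw [← hv] at hf
    have h1 := AddSubgroup.mem_map_of_mem φ hf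
    rw [AddMonoidHom.map_closure] at h1
    have h2 : AddSubgroup.closure (φ '' Set.range v) ≤
        (Submodule.span ℂ (Set.range fun k => φ (v k))).toAddSubgroup := by
      rw [AddSubgroup.closure_le]
      rintro _ ⟨_, ⟨k, rfl⟩, rfl⟩
      exact Submodule.subset_span ⟨k, rfl⟩
    exact h2 h1
  have h1 : LinearIndependent ℂ fun k => φ (v k) := by
    refine linearIndependent_of_forall_mem_span hm hcard ?_ fun a =>
      hspan _ (sawFun_mem_sawGroup m a)
    have h2 := Submodule.smul_mem _ (2 : ℂ) (hspan _ (half_mem_sawGroup m))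
    convert h2 using 1
    ext u
    simp [φ]
  have h2 : LinearIndependent ℤ fun k => φ (v k) :=
    h1.restrict_scalars (fun a b hab => by simpa using hab)
  have h3 : LinearIndependent ℤ v := LinearIndependent.of_comp φ.toIntLinearMap h2
  exact h3.map_injOn ((toQG m).toAddMonoidHom.toIntLinearMap) ((toQG_injective m).injOn)

end Sinnott

end

end OddDistribution

open OddDistribution in
theorem mainTheorem7 (m : ℕ) [NeZero m] (hm : 1 < m) (hm2 : m % 4 ≠ 2)
    (t : ℕ) (q : Fin t → ℕ) (hq : ∀ i, IsPrimePow (q i))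
    (hcop : ∀ i j, i ≠ j → Nat.Coprime (q i) (q j)) (hprod : m = ∏ i, q i) :
    (∃ B : Module.Basis (Option (Stickelberger.setM' m q)) ℤ (Stickelberger.sinnott m),
      (∀ a : Stickelberger.setM' m q,
        (B (some a) : Stickelberger.QG m) = Stickelberger.omega m (a : ℕ)) ∧
      (B none : Stickelberger.QG m) = (1 / 2 : ℚ) • Stickelberger.normElt m ∧
      ∀ b : ℕ, 0 < b → b < m → ∃ hb : Stickelberger.omega m b ∈ Stickelberger.sinnott m,
        ∀ a : Stickelberger.setM' m q, ¬ Stickelberger.rPart q b ∣ (a : ℕ) →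
          B.repr ⟨Stickelberger.omega m b, hb⟩ (some a) = 0) ∧
    (∃ B : Module.Basis (Option (Stickelberger.setM' m q)) ℤ (Stickelberger.sinnott m),
      (∀ a : Stickelberger.setM' m q,
        (B (some a) : Stickelberger.QG m) = Stickelberger.theta m (a : ℕ)) ∧
      (B none : Stickelberger.QG m) = (1 / 2 : ℚ) • Stickelberger.normElt m ∧
      ∀ b : ℕ, 0 < b → b < m → ∃ hb : Stickelberger.theta m b ∈ Stickelberger.sinnott m,
        ∀ a : Stickelberger.setM' m q, ¬ Stickelberger.rPart q b ∣ (a : ℕ) →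
          B.repr ⟨Stickelberger.theta m b, hb⟩ (some a) = 0) := by
  have hne : ∀ i, NeZero (q i) := fun i => ⟨(hq i).ne_zero⟩
  have hone : ∀ i, Fact (1 < q i) := fun i => ⟨(hq i).one_lt⟩
  have hdvd : ∀ i, q i ∣ m := fun i => hprod ▸ Finset.dvd_prod_of_mem q (Finset.mem_univ i)
  -- If some `q i` were `2`, then `m / 2` would be odd, which is the excluded class modulo `4`.
  have hq2 : ∀ i, 2 < q i := by
    intro i
    by_contra h
    have h1 := (hq i).one_lt
    have h2 : q i = 2 := by omega
    have h3 := coprime_div_self hcop hprod i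
    have h4 := hdvd i
    rw [h2] at h3 h4
    have h5 : Odd (m / 2) := Nat.coprime_two_right.1 h3
    rw [Nat.odd_iff] at h5
    omega
  have hm' : 2 < m := by
    refine lt_of_le_of_ne hm fun h => hm2 (by rw [← h])
  have hfin := (finite_setM' (q := q) hprod)
  let _ : Fintype (Stickelberger.setM' m q) := hfin.fintype
  have hcard : 2 * Fintype.card (Option (Stickelberger.setM' m q)) ≤ Nat.totient m + 2 := by
    have h1 := two_mul_ncard_setM'_le hcop hprod hq hq2 hm
    rw [Fintype.card_option, Fintype.card_eq_nat_card, Nat.card_coe_set_eq]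
    omega
  let half : (ZMod m)ˣ → ℚ := fun _ => 1 / 2
  have hhalf : toQG m half = (1 / 2 : ℚ) • Stickelberger.normElt m := by
    rw [normElt_eq, ← map_smul]; congr 1; ext u; simp [half]
  have hgen := sawFun_mem_closure_setM' hcop hprod hq hq2
  have hne0 (b : ℕ) (h0 : 0 < b) (hb : b < m) : (b : ZMod m) ≠ 0 := by
    rw [Ne, ZMod.natCast_eq_zero_iff]
    exact fun h => absurd (Nat.le_of_dvd h0 h) (not_le.2 hb)
  have htheta (b : ℕ) (h0 : 0 < b) (hb : b < m) :
      Stickelberger.theta m b = toQG m (sawFun m b + half) := by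
    rw [theta_eq]
    congr 1
    ext u
    rw [Int.cast_natCast, fractZ_eq (by rw [Ne, Units.mul_left_eq_zero]; exact hne0 b h0 hb)]
    rfl
  -- Both parts at once: `v (some a)` will be the sawtooth function of `a`, or that function plus
  -- `1/2`, and `x` is the corresponding shift of the element to be expanded.
  have hbasis (v : Option (Stickelberger.setM' m q) → (ZMod m)ˣ → ℚ)
      (hnone : v none = half)
      (hmem : ∀ a : Stickelberger.setM' m q, v (some a) ∈ sawGroup m)
      (hsaw : ∀ a : Stickelberger.setM' m q,
        sawFun m (a : ℕ) ∈ AddSubgroup.closure {y | ∃ k ∈ ({none, some a} : Set _), y = v k}) :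
      ∃ B : Module.Basis (Option (Stickelberger.setM' m q)) ℤ (Stickelberger.sinnott m),
        (∀ k, (B k : Stickelberger.QG m) = toQG m (v k)) ∧
        ∀ b : ℕ, ∀ x ∈ ({0, half} : Set ((ZMod m)ˣ → ℚ)),
          ∃ hb : toQG m (sawFun m b + x) ∈ Stickelberger.sinnott m,
          ∀ a : Stickelberger.setM' m q, ¬ Stickelberger.rPart q b ∣ (a : ℕ) →
            B.repr ⟨toQG m (sawFun m b + x), hb⟩ (some a) = 0 := by
    have hclosure : AddSubgroup.closure (Set.range v) = sawGroup m := by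
      apply le_antisymm
      · rw [AddSubgroup.closure_le]
        rintro _ ⟨_ | a, rfl⟩
        · rw [hnone]; exact half_mem_sawGroup m
        · exact hmem a
      · rw [sawGroup, AddSubgroup.closure_le]
        rintro _ (rfl | ⟨a, rfl⟩)
        · exact AddSubgroup.subset_closure ⟨none, hnone⟩
        · have h1 := hgen a.val
          rw [ZMod.natCast_zmod_val] at h1
          refine (AddSubgroup.closure_le _).2 ?_ h1
          rintro _ ⟨c, hc, -, rfl⟩
          refine AddSubgroup.closure_mono ?_ (hsaw ⟨c, hc⟩)
          rintro _ ⟨k, -, rfl⟩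
          exact ⟨k, rfl⟩
    have hclosure' : AddSubgroup.closure (Set.range fun k => toQG m (v k)) =
        Stickelberger.sinnott m := by
      rw [sinnott_eq_map, ← hclosure, AddMonoidHom.map_closure, ← Set.range_comp]
      rfl
    obtain ⟨B, hB⟩ := exists_basis_of_closure_eq
      (linearIndependent_of_closure_eq hm' hcard hclosure) hclosure'
    refine ⟨B, hB, fun b x hx => ?_⟩
    -- The indices that may occur in the expansion. The constant always may, so passing between `ω`
    -- and `θ` does not disturb the support condition.
    let K : Set (Option (Stickelberger.setM' m q)) :=
      {k | ∀ a, k = some a → ∀ i, q i ∣ b → q i ∣ (a : ℕ)}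
    have hKnone : none ∈ K := fun a h => by cases h
    have h1 : sawFun m b + x ∈ AddSubgroup.closure {y | ∃ k ∈ K, y = v k} := by
      refine add_mem ((AddSubgroup.closure_le _).2 ?_ (hgen b)) ?_
      · rintro _ ⟨c, hc, hbc, rfl⟩
        refine AddSubgroup.closure_mono ?_ (hsaw ⟨c, hc⟩)
        rintro _ ⟨k, rfl | rfl, rfl⟩
        · exact ⟨none, hKnone, rfl⟩
        · refine ⟨some ⟨c, hc⟩, fun a h => ?_, rfl⟩
          cases h
          exact hbc
      · rcases hx with rfl | rfl
        · exact zero_mem _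
        · exact AddSubgroup.subset_closure ⟨none, hKnone, hnone.symm⟩
    have h2 := AddSubgroup.mem_map_of_mem (toQG m).toAddMonoidHom h1
    rw [AddMonoidHom.map_closure] at h2
    have h3 : (toQG m).toAddMonoidHom '' {y | ∃ k ∈ K, y = v k} ⊆
        {y | ∃ k ∈ K, y = (B k : Stickelberger.QG m)} := by
      rintro _ ⟨_, ⟨k, hk, rfl⟩, rfl⟩
      exact ⟨k, hk, (hB k).symm⟩
    obtain ⟨hb, hrep⟩ := repr_eq_zero_of_mem_closure B K (AddSubgroup.closure_mono h3 h2)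
    refine ⟨hb, fun a ha => hrep _ fun hK => ha ?_⟩
    exact rPart_dvd hcop (hK a rfl)
  constructor
  · obtain ⟨B, hB, hrep⟩ := hbasis (fun k => k.elim half fun a => sawFun m (a : ℕ)) rfl
      (fun a => sawFun_mem_sawGroup m _)
      (fun a => AddSubgroup.subset_closure ⟨some a, Or.inr rfl, rfl⟩)
    refine ⟨B, fun a => ?_, ?_, fun b h0 hb => ?_⟩
    · rw [hB, omega_eq, Int.cast_natCast]; rfl
    · rw [hB]; exact hhalf
    · have h1 := hrep b 0 (Or.inl rfl)
      have h2 : Stickelberger.omega m b = toQG m (sawFun m b + 0) := by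
        rw [omega_eq, Int.cast_natCast, add_zero]
      simp only [h2]
      exact h1
  · obtain ⟨B, hB, hrep⟩ := hbasis (fun k => k.elim half fun a => sawFun m (a : ℕ) + half) rfl
      (fun a => add_mem (sawFun_mem_sawGroup m _) (half_mem_sawGroup m))
      (fun a => by
        have h1 : sawFun m (a : ℕ) = (sawFun m (a : ℕ) + half) - half := by abel
        rw [h1]
        exact sub_mem (AddSubgroup.subset_closure ⟨some a, Or.inr rfl, rfl⟩)
          (AddSubgroup.subset_closure ⟨none, Or.inl rfl, rfl⟩))
    refine ⟨B, fun a => ?_, ?_, fun b h0 hb => ?_⟩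
    · obtain ⟨h0, ha⟩ := pos_lt_of_mem_setM' hprod a.2
      rw [hB, htheta _ h0 ha]; rfl
    · rw [hB]; exact hhalf
    · have h1 := hrep b half (Or.inr rfl)
      simp only [htheta b h0 hb]
      exact h1
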